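/- **Setting.** Write $\pi(z)\varphi(t)=e^{2\pi i z_2\cdot t}\varphi(t-z_1)$ for $z=(z_1,z_2)$, $v_s(z)=(1+|z|^2)^{s/2}$ for $z\in\mathbb R^{2d}$, $s\in\mathbb R$, and $$\|F\|_{L^{p,q}_{v_s}}=\Big(\int_{\mathbb R^d}\Big(\int_{\mathbb R^d}|F(x,\omega)|^p v_s(x,\omega)^p\,dx\Big)^{q/p}d\omega\Big)^{1/q},\qquad 0<p,q\le\infty,$$ with essential suprema if $p=\infty$ or $q=\infty$. A tempered distribution on $\mathbb R^{2d}$ belongs to $L^{p,q}_{v_s}(\mathbb R^{2d})$ if it is given by a measurable function of finite $L^{p,q}_{v_s}$-norm. Fix a non-zero window $\varphi\in\mathcal S(\mathbb R^d)$; $M^{p,q}_{v_s}(\mathbb R^d)$ is the space of $f\in\mathcal S'(\mathbb R^d)$ with $\|f\|_{M^{p,q}_{v_s}}=\|V_\varphi f\|_{L^{p,q}_{v_s}}<\infty$, where $V_\varphi f(z)=\langle f,\pi(z)\varphi\rangle$, and $M^1_{v_s}=M^{1,1}_{v_s}$. For a symplectic matrix $\mathcal A\in Sp(2d,\mathbb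 R)$ let $\mu(\mathcal A)$ be the metaplectic operator on $L^2(\mathbb R^{2d})$ (defined up to a phase factor), i.e. the unitary operator with $\mu(\mathcal A)\pi(\zeta)=c\,\pi(\mathcal A\zeta)\mu(\mathcal A)$, $|c|=1$, for all $\zeta\in\mathbb R^{4d}$; it restricts to $\mathcal S(\mathbb R^{2d})$ and extends to $\mathcal S'(\mathbb R^{2d})$. Put $W_{\mathcal A}(f,g)=\mu(\mathcal A)(f\otimes\bar g)$ for $f,g\in\mathcal S'(\mathbb R^d)$. Let $\mathcal F_2F(x,\omega)=\int e^{-2\pi i y\cdot\omega}F(x,y)\,dy$ and $\mathfrak T_LF(z)=|\det L|^{1/2}F(Lz)$. **Theorem.** Let $\mathcal A\in Sp(2d,\mathbb R)$ be such that: * $\mathcal A$ is covariant, i.e., in $d\times d$ blocks, with $A_{13},A_{21}$ symmetric, $$\mathcal A=\begin{pmatrix}A_{11}&I-A_{11}&A_{13}&A_{13}\\A_{21}&-A_{21}&I-A_{11}^T&-A_{11}^T\\0&0&I&I\\-I&I&0&0\end{pmatrix};$$ * $\mu(\mathcal A)=\mathcal F_2\mathfrak T_L$ up to a phase factor, for some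 invertible real $2d\times 2d$ matrix $L$; * $W_{\mathcal A}$ is shift-invertible: there is $E\in GL(2d,\mathbb R)$ with $|W_{\mathcal A}(\pi(w)f,g)(z)|=|W_{\mathcal A}(f,g)(z-Ew)|$ for all $f,g\in L^2(\mathbb R^d)$ and $w\in\mathbb R^{2d}$ (for almost all $z$). Then $A_{11}$ and $I-A_{11}$ are invertible. Moreover, for all $0<p,q\le\infty$, all $s\in\mathbb R$ and every non-zero $g\in\mathcal S(\mathbb R^d)$, one has for $f\in\mathcal S'(\mathbb R^d)$ $$f\in M^{p,q}_{v_s}(\mathbb R^d)\iff W_{\mathcal A}(f,g)\in L^{p,q}_{v_s}(\mathbb R^{2d}),$$ with equivalence of norms: there is $C>0$, independent of $f$, such that $C^{-1}\|f\|_{M^{p,q}_{v_s}}\le\|W_{\mathcal A}(f,g)\|_{L^{p,q}_{v_s}}\le C\|f\|_{M^{p,q}_{v_s}}$ (a norm being $\infty$ off the corresponding space). If $1\le p,q\le\infty$, the same holds for every non-zero window $g$ in the larger class $M^1_{v_{|s|}}(\mathbb R^d)$ (that is, $M^1_{v_s}(\mathbb R^d)$ when $s\ge 0$). -/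

import Mathlib

noncomputable section
namespace TFA

open SchwartzMap MeasureTheory
open scoped ENNReal NNReal ContDiff LineDeriv

/-- The point `(x, y) ∈ ℝ²ᵈ` with blocks `x, y ∈ ℝᵈ`. -/
def pair {d : ℕ} (x y : EuclideanSpace ℝ (Fin d)) : EuclideanSpace ℝ (Fin d ⊕ Fin d) :=
  WithLp.toLp 2 (Sum.elim x y)

/-- The first block of a vector with two blocks. -/
def fstPart {ι : Type} (z : EuclideanSpace ℝ (ι ⊕ ι)) : EuclideanSpace ℝ ι :=
  WithLp.toLp 2 (fun i => z (Sum.inl i))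

/-- The second block of a vector with two blocks. -/
def sndPart {ι : Type} (z : EuclideanSpace ℝ (ι ⊕ ι)) : EuclideanSpace ℝ ι :=
  WithLp.toLp 2 (fun i => z (Sum.inr i))

theorem norm_pair_sq {d : ℕ} (x y : EuclideanSpace ℝ (Fin d)) :
    ‖pair x y‖ ^ 2 = ‖x‖ ^ 2 + ‖y‖ ^ 2 := by
  simp [EuclideanSpace.norm_sq_eq, pair]

theorem norm_left_le_pair {d : ℕ} (x y : EuclideanSpace ℝ (Fin d)) : ‖x‖ ≤ ‖pair x y‖ :=
  le_of_sq_le_sq (by rw [norm_pair_sq]; nlinarith [sq_nonneg ‖y‖]) (norm_nonneg _)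

theorem norm_right_le_pair {d : ℕ} (x y : EuclideanSpace ℝ (Fin d)) : ‖y‖ ≤ ‖pair x y‖ :=
  le_of_sq_le_sq (by rw [norm_pair_sq]; nlinarith [sq_nonneg ‖x‖]) (norm_nonneg _)

/-- The embedding `x ↦ (x, 0)`. -/
def inlL (d : ℕ) : EuclideanSpace ℝ (Fin d) →L[ℝ] EuclideanSpace ℝ (Fin d ⊕ Fin d) :=
  LinearMap.mkContinuous
    { toFun := fun x => pair x 0
      map_add' := fun x y => by ext i; cases i <;> simp [pair]
      map_smul' := fun c x => by ext i; cases i <;> simp [pair] } 1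
    (fun x => by
      have h := norm_pair_sq x 0
      have : ‖pair x 0‖ = ‖x‖ := by
        rw [← sq_eq_sq₀ (norm_nonneg _) (norm_nonneg _), h]; simp
      simp [this])

/-- The embedding `y ↦ (0, y)`. -/
def inrL (d : ℕ) : EuclideanSpace ℝ (Fin d) →L[ℝ] EuclideanSpace ℝ (Fin d ⊕ Fin d) :=
  LinearMap.mkContinuous
    { toFun := fun x => pair 0 x
      map_add' := fun x y => by ext i; cases i <;> simp [pair]
      map_smul' := fun c x => by ext i; cases i <;> simp [pair] } 1
    (fun x => by
      have h := norm_pair_sq 0 x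
      have : ‖pair 0 x‖ = ‖x‖ := by
        rw [← sq_eq_sq₀ (norm_nonneg _) (norm_nonneg _), h]; simp
      simp [this])

theorem pair_eq {d : ℕ} (x y : EuclideanSpace ℝ (Fin d)) : pair x y = inlL d x + inrL d y := by
  ext i; cases i <;> simp [pair, inlL, inrL]

theorem norm_inlL_le (d : ℕ) (x : EuclideanSpace ℝ (Fin d)) : ‖inlL d x‖ ≤ ‖x‖ := by
  simpa using (inlL d).le_of_opNorm_le (LinearMap.mkContinuous_norm_le _ zero_le_one _) x

theorem norm_inrL_le_one (d : ℕ) : ‖inrL d‖ ≤ 1 :=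
  LinearMap.mkContinuous_norm_le _ zero_le_one _

/-- The slice `Φ(x, ·)` of a Schwartz function `Φ` on `ℝ²ᵈ`. -/
def slice {d : ℕ} (x : EuclideanSpace ℝ (Fin d)) :
    𝓢(EuclideanSpace ℝ (Fin d ⊕ Fin d), ℂ) →L[ℂ] 𝓢(EuclideanSpace ℝ (Fin d), ℂ) :=
  SchwartzMap.compCLM ℂ (g := fun y => inlL d x + inrL d y)
    ((Function.HasTemperateGrowth.const _).add (inrL d).hasTemperateGrowth)
    ⟨1, 1, fun y => by
      have := norm_right_le_pair x y
      rw [pair_eq] at this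
      simp only [pow_one, one_mul]; linarith⟩

theorem slice_apply {d : ℕ} (x : EuclideanSpace ℝ (Fin d))
    (Φ : 𝓢(EuclideanSpace ℝ (Fin d ⊕ Fin d), ℂ)) (y : EuclideanSpace ℝ (Fin d)) :
    slice x Φ y = Φ (pair x y) := by
  rw [pair_eq]; rfl

theorem norm_iteratedFDeriv_slice_le {d : ℕ} (x : EuclideanSpace ℝ (Fin d))
    (Φ : 𝓢(EuclideanSpace ℝ (Fin d ⊕ Fin d), ℂ)) (j : ℕ) (y : EuclideanSpace ℝ (Fin d)) :
    ‖iteratedFDeriv ℝ j (slice x Φ) y‖ ≤ ‖iteratedFDeriv ℝ j Φ (pair x y)‖ := by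
  have h1 : (slice x Φ : EuclideanSpace ℝ (Fin d) → ℂ)
      = (fun w => Φ (w + inlL d x)) ∘ (inrL d) := by
    funext y; rw [slice_apply, pair_eq, add_comm]; rfl
  have h2 : ContDiff ℝ ∞ (fun w => Φ (w + inlL d x)) :=
    (Φ.smooth ⊤).comp (contDiff_id.add contDiff_const)
  rw [h1, (inrL d).iteratedFDeriv_comp_right h2 y (i := j) (mod_cast le_top),
    iteratedFDeriv_comp_add_right, pair_eq, add_comm]
  refine (ContinuousMultilinearMap.norm_compContinuousLinearMap_le _ _).trans ?_
  refine mul_le_of_le_one_right (norm_nonneg _) ?_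
  exact Finset.prod_le_one (fun _ _ => norm_nonneg _) (fun _ _ => norm_inrL_le_one d)

theorem taylor_aux {P : Type} [NormedAddCommGroup P] [NormedSpace ℝ P] (j : ℕ) :
    ∀ {F : Type} [NormedAddCommGroup F] [NormedSpace ℝ F] (Φ : P → F) (_ : ContDiff ℝ ∞ Φ)
      (z v : P) (C : ℝ)
      (_ : ∀ t ∈ Set.Icc (0 : ℝ) 1, ‖iteratedFDeriv ℝ (j + 2) Φ (z + t • v)‖ ≤ C),
      ‖iteratedFDeriv ℝ j (fun w => Φ (w + v) - Φ w - fderiv ℝ Φ w v) z‖ ≤ C * ‖v‖ ^ 2 := by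
  induction j with
  | zero =>
    intro F _ _ Φ hΦ z v C hC
    have hC0 : 0 ≤ C := (norm_nonneg _).trans (hC 0 (by simp))
    rw [norm_iteratedFDeriv_zero]
    have hd : ContDiff ℝ ∞ (fderiv ℝ Φ) := hΦ.fderiv_right (by simp)
    have hseg : ∀ y ∈ segment ℝ z (z + v), ∃ t ∈ Set.Icc (0 : ℝ) 1, y = z + t • v := by
      intro y hy
      rw [segment_eq_image'] at hy
      obtain ⟨t, ht, rfl⟩ := hy
      exact ⟨t, ht, by simp⟩
    have h1 : ∀ y ∈ segment ℝ z (z + v), ‖fderiv ℝ (fderiv ℝ Φ) y‖ ≤ C := by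
      intro y hy
      obtain ⟨t, ht, rfl⟩ := hseg y hy
      have := hC t ht
      rwa [show (0 + 2 : ℕ) = 1 + 1 from rfl, ← norm_iteratedFDeriv_fderiv,
        ← zero_add 1, ← norm_iteratedFDeriv_fderiv, norm_iteratedFDeriv_zero] at this
    have h2 : ∀ y ∈ segment ℝ z (z + v), ‖fderiv ℝ Φ y - fderiv ℝ Φ z‖ ≤ C * ‖v‖ := by
      intro y hy
      have h3 := (convex_segment z (z + v)).norm_image_sub_le_of_norm_fderiv_le
        (fun x _ => (hd.differentiable (by simp)).differentiableAt) h1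
        (left_mem_segment ℝ z (z + v)) hy
      refine h3.trans ?_
      obtain ⟨t, ht, rfl⟩ := hseg y hy
      gcongr
      simp only [add_sub_cancel_left, norm_smul, Real.norm_eq_abs, abs_of_nonneg ht.1]
      exact mul_le_of_le_one_left (norm_nonneg _) ht.2
    have h4 := (convex_segment z (z + v)).norm_image_sub_le_of_norm_fderiv_le'
        (fun x _ => (hΦ.differentiable (by simp)).differentiableAt) h2
        (left_mem_segment ℝ z (z + v)) (right_mem_segment ℝ z (z + v))
    simpa [pow_two, mul_assoc] using h4
  | succ j ih =>
    intro F _ _ Φ hΦ z v C hC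
    have hd : ContDiff ℝ ∞ (fderiv ℝ Φ) := hΦ.fderiv_right (by simp)
    have key : fderiv ℝ (fun w => Φ (w + v) - Φ w - fderiv ℝ Φ w v)
        = fun w => fderiv ℝ Φ (w + v) - fderiv ℝ Φ w - fderiv ℝ (fderiv ℝ Φ) w v := by
      funext w
      have d1 : HasFDerivAt (fun w => Φ (w + v)) (fderiv ℝ Φ (w + v)) w := by
        have := (hΦ.differentiable (by simp) (w + v)).hasFDerivAt
        exact (hasFDerivAt_comp_add_right v).2 this
      have d2 : HasFDerivAt Φ (fderiv ℝ Φ w) w :=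
        (hΦ.differentiable (by simp) w).hasFDerivAt
      have d3 : HasFDerivAt (fun w => fderiv ℝ Φ w v) (fderiv ℝ (fderiv ℝ Φ) w v) w := by
        have h := (hd.differentiable (by simp) w).hasFDerivAt.clm_apply (hasFDerivAt_const v w)
        convert h using 1
        ext u
        have hs : IsSymmSndFDerivAt ℝ Φ w := hΦ.contDiffAt.isSymmSndFDerivAt (by
          simpa using (show ((2 : ℕ∞) : WithTop ℕ∞) ≤ ((⊤ : ℕ∞) : WithTop ℕ∞) from
            WithTop.coe_le_coe.2 le_top))
        simpa using (hs v u)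
      exact ((d1.sub d2).sub d3).fderiv
    rw [← norm_iteratedFDeriv_fderiv, key]
    refine ih (fderiv ℝ Φ) hd z v C ?_
    intro t ht
    rw [norm_iteratedFDeriv_fderiv]
    exact hC t ht

/-- A tempered distribution is bounded by a finite family of Schwartz seminorms. -/
theorem exists_bound {d : ℕ} (g : 𝓢'(EuclideanSpace ℝ (Fin d), ℂ)) :
    ∃ (s : Finset (ℕ × ℕ)) (C : ℝ), 0 ≤ C ∧ ∀ ψ : 𝓢(EuclideanSpace ℝ (Fin d), ℂ),
      ‖g ψ‖ ≤ C * ∑ m ∈ s, SchwartzMap.seminorm ℝ m.1 m.2 ψ := by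
  obtain ⟨s, C, -, h⟩ := Seminorm.bound_of_continuous (schwartz_withSeminorms ℂ _ ℂ)
    ((normSeminorm ℂ ℂ).comp (g : 𝓢(EuclideanSpace ℝ (Fin d), ℂ) →ₗ[ℂ] ℂ))
    (continuous_norm.comp (map_continuous g))
  refine ⟨s, C, C.2, fun ψ => ?_⟩
  have h1 := h ψ
  refine le_trans h1 ?_
  change (C : ℝ) * _ ≤ _
  gcongr
  refine (Seminorm.le_def.1 (Seminorm.finset_sup_le_sum _ s) ψ).trans ?_
  exact le_of_eq (map_sum (({ toFun := fun p => p ψ, map_zero' := rfl, map_add' := fun _ _ => rfl } :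
    Seminorm ℂ 𝓢(EuclideanSpace ℝ (Fin d), ℂ) →+ ℝ)) _ _)

theorem pow_mul_slice_le {d : ℕ} (x : EuclideanSpace ℝ (Fin d))
    (Φ : 𝓢(EuclideanSpace ℝ (Fin d ⊕ Fin d), ℂ)) (k : ℕ) (m : ℕ × ℕ) :
    ‖x‖ ^ k * SchwartzMap.seminorm ℝ m.1 m.2 (slice x Φ)
      ≤ SchwartzMap.seminorm ℝ (k + m.1) m.2 Φ := by
  have hx : 0 ≤ ‖x‖ ^ k := by positivity
  rw [← Real.norm_of_nonneg hx, ← map_smul_eq_mul]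
  refine SchwartzMap.seminorm_le_bound ℝ _ _ _ (apply_nonneg _ _) fun y => ?_
  have e : iteratedFDeriv ℝ m.2 ((‖x‖ ^ k : ℝ) • slice x Φ : 𝓢(EuclideanSpace ℝ (Fin d), ℂ)) y
      = (‖x‖ ^ k : ℝ) • iteratedFDeriv ℝ m.2 (slice x Φ) y :=
    iteratedFDeriv_const_smul_apply ((slice x Φ).smooth _).contDiffAt
  rw [e, norm_smul, Real.norm_of_nonneg hx]
  calc ‖y‖ ^ m.1 * (‖x‖ ^ k * ‖iteratedFDeriv ℝ m.2 (slice x Φ) y‖)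
      ≤ ‖pair x y‖ ^ m.1 * (‖pair x y‖ ^ k * ‖iteratedFDeriv ℝ m.2 Φ (pair x y)‖) := by
        gcongr
        · exact norm_right_le_pair x y
        · exact norm_left_le_pair x y
        · exact norm_iteratedFDeriv_slice_le x Φ m.2 y
    _ = ‖pair x y‖ ^ (k + m.1) * ‖iteratedFDeriv ℝ m.2 Φ (pair x y)‖ := by ring
    _ ≤ _ := SchwartzMap.le_seminorm ℝ _ _ _ _

theorem slice_remainder_le {d : ℕ} (x v : EuclideanSpace ℝ (Fin d))
    (Φ : 𝓢(EuclideanSpace ℝ (Fin d ⊕ Fin d), ℂ)) (m : ℕ × ℕ) :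
    SchwartzMap.seminorm ℝ m.1 m.2 (slice (x + v) Φ - slice x Φ - slice x (∂_{inlL d v} Φ))
      ≤ SchwartzMap.seminorm ℝ m.1 (m.2 + 2) Φ * ‖v‖ ^ 2 := by
  refine SchwartzMap.seminorm_le_bound ℝ _ _ _ (by positivity) fun y => ?_
  set Θ : 𝓢(EuclideanSpace ℝ (Fin d ⊕ Fin d), ℂ) :=
    Φ.compSubConstCLM ℂ (-(inlL d v)) - Φ - ∂_{inlL d v} Φ with hΘ
  have e1 : slice (x + v) Φ - slice x Φ - slice x (∂_{inlL d v} Φ) = slice x Θ := by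
    ext y
    simp only [hΘ, sub_apply, slice_apply, SchwartzMap.compSubConstCLM_apply, pair_eq,
      map_add]
    congr 3
    abel
  have e2 : (Θ : EuclideanSpace ℝ (Fin d ⊕ Fin d) → ℂ)
      = fun w => Φ (w + inlL d v) - Φ w - fderiv ℝ Φ w (inlL d v) := by
    funext w
    simp [hΘ, SchwartzMap.lineDerivOp_apply_eq_fderiv]
  rw [e1]
  have h1 := norm_iteratedFDeriv_slice_le x Θ m.2 y
  rcases eq_or_ne m.1 0 with h0 | h0
  · have h2 := taylor_aux m.2 Φ (Φ.smooth ⊤) (pair x y) (inlL d v)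
      (SchwartzMap.seminorm ℝ m.1 (m.2 + 2) Φ) (fun t _ => by
        have := SchwartzMap.le_seminorm ℝ m.1 (m.2 + 2) Φ (pair x y + t • inlL d v)
        simpa [h0] using this)
    rw [← e2] at h2
    rw [h0, pow_zero, one_mul, ← h0]
    refine h1.trans (h2.trans ?_)
    gcongr
    exact norm_inlL_le d v
  · rcases eq_or_ne y 0 with hy | hy
    · rw [hy, norm_zero, zero_pow h0, zero_mul]; positivity
    have hyp : 0 < ‖y‖ ^ m.1 := pow_pos (norm_pos_iff.2 hy) _
    have h2 := taylor_aux m.2 Φ (Φ.smooth ⊤) (pair x y) (inlL d v)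
      (SchwartzMap.seminorm ℝ m.1 (m.2 + 2) Φ / ‖y‖ ^ m.1) (fun t _ => by
        have h3 := SchwartzMap.le_seminorm ℝ m.1 (m.2 + 2) Φ (pair x y + t • inlL d v)
        have h4 : pair x y + t • inlL d v = pair (x + t • v) y := by
          simp only [pair_eq, map_add, map_smul]; abel
        rw [le_div_iff₀' hyp]
        refine le_trans ?_ h3
        gcongr
        rw [h4]
        exact norm_right_le_pair _ _)
    rw [← e2] at h2
    calc ‖y‖ ^ m.1 * ‖iteratedFDeriv ℝ m.2 (slice x Θ) y‖
        ≤ ‖y‖ ^ m.1 * (SchwartzMap.seminorm ℝ m.1 (m.2 + 2) Φ / ‖y‖ ^ m.1 * ‖v‖ ^ 2) := by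
          gcongr
          refine h1.trans (h2.trans ?_)
          gcongr
          exact norm_inlL_le d v
      _ = _ := by field_simp

/-- The partial application `x ↦ g(Φ(x, ·))`. -/
def partialFun {d : ℕ} (g : 𝓢'(EuclideanSpace ℝ (Fin d), ℂ))
    (Φ : 𝓢(EuclideanSpace ℝ (Fin d ⊕ Fin d), ℂ)) (x : EuclideanSpace ℝ (Fin d)) : ℂ :=
  g (slice x Φ)

theorem partialFun_hasFDerivAt {d : ℕ} (g : 𝓢'(EuclideanSpace ℝ (Fin d), ℂ))
    (Φ : 𝓢(EuclideanSpace ℝ (Fin d ⊕ Fin d), ℂ)) (x : EuclideanSpace ℝ (Fin d)) :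
    HasFDerivAt (partialFun g Φ)
      (∑ i, (EuclideanSpace.proj (𝕜 := ℝ) i : EuclideanSpace ℝ (Fin d) →L[ℝ] ℝ).smulRight
        (partialFun g (∂_{inlL d (EuclideanSpace.single i (1 : ℝ))} Φ) x)) x := by
  obtain ⟨s, C, hC, hg⟩ := exists_bound g
  have key : ∀ v : EuclideanSpace ℝ (Fin d),
      (∑ i, (EuclideanSpace.proj (𝕜 := ℝ) i : EuclideanSpace ℝ (Fin d) →L[ℝ] ℝ).smulRight
        (partialFun g (∂_{inlL d (EuclideanSpace.single i (1 : ℝ))} Φ) x)) v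
        = g (slice x (∂_{inlL d v} Φ)) := by
    intro v
    have hv : v = ∑ i, v i • EuclideanSpace.single i (1 : ℝ) := by
      ext j; simp [Finset.sum_apply, Pi.single_apply]
    have h1 : ∂_{inlL d v} Φ = ∑ i, (v i : ℂ) • ∂_{inlL d (EuclideanSpace.single i (1 : ℝ))} Φ := by
      ext w
      rw [SchwartzMap.lineDerivOp_apply_eq_fderiv]
      conv_lhs => rw [hv]
      simp [SchwartzMap.lineDerivOp_apply_eq_fderiv]
    rw [h1]
    simp only [map_sum, map_smul]
    simp [partialFun]
  rw [hasFDerivAt_iff_isLittleO_nhds_zero]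
  refine Asymptotics.IsBigO.trans_isLittleO (g := fun v : EuclideanSpace ℝ (Fin d) => ‖v‖ ^ 2) ?_ ?_
  · refine Asymptotics.IsBigO.of_bound
      (C * ∑ m ∈ s, SchwartzMap.seminorm ℝ m.1 (m.2 + 2) Φ) (Filter.Eventually.of_forall fun v => ?_)
    rw [key v]
    have : partialFun g Φ (x + v) - partialFun g Φ x - g (slice x (∂_{inlL d v} Φ))
        = g (slice (x + v) Φ - slice x Φ - slice x (∂_{inlL d v} Φ)) := by
      simp [partialFun]
    rw [this]
    refine (hg _).trans ?_
    rw [mul_assoc, Finset.sum_mul]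
    gcongr with m hm
    rw [Real.norm_of_nonneg (by positivity)]
    exact slice_remainder_le x v Φ m
  · simpa using (Asymptotics.isLittleO_norm_pow_id one_lt_two
      (E' := EuclideanSpace ℝ (Fin d)))

theorem partialFun_fderiv {d : ℕ} (g : 𝓢'(EuclideanSpace ℝ (Fin d), ℂ))
    (Φ : 𝓢(EuclideanSpace ℝ (Fin d ⊕ Fin d), ℂ)) :
    fderiv ℝ (partialFun g Φ) = fun x => ∑ i,
      (ContinuousLinearMap.smulRightL ℝ (EuclideanSpace ℝ (Fin d)) ℂ (EuclideanSpace.proj i))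
        (partialFun g (∂_{inlL d (EuclideanSpace.single i (1 : ℝ))} Φ) x) := by
  funext x
  rw [(partialFun_hasFDerivAt g Φ x).fderiv]
  rfl

theorem partialFun_contDiff {d : ℕ} (g : 𝓢'(EuclideanSpace ℝ (Fin d), ℂ))
    (Φ : 𝓢(EuclideanSpace ℝ (Fin d ⊕ Fin d), ℂ)) : ContDiff ℝ ∞ (partialFun g Φ) := by
  rw [contDiff_infty]
  intro n
  induction n generalizing Φ with
  | zero =>
    exact contDiff_zero.2 (continuous_iff_continuousAt.2 fun x =>
      (partialFun_hasFDerivAt g Φ x).continuousAt)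
  | succ n ih =>
    rw [Nat.cast_add, Nat.cast_one, contDiff_succ_iff_fderiv]
    refine ⟨fun x => (partialFun_hasFDerivAt g Φ x).differentiableAt, by simp, ?_⟩
    rw [partialFun_fderiv]
    exact ContDiff.sum fun i _ => ContinuousLinearMap.contDiff _ |>.comp (ih _)

theorem exists_sum_seminorm {V ι : Type} [AddCommGroup V] [Module ℂ V] [TopologicalSpace V]
    (s : Finset ι) (c : ι → ℝ≥0) (q : ι → Seminorm ℂ V) (hq : ∀ i, Continuous (q i)) :
    ∃ Q : Seminorm ℂ V, Continuous Q ∧ ∀ v, Q v = ∑ i ∈ s, (c i : ℝ) * q i v := by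
  classical
  induction s using Finset.induction_on with
  | empty => exact ⟨0, continuous_const, fun v => by simp⟩
  | insert a s ha ih =>
    obtain ⟨Q, hQ, h⟩ := ih
    refine ⟨c a • q a + Q, ((hq a).const_smul (c a)).add hQ, fun v => ?_⟩
    rw [Finset.sum_insert ha, ← h v]
    rfl

theorem partialFun_bound {d : ℕ} (g : 𝓢'(EuclideanSpace ℝ (Fin d), ℂ)) (k n : ℕ) :
    ∃ q : Seminorm ℂ 𝓢(EuclideanSpace ℝ (Fin d ⊕ Fin d), ℂ), Continuous q ∧
      ∀ (Φ : 𝓢(EuclideanSpace ℝ (Fin d ⊕ Fin d), ℂ)) (x : EuclideanSpace ℝ (Fin d)),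
        ‖x‖ ^ k * ‖iteratedFDeriv ℝ n (partialFun g Φ) x‖ ≤ q Φ := by
  induction n with
  | zero =>
    obtain ⟨s, C, hC, hg⟩ := exists_bound g
    obtain ⟨Q, hQ, e⟩ := exists_sum_seminorm s (fun _ => (⟨C, hC⟩ : ℝ≥0))
      (fun m : ℕ × ℕ => schwartzSeminormFamily ℂ (EuclideanSpace ℝ (Fin d ⊕ Fin d)) ℂ
        (k + m.1, m.2)) (fun m => (schwartz_withSeminorms ℂ _ ℂ).continuous_seminorm _)
    refine ⟨Q, hQ, ?_⟩
    · intro Φ x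
      rw [e, norm_iteratedFDeriv_zero, ← Finset.mul_sum]
      calc ‖x‖ ^ k * ‖g (slice x Φ)‖
          ≤ ‖x‖ ^ k * (C * ∑ m ∈ s, SchwartzMap.seminorm ℝ m.1 m.2 (slice x Φ)) := by
            gcongr; exact hg _
        _ = C * ∑ m ∈ s, ‖x‖ ^ k * SchwartzMap.seminorm ℝ m.1 m.2 (slice x Φ) := by
            rw [Finset.mul_sum, Finset.mul_sum, Finset.mul_sum]
            exact Finset.sum_congr rfl fun m _ => by ring
        _ ≤ _ := by
            exact mul_le_mul_of_nonneg_left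
              (Finset.sum_le_sum fun m _ => pow_mul_slice_le x Φ k m) hC
  | succ n ih =>
    obtain ⟨q, hq, h⟩ := ih
    set B : Fin d → ℂ →L[ℝ] EuclideanSpace ℝ (Fin d) →L[ℝ] ℂ := fun i =>
      ContinuousLinearMap.smulRightL ℝ (EuclideanSpace ℝ (Fin d)) ℂ (EuclideanSpace.proj i) with hB
    set D : Fin d → 𝓢(EuclideanSpace ℝ (Fin d ⊕ Fin d), ℂ) →L[ℂ]
        𝓢(EuclideanSpace ℝ (Fin d ⊕ Fin d), ℂ) := fun i =>
      LineDeriv.lineDerivOpCLM ℂ _ (inlL d (EuclideanSpace.single i (1 : ℝ))) with hD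
    obtain ⟨Q, hQ, e⟩ := exists_sum_seminorm Finset.univ (fun i => ‖B i‖₊)
      (fun i => q.comp (D i).toLinearMap) (fun i => hq.comp (D i).continuous)
    refine ⟨Q, hQ, ?_⟩
    · intro Φ x
      rw [e, ← norm_iteratedFDeriv_fderiv, partialFun_fderiv]
      have hc : ∀ i, ContDiff ℝ ∞ (fun x => B i (partialFun g (D i Φ) x)) := fun i =>
        (B i).contDiff.comp (partialFun_contDiff g _)
      have e2 : iteratedFDeriv ℝ n (fun x => ∑ i, B i (partialFun g (D i Φ) x)) x
          = ∑ i, iteratedFDeriv ℝ n (fun x => B i (partialFun g (D i Φ) x)) x :=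
        iteratedFDeriv_fun_sum_apply fun i _ => ((hc i).of_le (mod_cast le_top)).contDiffAt
      change ‖x‖ ^ k * ‖iteratedFDeriv ℝ n (fun x => ∑ i, B i (partialFun g (D i Φ) x)) x‖ ≤ _
      rw [e2]
      refine (mul_le_mul_of_nonneg_left (norm_sum_le _ _) (by positivity)).trans ?_
      rw [Finset.mul_sum]
      refine Finset.sum_le_sum fun i _ => ?_
      have e3 : ‖iteratedFDeriv ℝ n (fun x => B i (partialFun g (D i Φ) x)) x‖
          ≤ ‖B i‖ * ‖iteratedFDeriv ℝ n (partialFun g (D i Φ)) x‖ :=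
        (B i).norm_iteratedFDeriv_comp_left
          ((partialFun_contDiff g _).contDiffAt (n := ∞)) (mod_cast le_top)
      calc _ ≤ ‖x‖ ^ k * (‖B i‖ * ‖iteratedFDeriv ℝ n (partialFun g (D i Φ)) x‖) := by gcongr
        _ = ‖B i‖ * (‖x‖ ^ k * ‖iteratedFDeriv ℝ n (partialFun g (D i Φ)) x‖) := by ring
        _ ≤ _ := mul_le_mul_of_nonneg_left (h _ x) (norm_nonneg (B i))

/-- The partial application `Φ ↦ (x ↦ g(Φ(x, ·)))` of a tempered distribution `g` on `ℝᵈ` to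
Schwartz functions `Φ` on `ℝ²ᵈ`. -/
def partialCLM {d : ℕ} (g : 𝓢'(EuclideanSpace ℝ (Fin d), ℂ)) :
    𝓢(EuclideanSpace ℝ (Fin d ⊕ Fin d), ℂ) →L[ℂ] 𝓢(EuclideanSpace ℝ (Fin d), ℂ) :=
  SchwartzMap.mkCLM (σ := RingHom.id ℂ) (partialFun g)
    (fun Φ Ψ x => by simp [partialFun]) (fun a Φ x => by simp [partialFun])
    (partialFun_contDiff g) (fun n => by
      obtain ⟨q, hq, h⟩ := partialFun_bound g n.1 n.2
      obtain ⟨s, C, -, hs⟩ := Seminorm.bound_of_continuous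
        (schwartz_withSeminorms ℂ (EuclideanSpace ℝ (Fin d ⊕ Fin d)) ℂ) q hq
      exact ⟨s, C, C.2, fun Φ x => (h Φ x).trans (hs Φ)⟩)

/-- The tensor product `f ⊗ g` of two tempered distributions on `ℝᵈ`:
`(f ⊗ g)(Φ) = f(x ↦ g(y ↦ Φ(x, y)))`. -/
def tensorDistribution {d : ℕ} (f g : 𝓢'(EuclideanSpace ℝ (Fin d), ℂ)) :
    𝓢'(EuclideanSpace ℝ (Fin d ⊕ Fin d), ℂ) :=
  PointwiseConvergenceCLM.precomp ℂ (partialCLM g) f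

theorem tensorDistribution_apply {d : ℕ} (f g : 𝓢'(EuclideanSpace ℝ (Fin d), ℂ))
    (Φ : 𝓢(EuclideanSpace ℝ (Fin d ⊕ Fin d), ℂ)) :
    tensorDistribution f g Φ = f (partialCLM g Φ) := rfl

/-- Complex conjugation of a Schwartz function. -/
def conjSchwartz {V : Type} [NormedAddCommGroup V] [NormedSpace ℝ V] :
    𝓢(V, ℂ) →L[ℝ] 𝓢(V, ℂ) :=
  SchwartzMap.postcompCLM (𝕜 := ℝ) (Complex.conjCLE : ℂ →L[ℝ] ℂ)

theorem conjSchwartz_apply {V : Type} [NormedAddCommGroup V] [NormedSpace ℝ V]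
    (φ : 𝓢(V, ℂ)) (x : V) : conjSchwartz φ x = (starRingEnd ℂ) (φ x) := rfl

theorem conjSchwartz_smul {V : Type} [NormedAddCommGroup V] [NormedSpace ℝ V]
    (c : ℂ) (φ : 𝓢(V, ℂ)) : conjSchwartz (c • φ) = (starRingEnd ℂ c) • conjSchwartz φ := by
  ext x; simp [conjSchwartz_apply]

/-- The conjugate `T̄` of a tempered distribution: `T̄(φ) = conj (T (conj φ))`. -/
def conjDistribution {V : Type} [NormedAddCommGroup V] [NormedSpace ℝ V] (T : 𝓢'(V, ℂ)) :
    𝓢'(V, ℂ) :=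
  ContinuousLinearMap.toPointwiseConvergenceCLM ℂ (RingHom.id ℂ) 𝓢(V, ℂ) ℂ
    { toFun := fun φ => (starRingEnd ℂ) (T (conjSchwartz φ))
      map_add' := fun φ ψ => by simp
      map_smul' := fun c φ => by simp [conjSchwartz_smul]
      cont := Complex.continuous_conj.comp ((map_continuous T).comp conjSchwartz.continuous) }

theorem conjDistribution_apply {V : Type} [NormedAddCommGroup V] [NormedSpace ℝ V]
    (T : 𝓢'(V, ℂ)) (φ : 𝓢(V, ℂ)) :
    conjDistribution T φ = (starRingEnd ℂ) (T (conjSchwartz φ)) := rfl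

/-- The character `t ↦ exp(2πi b · t)`. -/
def character {ι : Type} [Fintype ι] (b t : EuclideanSpace ℝ ι) : ℂ :=
  Complex.exp (2 * Real.pi * Complex.I * (inner ℝ b t : ℝ))

theorem character_hasTemperateGrowth {ι : Type} [Fintype ι] (b : EuclideanSpace ℝ ι) :
    (character b).HasTemperateGrowth := by
  set c : ℂ := 2 * Real.pi * Complex.I with hc
  have hexp : Function.HasTemperateGrowth (fun r : ℝ => Complex.exp (c * (r : ℂ))) := by
    have hder : ∀ n : ℕ, iteratedDeriv n (fun r : ℝ => Complex.exp (c * (r : ℂ)))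
        = fun r : ℝ => c ^ n * Complex.exp (c * (r : ℂ)) := by
      intro n
      induction n with
      | zero => simp
      | succ n ih =>
        rw [iteratedDeriv_succ, ih]
        funext r
        have h1 : HasDerivAt (fun r : ℝ => c * (r : ℂ)) (c * 1) r :=
          (Complex.ofRealCLM.hasDerivAt (x := r)).const_mul c
        rw [(h1.cexp.const_mul (c ^ n)).deriv]
        ring
    refine ⟨(contDiff_const.mul Complex.ofRealCLM.contDiff).cexp, fun n => ⟨0, ‖c‖ ^ n, fun r => ?_⟩⟩
    rw [norm_iteratedFDeriv_eq_norm_iteratedDeriv, hder]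
    have h2 : ‖Complex.exp (c * (r : ℂ))‖ = 1 := by
      rw [Complex.norm_exp]; simp [hc]
    rw [norm_mul, h2, norm_pow]; simp
  exact hexp.comp (Function.hasTemperateGrowth_inner_right b)

/-- The time-frequency shift `π(z)φ(t) = exp(2πi z₂ · t) φ(t - z₁)`, for `z = (z₁, z₂)`. -/
def timeFreqShift {ι : Type} [Fintype ι] (z : EuclideanSpace ℝ (ι ⊕ ι)) :
    𝓢(EuclideanSpace ℝ ι, ℂ) →L[ℂ] 𝓢(EuclideanSpace ℝ ι, ℂ) :=
  (SchwartzMap.smulLeftCLM ℂ (character (sndPart z))).comp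
    (SchwartzMap.compSubConstCLM ℂ (fstPart z))

theorem timeFreqShift_apply {ι : Type} [Fintype ι] (z : EuclideanSpace ℝ (ι ⊕ ι))
    (φ : 𝓢(EuclideanSpace ℝ ι, ℂ)) (t : EuclideanSpace ℝ ι) :
    timeFreqShift z φ t = character (sndPart z) t * φ (t - fstPart z) := by
  simp [timeFreqShift, SchwartzMap.smulLeftCLM_apply_apply (character_hasTemperateGrowth _)]

/-- The projection onto the first block, as a continuous linear map. -/
def fstL (d : ℕ) : EuclideanSpace ℝ (Fin d ⊕ Fin d) →L[ℝ] EuclideanSpace ℝ (Fin d) :=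
  LinearMap.toContinuousLinearMap
    { toFun := fstPart
      map_add' := fun x y => by ext i; simp [fstPart]
      map_smul' := fun c x => by ext i; simp [fstPart] }

/-- The projection onto the second block, as a continuous linear map. -/
def sndL (d : ℕ) : EuclideanSpace ℝ (Fin d ⊕ Fin d) →L[ℝ] EuclideanSpace ℝ (Fin d) :=
  LinearMap.toContinuousLinearMap
    { toFun := sndPart
      map_add' := fun x y => by ext i; simp [sndPart]
      map_smul' := fun c x => by ext i; simp [sndPart] }

theorem norm_le_fst_add_snd {d : ℕ} (z : EuclideanSpace ℝ (Fin d ⊕ Fin d)) :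
    ‖z‖ ≤ ‖fstPart z‖ + ‖sndPart z‖ := by
  have h : z = pair (fstPart z) (sndPart z) := by
    ext i; cases i <;> simp [pair, fstPart, sndPart]
  have h2 := norm_pair_sq (fstPart z) (sndPart z)
  rw [← h] at h2
  exact le_of_sq_le_sq (by nlinarith [norm_nonneg (fstPart z), norm_nonneg (sndPart z)])
    (by positivity)

theorem exists_iteratedFDeriv_comp_bound {d : ℕ} (φ : 𝓢(EuclideanSpace ℝ (Fin d), ℂ))
    (T : EuclideanSpace ℝ (Fin d ⊕ Fin d) →L[ℝ] EuclideanSpace ℝ (Fin d)) (k n : ℕ) :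
    ∃ C : ℝ, 0 ≤ C ∧ ∀ z,
      ‖T z‖ ^ k * ‖iteratedFDeriv ℝ n (fun z => φ (T z)) z‖ ≤ C := by
  refine ⟨SchwartzMap.seminorm ℝ k n φ * ‖T‖ ^ n, by positivity, fun z => ?_⟩
  have h := T.iteratedFDeriv_comp_right (φ.smooth ⊤) z (i := n) (mod_cast le_top)
  change ‖T z‖ ^ k * ‖iteratedFDeriv ℝ n (φ ∘ T) z‖ ≤ _
  rw [h]
  calc _ ≤ ‖T z‖ ^ k * (‖iteratedFDeriv ℝ n φ (T z)‖ * ‖T‖ ^ n) := by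
        gcongr
        refine (ContinuousMultilinearMap.norm_compContinuousLinearMap_le _ _).trans ?_
        simp
    _ = (‖T z‖ ^ k * ‖iteratedFDeriv ℝ n φ (T z)‖) * ‖T‖ ^ n := by ring
    _ ≤ _ := by
        gcongr
        exact SchwartzMap.le_seminorm ℝ _ _ _ _

/-- The tensor product `(φ ⊗ ψ)(x, y) = φ(x) ψ(y)` of Schwartz functions. -/
def tensorSchwartz {d : ℕ} (φ ψ : 𝓢(EuclideanSpace ℝ (Fin d), ℂ)) :
    𝓢(EuclideanSpace ℝ (Fin d ⊕ Fin d), ℂ) where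
  toFun z := φ (fstPart z) * ψ (sndPart z)
  smooth' := ((φ.smooth ⊤).comp (fstL d).contDiff).mul ((ψ.smooth ⊤).comp (sndL d).contDiff)
  decay' := by
    intro k n
    choose A hA0 hA using fun m : ℕ × ℕ => exists_iteratedFDeriv_comp_bound φ (fstL d) m.1 m.2
    choose B hB0 hB using fun m : ℕ × ℕ => exists_iteratedFDeriv_comp_bound ψ (sndL d) m.1 m.2
    refine ⟨∑ i ∈ Finset.range (n + 1), (n.choose i : ℝ) * (2 ^ k *
      (A (k, i) * B (0, n - i) + A (0, i) * B (k, n - i))), fun z => ?_⟩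
    have h1 := norm_iteratedFDeriv_mul_le (n := n) (N := ((⊤ : ℕ∞) : WithTop ℕ∞))
      ((φ.smooth ⊤).comp (fstL d).contDiff) ((ψ.smooth ⊤).comp (sndL d).contDiff) z
      (mod_cast le_top)
    refine (mul_le_mul_of_nonneg_left h1 (by positivity)).trans ?_
    rw [Finset.mul_sum]
    refine Finset.sum_le_sum fun i _ => ?_
    set a := ‖iteratedFDeriv ℝ i (φ ∘ fstL d) z‖ with ha
    set b := ‖iteratedFDeriv ℝ (n - i) (ψ ∘ sndL d) z‖ with hb
    have hz : ‖z‖ ^ k ≤ 2 ^ k * (‖fstL d z‖ ^ k + ‖sndL d z‖ ^ k) := by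
      have h2 : ‖z‖ ≤ 2 * max ‖fstL d z‖ ‖sndL d z‖ := by
        refine (norm_le_fst_add_snd z).trans ?_
        rw [two_mul]
        exact add_le_add (le_max_left _ _) (le_max_right _ _)
      calc ‖z‖ ^ k ≤ (2 * max ‖fstL d z‖ ‖sndL d z‖) ^ k := by gcongr
        _ = 2 ^ k * max ‖fstL d z‖ ‖sndL d z‖ ^ k := by rw [mul_pow]
        _ ≤ _ := by
          gcongr
          rcases max_cases ‖fstL d z‖ ‖sndL d z‖ with h | h
          · rw [h.1]; linarith [pow_nonneg (norm_nonneg (sndL d z)) k]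
          · rw [h.1]; linarith [pow_nonneg (norm_nonneg (fstL d z)) k]
    have a1 : ‖fstL d z‖ ^ k * a ≤ A (k, i) := hA (k, i) z
    have a2 : a ≤ A (0, i) := by
      have h := hA (0, i) z
      rw [pow_zero, one_mul] at h
      exact h
    have b1 : ‖sndL d z‖ ^ k * b ≤ B (k, n - i) := hB (k, n - i) z
    have b2 : b ≤ B (0, n - i) := by
      have h := hB (0, n - i) z
      rw [pow_zero, one_mul] at h
      exact h
    have a0 : 0 ≤ a := norm_nonneg _
    have b0 : 0 ≤ b := norm_nonneg _
    calc ‖z‖ ^ k * ((n.choose i : ℝ) * a * b)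
        ≤ (2 ^ k * (‖fstL d z‖ ^ k + ‖sndL d z‖ ^ k)) * ((n.choose i : ℝ) * a * b) := by gcongr
      _ = (n.choose i : ℝ) * (2 ^ k * ((‖fstL d z‖ ^ k * a) * b + a * (‖sndL d z‖ ^ k * b))) := by
          ring
      _ ≤ _ := by
          gcongr
          · exact hA0 _
          · exact hA0 _

theorem tensorSchwartz_apply {d : ℕ} (φ ψ : 𝓢(EuclideanSpace ℝ (Fin d), ℂ))
    (z : EuclideanSpace ℝ (Fin d ⊕ Fin d)) :
    tensorSchwartz φ ψ z = φ (fstPart z) * ψ (sndPart z) := rfl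

/-- The short-time Fourier transform `V_φ f(z) = ⟨f, π(z)φ⟩` of a tempered distribution. -/
def stft {d : ℕ} (φ : 𝓢(EuclideanSpace ℝ (Fin d), ℂ)) (f : 𝓢'(EuclideanSpace ℝ (Fin d), ℂ))
    (z : EuclideanSpace ℝ (Fin d ⊕ Fin d)) : ℂ :=
  f (conjSchwartz (timeFreqShift z φ))

/-- The weight `v_s(z) = (1 + |z|²)^{s/2}`. -/
def weight {d : ℕ} (s : ℝ) (z : EuclideanSpace ℝ (Fin d ⊕ Fin d)) : ℝ :=
  (1 + ‖z‖ ^ 2) ^ (s / 2)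

/-- The weighted mixed (quasi-)norm
`(∫ (∫ |F(x, ξ)|^p v_s(x, ξ)^p dx)^{q/p} dξ)^{1/q}`, with essential suprema at `p = ∞`, `q = ∞`. -/
def mixedNorm {d : ℕ} (p q : ℝ≥0∞) (s : ℝ) (F : EuclideanSpace ℝ (Fin d ⊕ Fin d) → ℂ) : ℝ≥0∞ :=
  eLpNorm (fun ξ : EuclideanSpace ℝ (Fin d) =>
    eLpNorm (fun x : EuclideanSpace ℝ (Fin d) => weight s (pair x ξ) • F (pair x ξ)) p volume)
    q volume

/-- The (quasi-)norm `‖V_φ f‖_{L^{p,q}_{v_s}}` of the modulation space `M^{p,q}_{v_s}`, with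
respect to the window `φ`. -/
def modulationNorm {d : ℕ} (φ : 𝓢(EuclideanSpace ℝ (Fin d), ℂ)) (p q : ℝ≥0∞) (s : ℝ)
    (f : 𝓢'(EuclideanSpace ℝ (Fin d), ℂ)) : ℝ≥0∞ :=
  mixedNorm p q s (stft φ f)

/-- Membership in `M^{p,q}_{v_s}`, with respect to the window `φ`. -/
def MemModulation {d : ℕ} (φ : 𝓢(EuclideanSpace ℝ (Fin d), ℂ)) (p q : ℝ≥0∞) (s : ℝ)
    (f : 𝓢'(EuclideanSpace ℝ (Fin d), ℂ)) : Prop :=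
  modulationNorm φ p q s f < ⊤

/-- The tempered distribution `T` is (integration against) the measurable function `F`. -/
def IsGivenBy {d : ℕ} (T : 𝓢'(EuclideanSpace ℝ (Fin d ⊕ Fin d), ℂ))
    (F : EuclideanSpace ℝ (Fin d ⊕ Fin d) → ℂ) : Prop :=
  AEStronglyMeasurable F volume ∧
    ∀ Φ : 𝓢(EuclideanSpace ℝ (Fin d ⊕ Fin d), ℂ),
      Integrable (fun z => Φ z * F z) volume ∧ T Φ = ∫ z, Φ z * F z

/-- A tempered distribution belongs to `L^{p,q}_{v_s}(ℝ²ᵈ)`: it is given by a function of finite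
`L^{p,q}_{v_s}` (quasi-)norm. -/
def MemMixed {d : ℕ} (p q : ℝ≥0∞) (s : ℝ)
    (T : 𝓢'(EuclideanSpace ℝ (Fin d ⊕ Fin d), ℂ)) : Prop :=
  ∃ F, IsGivenBy T F ∧ mixedNorm p q s F < ⊤

/-- The `L^{p,q}_{v_s}` (quasi-)norm of a tempered distribution: the norm of the function which
gives it (unique almost everywhere), and `∞` if the distribution is not given by a function. -/
def distMixedNorm {d : ℕ} (p q : ℝ≥0∞) (s : ℝ)
    (T : 𝓢'(EuclideanSpace ℝ (Fin d ⊕ Fin d), ℂ)) : ℝ≥0∞ :=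
  ⨅ (F : EuclideanSpace ℝ (Fin d ⊕ Fin d) → ℂ) (_ : IsGivenBy T F), mixedNorm p q s F

/-- `U` is a metaplectic operator `μ(A)` with projection `A`: it is unitary for the `L²` norm and
intertwines time-frequency shifts, `μ(A) π(ζ) = c π(Aζ) μ(A)` with `|c| = 1`. This determines `U`
up to a phase factor. The operator is given on the Schwartz space, which every metaplectic operator
maps homeomorphically onto itself. -/
def IsMetaplectic {ι : Type} [Fintype ι] [DecidableEq ι] (A : Matrix (ι ⊕ ι) (ι ⊕ ι) ℝ)
    (U : 𝓢(EuclideanSpace ℝ ι, ℂ) ≃L[ℂ] 𝓢(EuclideanSpace ℝ ι, ℂ)) : Prop :=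
  (∀ Φ, ∫ t, ‖U Φ t‖ ^ 2 = ∫ t, ‖Φ t‖ ^ 2) ∧
  ∀ ζ : EuclideanSpace ℝ (ι ⊕ ι), ∃ c : ℂ, ‖c‖ = 1 ∧
    ∀ Φ, U (timeFreqShift ζ Φ) = c • timeFreqShift (Matrix.toEuclideanLin A ζ) (U Φ)

/-- The extension of an `L²`-unitary operator `U` from Schwartz functions to tempered
distributions: `⟨U T, Φ⟩ = ⟨T, U⁻¹ Φ⟩`, where `⟨T, Φ⟩ = T (conj Φ)`. -/
def extendToDistributions {V : Type} [NormedAddCommGroup V] [NormedSpace ℝ V]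
    (U : 𝓢(V, ℂ) ≃L[ℂ] 𝓢(V, ℂ)) (T : 𝓢'(V, ℂ)) : 𝓢'(V, ℂ) :=
  ContinuousLinearMap.toPointwiseConvergenceCLM ℂ (RingHom.id ℂ) 𝓢(V, ℂ) ℂ
    { toFun := fun Φ => T (conjSchwartz (U.symm (conjSchwartz Φ)))
      map_add' := fun φ ψ => by simp
      map_smul' := fun c φ => by simp [conjSchwartz_smul]
      cont := (map_continuous T).comp
        (conjSchwartz.continuous.comp (U.symm.continuous.comp conjSchwartz.continuous)) }

/-- The time-frequency representation `W_A(f, g) = μ(A)(f ⊗ ḡ)` of tempered distributions,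
where `U = μ(A)`. -/
def wigner {d : ℕ}
    (U : 𝓢(EuclideanSpace ℝ (Fin d ⊕ Fin d), ℂ) ≃L[ℂ] 𝓢(EuclideanSpace ℝ (Fin d ⊕ Fin d), ℂ))
    (f g : 𝓢'(EuclideanSpace ℝ (Fin d), ℂ)) : 𝓢'(EuclideanSpace ℝ (Fin d ⊕ Fin d), ℂ) :=
  extendToDistributions U (tensorDistribution f (conjDistribution g))

/-- The function `W_A(f, g) = μ(A)(f ⊗ ḡ)` for Schwartz functions `f, g`, where `U = μ(A)`. -/
def wignerSchwartz {d : ℕ}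
    (U : 𝓢(EuclideanSpace ℝ (Fin d ⊕ Fin d), ℂ) ≃L[ℂ] 𝓢(EuclideanSpace ℝ (Fin d ⊕ Fin d), ℂ))
    (f g : 𝓢(EuclideanSpace ℝ (Fin d), ℂ)) : 𝓢(EuclideanSpace ℝ (Fin d ⊕ Fin d), ℂ) :=
  U (tensorSchwartz f (conjSchwartz g))

/-- Covariant matrices, by their decomposition into `d × d` blocks:
`A = [[A₁₁, I - A₁₁, A₁₃, A₁₃], [A₂₁, -A₂₁, I - A₁₁ᵀ, -A₁₁ᵀ], [0, 0, I, I], [-I, I, 0, 0]]`,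
with `A₁₃` and `A₂₁` symmetric. -/
def IsCovariant {d : ℕ}
    (A : Matrix ((Fin d ⊕ Fin d) ⊕ (Fin d ⊕ Fin d)) ((Fin d ⊕ Fin d) ⊕ (Fin d ⊕ Fin d)) ℝ) :
    Prop :=
  ∃ A₁₁ A₁₃ A₂₁ : Matrix (Fin d) (Fin d) ℝ, A₁₃.transpose = A₁₃ ∧ A₂₁.transpose = A₂₁ ∧
    A = Matrix.fromBlocks
      (Matrix.fromBlocks A₁₁ (1 - A₁₁) A₂₁ (-A₂₁))
      (Matrix.fromBlocks A₁₃ A₁₃ (1 - A₁₁.transpose) (-A₁₁.transpose))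
      (Matrix.fromBlocks 0 0 (-1) 1)
      (Matrix.fromBlocks 1 1 0 0)

/-- Shift-invertibility of `W_A`, where `U = μ(A)`: `|W_A(π(w)f, g)| = |W_A(f, g)(· - E w)|` for
some invertible matrix `E`. -/
def IsShiftInvertible {d : ℕ}
    (U : 𝓢(EuclideanSpace ℝ (Fin d ⊕ Fin d), ℂ) ≃L[ℂ] 𝓢(EuclideanSpace ℝ (Fin d ⊕ Fin d), ℂ)) :
    Prop :=
  ∃ E : Matrix (Fin d ⊕ Fin d) (Fin d ⊕ Fin d) ℝ, IsUnit E.det ∧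
    ∀ (f g : 𝓢(EuclideanSpace ℝ (Fin d), ℂ)) (w z : EuclideanSpace ℝ (Fin d ⊕ Fin d)),
      ‖wignerSchwartz U (timeFreqShift w f) g z‖
        = ‖wignerSchwartz U f g (z - Matrix.toEuclideanLin E w)‖

/-- The partial Fourier transform `F₂F(x, ξ) = ∫ exp(-2πi y · ξ) F(x, y) dy`. -/
def partialFourier {d : ℕ} (F : EuclideanSpace ℝ (Fin d ⊕ Fin d) → ℂ)
    (z : EuclideanSpace ℝ (Fin d ⊕ Fin d)) : ℂ :=
  ∫ y : EuclideanSpace ℝ (Fin d), character (-sndPart z) y * F (pair (fstPart z) y)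

/-- The change of variables `T_L F(z) = |det L|^{1/2} F(Lz)`. -/
def rescale {d : ℕ} (L : Matrix (Fin d ⊕ Fin d) (Fin d ⊕ Fin d) ℝ)
    (F : EuclideanSpace ℝ (Fin d ⊕ Fin d) → ℂ) (z : EuclideanSpace ℝ (Fin d ⊕ Fin d)) : ℂ :=
  (Real.sqrt |L.det| : ℂ) * F (Matrix.toEuclideanLin L z)

/-- `U = F₂ T_L` up to a phase factor, for some invertible matrix `L`. -/
def IsPartialFourierRescale {d : ℕ}
    (U : 𝓢(EuclideanSpace ℝ (Fin d ⊕ Fin d), ℂ) ≃L[ℂ] 𝓢(EuclideanSpace ℝ (Fin d ⊕ Fin d), ℂ)) :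
    Prop :=
  ∃ L : Matrix (Fin d ⊕ Fin d) (Fin d ⊕ Fin d) ℝ, IsUnit L.det ∧ ∃ c : ℂ, ‖c‖ = 1 ∧
    ∀ Φ z, U Φ z = c * partialFourier (rescale L Φ) z

end TFA
end

open TFA
open scoped SchwartzMap ENNReal

noncomputable section
namespace TFA

open SchwartzMap MeasureTheory
open scoped ENNReal NNReal ContDiff LineDeriv
open scoped BoundedContinuousFunction FourierTransform Topology

/-! ### Minkowski's integral inequality for functions with values in `[0, ∞]`. -/

section Minkowski

variable {α β : Type*} [MeasurableSpace α] [MeasurableSpace β]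

/-! Write `M` for the block `A₁₁` and `W` for the representation. Everything reduces to the fact
that `W(f, g)` is a short-time Fourier transform of `f` in disguise.

Testing the intertwining relation `μ(A)π(ζ) = cπ(Aζ)μ(A)` on pure modulations `ζ = (0, η)`
determines `L`: covariance forces `L(x, y) = (x + (1 - M)y, x - My)` (`exists_eq_partialFourier`),
so up to a constant `W(f, g)(x, ξ)` is the integral over `y` of `exp(-2πi y·ξ) f(x + (1 - M)y) conj
g(x - My)`. From this formula, `|W(π(w)f, g)|` is `|W(f, g)|` translated by `(Mw₁, (1 - Mᵀ)w₂)`. The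
modulus of a non-zero Schwartz function has no period, so this vector must be `Ew`, and
invertibility of `E` gives that of `M` and `1 - M` (`isUnit_det_of_isShiftInvertible`).

Substituting `t = x + (1 - M)y` then gives a factor of constant modulus times `V_γ f(M⁻¹x, (1 -
M)⁻ᵀξ)` with `γ(t) = g(-(1 - M)⁻¹Mt)` (`nonempty_wignerKernel`). The change of coordinates acts
separately on `x` and `ξ`, so it preserves `L^{p,q}` up to a constant, and linear automorphisms
distort the weights only boundedly. What remains is independence of the window.

The unitarity of `μ(A)` gives a reproducing formula, and with it `|V_h f| ≤ C |W(f, g)| * (1 +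
|·|)^{-N}` in suitable coordinates, for every `N` and every window distribution `g ≠ 0`
(`WignerKernel.exists_enorm_stft_le_lintegral`). For `p, q ≥ 1` Young's inequality concludes. For
smaller exponents convolution is not bounded, and the inequality is first improved, through Peetre's
maximal function, to a bound of `|V_h f|^r` by a convolution of `|V_ψ f|^r`
(`rpow_le_peetreIntegral`). With `r ≤ min(1, p, q)`, Young's inequality applies in `L^{p/r, q/r}`.
This settles Schwartz windows.

For `g` in `M¹` with weight `v_{|s|}` and `p, q ≥ 1`, the lower bound is again the reproducing
formula. For the upper bound, the inversion formula writes `g` as a superposition of `π(w)φ` with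
coefficients proportional to `V_φ g(w)`. Hence `W(f, g)` is a superposition of the functions `W(f,
π(w)φ)`, whose moduli are translates of one another; Young's inequality with the integrable kernel
`v_{|s|}|V_φ g|` bounds its norm (`WignerKernel.exists_distMixedNorm_le`). -/

theorem measurable_eLpNorm_left {μ : Measure α} [SFinite μ] (p : ℝ≥0∞) {k : α → β → ℝ≥0∞}
    (hk : Measurable (Function.uncurry k)) :
    Measurable (fun w => eLpNorm (fun x => k x w) p μ) := by
  rcases eq_or_ne p 0 with rfl | h0
  · simp
  rcases eq_or_ne p ⊤ with rfl | ht
  · refine measurable_of_Iic fun a => ?_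
    -- An essential supremum is at most `a` exactly when the slice of the superlevel set is null,
    -- and the measure of a slice is measurable in the parameter.
    have h1 : (fun w => eLpNorm (fun x => k x w) ⊤ μ) ⁻¹' Set.Iic a
        = {w | μ ((fun x => (x, w)) ⁻¹' {z | a < Function.uncurry k z}) = 0} := by
      ext w
      simp only [Set.mem_preimage, Set.mem_Iic, eLpNorm_exponent_top, eLpNormEssSup, enorm_eq_self,
        Set.mem_ofPred_eq]
      constructor
      · intro h
        have h2 : ∀ᵐ x ∂μ, k x w ≤ a := (ENNReal.ae_le_essSup _).mono fun x hx => hx.trans h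
        simpa [ae_iff] using h2
      · intro h
        refine essSup_le_of_ae_le a ?_
        change ∀ᵐ x ∂μ, k x w ≤ a
        simpa [ae_iff] using h
    rw [h1]
    exact measurable_measure_prodMk_right (hk measurableSet_Ioi) (measurableSet_singleton 0)
  · simp_rw [eLpNorm_eq_lintegral_rpow_enorm_toReal h0 ht, enorm_eq_self]
    refine Measurable.pow_const ?_ _
    exact Measurable.lintegral_prod_left' (f := fun z => Function.uncurry k z ^ p.toReal)
      (hk.pow_const _)

/-- **Minkowski's integral inequality**. -/
theorem eLpNorm_lintegral_le {μ : Measure α} {ν : Measure β} [SFinite μ] [SFinite ν] {p : ℝ≥0∞}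
    (hp : 1 ≤ p) {k : α → β → ℝ≥0∞} (hk : Measurable (Function.uncurry k)) :
    eLpNorm (fun x => ∫⁻ w, k x w ∂ν) p μ ≤ ∫⁻ w, eLpNorm (fun x => k x w) p μ ∂ν := by
  have hk1 : ∀ x, Measurable (k x) := fun x => hk.comp measurable_prodMk_left
  have hk2 : ∀ w, Measurable (fun x => k x w) := fun w => hk.comp measurable_prodMk_right
  set ρ : β → ℝ≥0∞ := fun w => eLpNorm (fun x => k x w) p μ with hρ
  have hρm : Measurable ρ := measurable_eLpNorm_left p hk
  rcases eq_or_ne p ⊤ with rfl | ht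
  -- For `p = ∞` it suffices to exchange the two "almost every" in the bound by the essential
  -- supremum and integrate over `w`.
  · have h1 : ∀ᵐ w ∂ν, ∀ᵐ x ∂μ, k x w ≤ ρ w := by
      refine Filter.Eventually.of_forall fun w => ?_
      have := ENNReal.ae_le_essSup (μ := μ) (fun x => k x w)
      simpa [hρ, eLpNormEssSup] using this
    have hms : MeasurableSet {z : β × α | k z.2 z.1 ≤ ρ z.1} :=
      measurableSet_le (hk.comp measurable_swap) (hρm.comp measurable_fst)
    have h2 : ∀ᵐ x ∂μ, ∀ᵐ w ∂ν, k x w ≤ ρ w :=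
      (Measure.ae_ae_comm (p := fun w x => k x w ≤ ρ w) hms).1 h1
    rw [eLpNorm_exponent_top]
    refine essSup_le_of_ae_le _ ?_
    filter_upwards [h2] with x hx
    rw [enorm_eq_self]
    exact lintegral_mono_ae hx
  rcases eq_or_ne p 1 with rfl | h1
  · simp only [hρ, eLpNorm_one_eq_lintegral_enorm, enorm_eq_self]
    rw [lintegral_lintegral_swap hk.aemeasurable]
  have h0 : p ≠ 0 := (zero_lt_one.trans_le hp).ne'
  set P := p.toReal with hP
  have hP1 : 1 < P := by
    rw [hP, ← ENNReal.toReal_one]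
    exact (ENNReal.toReal_lt_toReal ENNReal.one_ne_top ht).2 (lt_of_le_of_ne hp h1.symm)
  have hP0 : 0 < P := zero_lt_one.trans hP1
  obtain ⟨Q, hPQ⟩ : ∃ Q, P.HolderConjugate Q := ⟨_, Real.HolderConjugate.conjExponent hP1⟩
  have hQ0 : 0 < Q := hPQ.symm.pos
  set R := ∫⁻ w, ρ w ∂ν with hR
  rcases eq_or_ne R ⊤ with hRt | hRt
  · rw [hRt]; exact le_top
  have hρP : ∀ w, ρ w ^ P = ∫⁻ x, k x w ^ P ∂μ := by
    intro w
    simp only [hρ, eLpNorm_eq_lintegral_rpow_enorm_toReal h0 ht, enorm_eq_self]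
    rw [← ENNReal.rpow_mul, one_div, inv_mul_cancel₀ hP0.ne', ENNReal.rpow_one]
  have hexp : P / Q = P - 1 := by
    have := hPQ.div_conj_eq_sub_one
    exact this
  -- for almost every `x` the weight only vanishes where `k x` does
  have hz : ∀ᵐ w ∂ν, ∀ᵐ x ∂μ, k x w ≤ k x w * ρ w ^ (-(1 / Q)) * ρ w ^ (1 / Q) := by
    have hfin : ∀ᵐ w ∂ν, ρ w < ⊤ := ae_lt_top hρm hRt
    filter_upwards [hfin] with w hw
    rcases eq_or_ne (ρ w) 0 with h | h
    · have h3 : ∫⁻ x, k x w ^ P ∂μ = 0 := by rw [← hρP, h, ENNReal.zero_rpow_of_pos hP0]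
      rw [lintegral_eq_zero_iff ((hk2 w).pow_const _)] at h3
      filter_upwards [h3] with x hx
      have : k x w = 0 := by
        have hx' : k x w ^ P = 0 := hx
        exact (ENNReal.rpow_eq_zero_iff_of_pos hP0).1 hx'
      simp [this]
    · refine Filter.Eventually.of_forall fun x => le_of_eq ?_
      rw [mul_assoc, ← ENNReal.rpow_add _ _ h hw.ne]
      simp
  have hms : MeasurableSet {z : β × α | k z.2 z.1 ≤ k z.2 z.1 * ρ z.1 ^ (-(1 / Q)) * ρ z.1 ^ (1 / Q)} := by
    have m1 : Measurable fun z : β × α => k z.2 z.1 := hk.comp measurable_swap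
    have m2 : Measurable fun z : β × α => ρ z.1 := hρm.comp measurable_fst
    exact measurableSet_le m1 ((m1.mul (m2.pow_const _)).mul (m2.pow_const _))
  have hz' : ∀ᵐ x ∂μ, ∀ᵐ w ∂ν, k x w ≤ k x w * ρ w ^ (-(1 / Q)) * ρ w ^ (1 / Q) :=
    (Measure.ae_ae_comm (p := fun w x => k x w ≤ k x w * ρ w ^ (-(1 / Q)) * ρ w ^ (1 / Q)) hms).1 hz
  -- Hölder in `w` for the splitting `k = (k ρ^{-1/Q}) ρ^{1/Q}`. Integrating the result over `x`
  -- turns `k^P ρ^{-(P-1)}` into at most `ρ`, so no duality argument is needed.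
  have hmain : ∀ᵐ x ∂μ, (∫⁻ w, k x w ∂ν) ^ P
      ≤ (∫⁻ w, k x w ^ P * ρ w ^ (-(P - 1)) ∂ν) * R ^ (P - 1) := by
    filter_upwards [hz'] with x hx
    have h3 : ∫⁻ w, k x w ∂ν ≤ (∫⁻ w, (k x w * ρ w ^ (-(1 / Q))) ^ P ∂ν) ^ (1 / P)
        * (∫⁻ w, (ρ w ^ (1 / Q)) ^ Q ∂ν) ^ (1 / Q) :=
      (lintegral_mono_ae hx).trans (ENNReal.lintegral_mul_le_Lp_mul_Lq ν hPQ
        ((hk1 x).mul (hρm.pow_const _)).aemeasurable (hρm.pow_const _).aemeasurable)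
    have h4 : ∀ w, (ρ w ^ (1 / Q)) ^ Q = ρ w := fun w => by
      rw [← ENNReal.rpow_mul, one_div, inv_mul_cancel₀ hQ0.ne', ENNReal.rpow_one]
    have h5 : ∀ w, (k x w * ρ w ^ (-(1 / Q))) ^ P = k x w ^ P * ρ w ^ (-(P - 1)) := fun w => by
      rw [ENNReal.mul_rpow_of_nonneg _ _ hP0.le, ← ENNReal.rpow_mul, ← hexp]
      congr 2; ring
    simp_rw [h4, h5] at h3
    calc (∫⁻ w, k x w ∂ν) ^ P ≤ ((∫⁻ w, k x w ^ P * ρ w ^ (-(P - 1)) ∂ν) ^ (1 / P) * R ^ (1 / Q)) ^ P := by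
          gcongr
      _ = _ := by
          rw [ENNReal.mul_rpow_of_nonneg _ _ hP0.le, ← ENNReal.rpow_mul, ← ENNReal.rpow_mul, one_div,
            inv_mul_cancel₀ hP0.ne', ENNReal.rpow_one, ← hexp]
          congr 2; ring
  have m1 : Measurable fun z : α × β => Function.uncurry k z ^ P * ρ z.2 ^ (-(P - 1)) :=
    (hk.pow_const _).mul ((hρm.comp measurable_snd).pow_const _)
  rw [eLpNorm_eq_lintegral_rpow_enorm_toReal h0 ht]
  simp_rw [enorm_eq_self]
  have hfin : ∫⁻ x, (∫⁻ w, k x w ∂ν) ^ P ∂μ ≤ R ^ P := by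
    calc ∫⁻ x, (∫⁻ w, k x w ∂ν) ^ P ∂μ
        ≤ ∫⁻ x, (∫⁻ w, k x w ^ P * ρ w ^ (-(P - 1)) ∂ν) * R ^ (P - 1) ∂μ := lintegral_mono_ae hmain
      _ = (∫⁻ x, ∫⁻ w, k x w ^ P * ρ w ^ (-(P - 1)) ∂ν ∂μ) * R ^ (P - 1) :=
          lintegral_mul_const _ (Measurable.lintegral_prod_right' m1)
      _ = (∫⁻ w, ∫⁻ x, k x w ^ P * ρ w ^ (-(P - 1)) ∂μ ∂ν) * R ^ (P - 1) := by
          rw [lintegral_lintegral_swap]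
          exact m1.aemeasurable
      _ = (∫⁻ w, ρ w ^ P * ρ w ^ (-(P - 1)) ∂ν) * R ^ (P - 1) := by
          congr 2; ext w
          rw [lintegral_mul_const _ ((hk2 w).pow_const _), hρP]
      _ ≤ R * R ^ (P - 1) := by
          refine mul_le_mul' (lintegral_mono fun w => ?_) le_rfl
          rcases eq_or_ne (ρ w) 0 with h | h
          · simp [h, ENNReal.zero_rpow_of_pos hP0]
          rcases eq_or_ne (ρ w) ⊤ with h' | h'
          · rw [h']; exact le_top
          · rw [← ENNReal.rpow_add _ _ h h']; simp
      _ = R ^ P := by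
          conv_lhs => rw [← ENNReal.rpow_one R]
          rw [← ENNReal.rpow_mul, one_mul, ← ENNReal.rpow_add_of_nonneg _ _ zero_le_one (by linarith)]
          congr 1; ring
  calc (∫⁻ x, (∫⁻ w, k x w ∂ν) ^ P ∂μ) ^ (1 / P) ≤ (R ^ P) ^ (1 / P) := by gcongr
    _ = R := by rw [← ENNReal.rpow_mul, mul_one_div_cancel hP0.ne', ENNReal.rpow_one]

end Minkowski

/-! ### Homogeneity and Hölder's inequality for `L^p` norms of `[0, ∞]`-valued functions. -/

section LpENNReal

variable {α : Type*} [MeasurableSpace α] {μ : Measure α}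

theorem eLpNorm_const_mul_ennreal {c : ℝ≥0∞} (hc : c ≠ ⊤) (p : ℝ≥0∞) (f : α → ℝ≥0∞) :
    eLpNorm (fun x => c * f x) p μ = c * eLpNorm f p μ := by
  rcases eq_or_ne p 0 with rfl | h0
  · simp
  rcases eq_or_ne p ⊤ with rfl | ht
  · simpa [eLpNormEssSup] using ENNReal.essSup_const_mul
  · have hp : 0 < p.toReal := ENNReal.toReal_pos h0 ht
    simp_rw [eLpNorm_eq_lintegral_rpow_enorm_toReal h0 ht, enorm_eq_self,
      ENNReal.mul_rpow_of_nonneg _ _ hp.le]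
    rw [lintegral_const_mul' _ _ (ENNReal.rpow_ne_top_of_nonneg hp.le hc),
      ENNReal.mul_rpow_of_nonneg _ _ (by positivity), ← ENNReal.rpow_mul,
      mul_one_div_cancel hp.ne', ENNReal.rpow_one]

theorem lintegral_mul_le_eLpNorm {p q : ℝ≥0∞} [hpq : p.HolderConjugate q] {f g : α → ℝ≥0∞}
    (hf : Measurable f) (hg : Measurable g) :
    ∫⁻ x, f x * g x ∂μ ≤ eLpNorm f p μ * eLpNorm g q μ := by
  -- The endpoint pair `(1, ∞)`, not covered by the Hölder inequality for real conjugate exponents;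
  -- used in both orders.
  have key : ∀ {f g : α → ℝ≥0∞}, Measurable f →
      ∫⁻ x, f x * g x ∂μ ≤ eLpNorm f 1 μ * eLpNorm g ⊤ μ := by
    intro f g hf
    rw [eLpNorm_one_eq_lintegral_enorm, eLpNorm_exponent_top]
    simp_rw [enorm_eq_self]
    rw [← lintegral_mul_const _ hf]
    refine lintegral_mono_ae ?_
    filter_upwards [ENNReal.ae_le_essSup (μ := μ) g] with x hx
    refine mul_le_mul' le_rfl (hx.trans (le_of_eq ?_))
    simp [eLpNormEssSup]
  rcases eq_or_ne p ⊤ with rfl | hp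
  · have : q = 1 := (ENNReal.HolderConjugate.eq_top_iff_eq_one (⊤ : ℝ≥0∞) q).1 rfl
    subst this
    rw [mul_comm]
    simp_rw [mul_comm (f _)]
    exact key hg
  rcases eq_or_ne q ⊤ with rfl | hq
  · have : p = 1 :=
      haveI : (⊤ : ℝ≥0∞).HolderConjugate p := ENNReal.HolderConjugate.symm
      (ENNReal.HolderConjugate.eq_top_iff_eq_one (⊤ : ℝ≥0∞) p).1 rfl
    subst this
    exact key hf
  have h := ENNReal.HolderConjugate.toReal_of_ne_top hp hq (p := p) (q := q)
  have hp0 : p ≠ 0 := fun h0 => by simpa [h0] using h.pos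
  have hq0 : q ≠ 0 := fun h0 => by simpa [h0] using h.symm.pos
  simp_rw [eLpNorm_eq_lintegral_rpow_enorm_toReal hp0 hp,
    eLpNorm_eq_lintegral_rpow_enorm_toReal hq0 hq, enorm_eq_self]
  exact ENNReal.lintegral_mul_le_Lp_mul_Lq μ h hf.aemeasurable hg.aemeasurable

theorem eLpNorm_lt_top_of_le_one {p : ℝ≥0∞} (hp : 1 ≤ p) {f : α → ℝ≥0∞} (h1 : ∀ x, f x ≤ 1)
    (hf : ∫⁻ x, f x ∂μ ≠ ⊤) : eLpNorm f p μ < ⊤ := by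
  rcases eq_or_ne p ⊤ with rfl | ht
  · rw [eLpNorm_exponent_top]
    refine lt_of_le_of_lt (essSup_le_of_ae_le 1 (Filter.Eventually.of_forall fun x => ?_))
      ENNReal.one_lt_top
    simpa using h1 x
  have h0 : p ≠ 0 := (zero_lt_one.trans_le hp).ne'
  have hp1 : 1 ≤ p.toReal := by
    rw [← ENNReal.toReal_one]; exact ENNReal.toReal_mono ht hp
  simp_rw [eLpNorm_eq_lintegral_rpow_enorm_toReal h0 ht, enorm_eq_self]
  refine ENNReal.rpow_lt_top_of_nonneg (by positivity) (ne_top_of_le_ne_top hf ?_)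
  refine lintegral_mono fun x => ?_
  calc f x ^ p.toReal ≤ f x ^ (1 : ℝ) := ENNReal.rpow_le_rpow_of_exponent_ge (h1 x) hp1
    _ = f x := ENNReal.rpow_one _

end LpENNReal

/-! ### Mixed norms on phase space: scaling, translation, Young, Hölder, block-diagonal changes of
variables. -/

section Mixed

variable {d : ℕ}

theorem continuous_pair : Continuous fun z : EuclideanSpace ℝ (Fin d) × EuclideanSpace ℝ (Fin d) =>
    pair z.1 z.2 := by
  simp_rw [pair_eq]; fun_prop

theorem fstPart_pair (x y : EuclideanSpace ℝ (Fin d)) : fstPart (pair x y) = x := rfl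

theorem sndPart_pair (x y : EuclideanSpace ℝ (Fin d)) : sndPart (pair x y) = y := rfl

theorem pair_fstPart_sndPart (z : EuclideanSpace ℝ (Fin d ⊕ Fin d)) :
    pair (fstPart z) (sndPart z) = z := by
  ext i; cases i <;> rfl

theorem continuous_fstPart : Continuous (fstPart : EuclideanSpace ℝ (Fin d ⊕ Fin d) → _) :=
  (fstL d).continuous

theorem continuous_sndPart : Continuous (sndPart : EuclideanSpace ℝ (Fin d ⊕ Fin d) → _) :=
  (sndL d).continuous

theorem fstPart_sub (z w : EuclideanSpace ℝ (Fin d ⊕ Fin d)) :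
    fstPart (z - w) = fstPart z - fstPart w := rfl

theorem sndPart_sub (z w : EuclideanSpace ℝ (Fin d ⊕ Fin d)) :
    sndPart (z - w) = sndPart z - sndPart w := rfl

theorem pair_sub (x y x' y' : EuclideanSpace ℝ (Fin d)) :
    pair x y - pair x' y' = pair (x - x') (y - y') := by
  simp only [pair_eq, map_sub]; abel

theorem pair_add (x y x' y' : EuclideanSpace ℝ (Fin d)) :
    pair x y + pair x' y' = pair (x + x') (y + y') := by
  simp only [pair_eq, map_add]; abel

theorem measurePreserving_pair :
    MeasurePreserving (fun z : EuclideanSpace ℝ (Fin d) × EuclideanSpace ℝ (Fin d) =>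
      pair z.1 z.2) (volume.prod volume) volume := by
  have h1 := (EuclideanSpace.volume_preserving_symm_measurableEquiv_toLp (Fin d)).prod
    (EuclideanSpace.volume_preserving_symm_measurableEquiv_toLp (Fin d))
  have h2 := volume_measurePreserving_sumPiEquivProdPi_symm (fun _ : Fin d ⊕ Fin d => ℝ)
  have h3 := (EuclideanSpace.volume_preserving_symm_measurableEquiv_toLp (Fin d ⊕ Fin d)).symm
  have h4 := h3.comp (h2.comp h1)
  convert! h4 using 1

theorem measurableEmbedding_pair :
    MeasurableEmbedding (fun z : EuclideanSpace ℝ (Fin d) × EuclideanSpace ℝ (Fin d) =>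
      pair z.1 z.2) := by
  refine continuous_pair.measurableEmbedding fun a b h => ?_
  have h1 := congrArg fstPart h
  have h2 := congrArg sndPart h
  simp only [fstPart_pair, sndPart_pair] at h1 h2
  exact Prod.ext h1 h2

theorem lintegral_eq_lintegral_pair {H : EuclideanSpace ℝ (Fin d ⊕ Fin d) → ℝ≥0∞}
    (hH : Measurable H) :
    ∫⁻ z, H z = ∫⁻ ξ : EuclideanSpace ℝ (Fin d), ∫⁻ x : EuclideanSpace ℝ (Fin d), H (pair x ξ) := by
  rw [← measurePreserving_pair.lintegral_comp hH, lintegral_prod_symm]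
  exact (hH.comp continuous_pair.measurable).aemeasurable

theorem ae_ae_pair {P : EuclideanSpace ℝ (Fin d ⊕ Fin d) → Prop} (h : ∀ᵐ z, P z) :
    ∀ᵐ ξ : EuclideanSpace ℝ (Fin d), ∀ᵐ x : EuclideanSpace ℝ (Fin d), P (pair x ξ) := by
  have h1 : ∀ᵐ z : EuclideanSpace ℝ (Fin d) × EuclideanSpace ℝ (Fin d) ∂(volume.prod volume),
      P (pair z.1 z.2) := measurePreserving_pair.quasiMeasurePreserving.ae h
  have h2 := (Measure.measurePreserving_swap (μ := volume) (ν := volume)).quasiMeasurePreserving.ae h1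
  exact Measure.ae_ae_of_ae_prod h2

/-- The mixed `L^{p,q}` (quasi-)norm of a function with values in `[0, ∞]`. -/
def mixE (p q : ℝ≥0∞) (H : EuclideanSpace ℝ (Fin d ⊕ Fin d) → ℝ≥0∞) : ℝ≥0∞ :=
  eLpNorm (fun ξ : EuclideanSpace ℝ (Fin d) =>
    eLpNorm (fun x : EuclideanSpace ℝ (Fin d) => H (pair x ξ)) p volume) q volume

theorem mixedNorm_eq_mixE (p q : ℝ≥0∞) (s : ℝ) (F : EuclideanSpace ℝ (Fin d ⊕ Fin d) → ℂ) :
    mixedNorm p q s F = mixE p q (fun z => ‖weight s z‖ₑ * ‖F z‖ₑ) := by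
  unfold mixedNorm mixE
  congr 1
  funext ξ
  rw [← eLpNorm_enorm]
  simp_rw [enorm_smul]

theorem mixE_mono_ae (p q : ℝ≥0∞) {H K : EuclideanSpace ℝ (Fin d ⊕ Fin d) → ℝ≥0∞}
    (h : ∀ᵐ z, H z ≤ K z) : mixE p q H ≤ mixE p q K := by
  refine eLpNorm_mono_enorm_ae ?_
  filter_upwards [ae_ae_pair h] with ξ hξ
  simp only [enorm_eq_self]
  exact eLpNorm_mono_enorm_ae (by simpa using hξ)

theorem mixE_mono (p q : ℝ≥0∞) {H K : EuclideanSpace ℝ (Fin d ⊕ Fin d) → ℝ≥0∞}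
    (h : ∀ z, H z ≤ K z) : mixE p q H ≤ mixE p q K :=
  mixE_mono_ae p q (Filter.Eventually.of_forall h)

theorem mixE_const_mul (p q : ℝ≥0∞) {c : ℝ≥0∞} (hc : c ≠ ⊤)
    (H : EuclideanSpace ℝ (Fin d ⊕ Fin d) → ℝ≥0∞) :
    mixE p q (fun z => c * H z) = c * mixE p q H := by
  unfold mixE
  simp_rw [eLpNorm_const_mul_ennreal hc]

/-- The device for exponents below 1: passing to `r`-th powers divides both exponents by `r`, which
brings them up to at least 1. -/
theorem mixE_rpow (p q : ℝ≥0∞) {r : ℝ} (hr : 0 < r)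
    (H : EuclideanSpace ℝ (Fin d ⊕ Fin d) → ℝ≥0∞) :
    mixE p q (fun z => H z ^ r) = mixE (p * ENNReal.ofReal r) (q * ENNReal.ofReal r) H ^ r := by
  unfold mixE
  have h1 : ∀ ξ : EuclideanSpace ℝ (Fin d),
      eLpNorm (fun x : EuclideanSpace ℝ (Fin d) => H (pair x ξ) ^ r) p volume
      = eLpNorm (fun x => H (pair x ξ)) (p * ENNReal.ofReal r) volume ^ r := fun ξ => by
    simpa using eLpNorm_enorm_rpow (μ := volume) (p := p) (fun x => H (pair x ξ)) hr
  simp_rw [h1]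
  simpa using eLpNorm_enorm_rpow (μ := volume) (p := q) (fun ξ : EuclideanSpace ℝ (Fin d) =>
    eLpNorm (fun x : EuclideanSpace ℝ (Fin d) => H (pair x ξ)) (p * ENNReal.ofReal r) volume) hr

theorem eLpNorm_comp_sub_right (p : ℝ≥0∞) (f : EuclideanSpace ℝ (Fin d) → ℝ≥0∞)
    (a : EuclideanSpace ℝ (Fin d)) :
    eLpNorm (fun x => f (x - a)) p volume = eLpNorm f p volume := by
  have h := (MeasurableEquiv.subRight a).measurableEmbedding.eLpNorm_map_measure (g := f) (p := p)
    (μ := volume)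
  rw [show Measure.map (MeasurableEquiv.subRight a) (volume : Measure (EuclideanSpace ℝ (Fin d)))
    = volume from map_sub_right_eq_self volume a] at h
  exact h.symm

theorem mixE_comp_sub (p q : ℝ≥0∞) (H : EuclideanSpace ℝ (Fin d ⊕ Fin d) → ℝ≥0∞)
    (w : EuclideanSpace ℝ (Fin d ⊕ Fin d)) :
    mixE p q (fun z => H (z - w)) = mixE p q H := by
  unfold mixE
  have h1 : ∀ x ξ : EuclideanSpace ℝ (Fin d),
      pair x ξ - w = pair (x - fstPart w) (ξ - sndPart w) := fun x ξ => by
    conv_lhs => rw [← pair_fstPart_sndPart w]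
    rw [pair_sub]
  simp_rw [h1]
  have h2 : ∀ ξ : EuclideanSpace ℝ (Fin d),
      eLpNorm (fun x => H (pair (x - fstPart w) (ξ - sndPart w))) p volume
        = eLpNorm (fun x => H (pair x (ξ - sndPart w))) p volume := fun ξ =>
    eLpNorm_comp_sub_right p (fun x => H (pair x (ξ - sndPart w))) (fstPart w)
  simp_rw [h2]
  exact eLpNorm_comp_sub_right q
    (fun ξ => eLpNorm (fun x => H (pair x ξ)) p volume) (sndPart w)

/-- Minkowski's inequality in the inner variable, then in the outer one. -/
theorem mixE_lintegral_le {β : Type*} [MeasurableSpace β] {ν : Measure β} [SFinite ν] {p q : ℝ≥0∞}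
    (hp : 1 ≤ p) (hq : 1 ≤ q) {K : EuclideanSpace ℝ (Fin d ⊕ Fin d) → β → ℝ≥0∞}
    (hK : Measurable (Function.uncurry K)) :
    mixE p q (fun z => ∫⁻ w, K z w ∂ν) ≤ ∫⁻ w, mixE p q (fun z => K z w) ∂ν := by
  unfold mixE
  have m1 : ∀ ξ : EuclideanSpace ℝ (Fin d),
      Measurable (Function.uncurry fun (x : EuclideanSpace ℝ (Fin d)) w => K (pair x ξ) w) := by
    intro ξ
    have h : Measurable fun z : EuclideanSpace ℝ (Fin d) × β => (pair z.1 ξ, z.2) :=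
      (continuous_pair.measurable.comp (measurable_fst.prodMk measurable_const)).prodMk
        measurable_snd
    exact hK.comp h
  have m2 : Measurable (Function.uncurry fun (ξ : EuclideanSpace ℝ (Fin d)) w =>
      eLpNorm (fun x : EuclideanSpace ℝ (Fin d) => K (pair x ξ) w) p volume) := by
    have h : Measurable fun z : EuclideanSpace ℝ (Fin d) × (EuclideanSpace ℝ (Fin d) × β) =>
        (pair z.1 z.2.1, z.2.2) :=
      (continuous_pair.measurable.comp (measurable_fst.prodMk
        (measurable_fst.comp measurable_snd))).prodMk (measurable_snd.comp measurable_snd)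
    exact measurable_eLpNorm_left p
      (k := fun (x : EuclideanSpace ℝ (Fin d)) (z : EuclideanSpace ℝ (Fin d) × β) =>
        K (pair x z.1) z.2) (hK.comp h)
  refine le_trans (eLpNorm_mono_enorm fun ξ => ?_) (eLpNorm_lintegral_le (ν := ν) hq m2)
  simp only [enorm_eq_self]
  exact eLpNorm_lintegral_le hp (m1 ξ)

/-- **Young's inequality** for mixed norms. -/
theorem mixE_convolution_le {β : Type*} [MeasurableSpace β] {ν : Measure β} [SFinite ν]
    {p q : ℝ≥0∞} (hp : 1 ≤ p) (hq : 1 ≤ q) {H : EuclideanSpace ℝ (Fin d ⊕ Fin d) → ℝ≥0∞}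
    (hH : Measurable H) {k : β → ℝ≥0∞} (hk : Measurable k) (hkt : ∀ w, k w ≠ ⊤)
    {B : β → EuclideanSpace ℝ (Fin d ⊕ Fin d)} (hB : Measurable B) :
    mixE p q (fun z => ∫⁻ w, k w * H (z - B w) ∂ν) ≤ (∫⁻ w, k w ∂ν) * mixE p q H := by
  have hm : Measurable (Function.uncurry fun (z : EuclideanSpace ℝ (Fin d ⊕ Fin d)) w =>
      k w * H (z - B w)) :=
    (hk.comp measurable_snd).mul (hH.comp (measurable_fst.sub (hB.comp measurable_snd)))
  refine (mixE_lintegral_le hp hq hm).trans (le_of_eq ?_)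
  rw [← lintegral_mul_const _ hk]
  refine lintegral_congr fun w => ?_
  rw [mixE_const_mul p q (hkt w), mixE_comp_sub]

theorem lintegral_mul_le_mixE {p q p' q' : ℝ≥0∞} [p.HolderConjugate p'] [q.HolderConjugate q']
    {H K : EuclideanSpace ℝ (Fin d ⊕ Fin d) → ℝ≥0∞} (hH : Measurable H) (hK : Measurable K) :
    ∫⁻ z, H z * K z ≤ mixE p q H * mixE p' q' K := by
  rw [lintegral_eq_lintegral_pair (H := fun z => H z * K z) (hH.mul hK)]
  have m1 : ∀ {H : EuclideanSpace ℝ (Fin d ⊕ Fin d) → ℝ≥0∞}, Measurable H →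
      Measurable (Function.uncurry fun x ξ : EuclideanSpace ℝ (Fin d) => H (pair x ξ)) :=
    fun hH => hH.comp continuous_pair.measurable
  have m2 : ∀ {H : EuclideanSpace ℝ (Fin d ⊕ Fin d) → ℝ≥0∞}, Measurable H →
      ∀ ξ : EuclideanSpace ℝ (Fin d), Measurable fun x => H (pair x ξ) :=
    fun hH ξ => (m1 hH).comp measurable_prodMk_right
  exact (lintegral_mono fun ξ => lintegral_mul_le_eLpNorm (p := p) (q := p') (m2 hH ξ)
    (m2 hK ξ)).trans (lintegral_mul_le_eLpNorm (measurable_eLpNorm_left p (m1 hH))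
      (measurable_eLpNorm_left p' (m1 hK)))

theorem exists_eLpNorm_comp_linearEquiv (p : ℝ≥0∞)
    (S : EuclideanSpace ℝ (Fin d) ≃ₗ[ℝ] EuclideanSpace ℝ (Fin d)) :
    ∃ c : ℝ≥0∞, c ≠ 0 ∧ c ≠ ⊤ ∧ ∀ f : EuclideanSpace ℝ (Fin d) → ℝ≥0∞,
      eLpNorm (fun x => f (S x)) p volume = c * eLpNorm f p volume := by
  have hdet : LinearMap.det (S : EuclideanSpace ℝ (Fin d) →ₗ[ℝ] EuclideanSpace ℝ (Fin d)) ≠ 0 :=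
    (LinearEquiv.isUnit_det' S).ne_zero
  have h1 := Measure.map_linearMap_addHaar_eq_smul_addHaar
    (volume : Measure (EuclideanSpace ℝ (Fin d))) hdet
  set a := ENNReal.ofReal |(LinearMap.det
    (S : EuclideanSpace ℝ (Fin d) →ₗ[ℝ] EuclideanSpace ℝ (Fin d)))⁻¹| with ha
  have ha0 : a ≠ 0 := by
    simp only [ha, ne_eq, ENNReal.ofReal_eq_zero, not_le]
    positivity
  have hat : a ≠ ⊤ := ENNReal.ofReal_ne_top
  refine ⟨a ^ (1 / p).toReal, ?_, ?_, fun f => ?_⟩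
  · simp [ENNReal.rpow_eq_zero_iff, ha0, hat]
  · simp [ENNReal.rpow_eq_top_iff, ha0, hat]
  · have h2 := S.toContinuousLinearEquiv.toHomeomorph.measurableEmbedding.eLpNorm_map_measure
      (g := f) (p := p) (μ := volume)
    have h3 : Measure.map S.toContinuousLinearEquiv.toHomeomorph
        (volume : Measure (EuclideanSpace ℝ (Fin d))) = a • volume := h1
    rw [h3, eLpNorm_smul_measure_of_ne_zero ha0] at h2
    exact h2.symm

/-- Each block is rescaled within its own norm. A linear map mixing `x` and `ξ` would not respect a
mixed norm in general, so the block-diagonal form is essential. -/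
theorem exists_mixE_comp_linearEquiv (p q : ℝ≥0∞)
    (S R : EuclideanSpace ℝ (Fin d) ≃ₗ[ℝ] EuclideanSpace ℝ (Fin d)) :
    ∃ c : ℝ≥0∞, c ≠ 0 ∧ c ≠ ⊤ ∧ ∀ H : EuclideanSpace ℝ (Fin d ⊕ Fin d) → ℝ≥0∞,
      mixE p q (fun z => H (pair (S (fstPart z)) (R (sndPart z)))) = c * mixE p q H := by
  obtain ⟨a, ha0, hat, ha⟩ := exists_eLpNorm_comp_linearEquiv p S
  obtain ⟨b, hb0, hbt, hb⟩ := exists_eLpNorm_comp_linearEquiv q R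
  refine ⟨a * b, mul_ne_zero ha0 hb0, ENNReal.mul_ne_top hat hbt, fun H => ?_⟩
  unfold mixE
  simp only [fstPart_pair, sndPart_pair]
  have h1 : ∀ ξ : EuclideanSpace ℝ (Fin d),
      eLpNorm (fun x : EuclideanSpace ℝ (Fin d) => H (pair (S x) (R ξ))) p volume
        = a * eLpNorm (fun x => H (pair x (R ξ))) p volume :=
    fun ξ => ha fun x => H (pair x (R ξ))
  simp_rw [h1]
  rw [eLpNorm_const_mul_ennreal hat,
    hb fun ξ => eLpNorm (fun x : EuclideanSpace ℝ (Fin d) => H (pair x ξ)) p volume, mul_assoc]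

end Mixed

/-! ### Peetre's maximal function and the sub-mean value property for exponents at most 1. -/

section Bracket

variable {V : Type*} [NormedAddCommGroup V]

/-- The bracket `1 + ‖z‖` as an extended nonnegative real. -/
def bracket (z : V) : ℝ≥0∞ := ENNReal.ofReal (1 + ‖z‖)

theorem one_le_bracket (z : V) : 1 ≤ bracket z := by
  rw [bracket, ← ENNReal.ofReal_one]
  exact ENNReal.ofReal_le_ofReal (by linarith [norm_nonneg z])

theorem bracket_ne_zero (z : V) : bracket z ≠ 0 := (zero_lt_one.trans_le (one_le_bracket z)).ne'

theorem bracket_ne_top (z : V) : bracket z ≠ ⊤ := ENNReal.ofReal_ne_top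

theorem bracket_zero : bracket (0 : V) = 1 := by simp [bracket]

theorem bracket_add_le (z w : V) : bracket (z + w) ≤ bracket z * bracket w := by
  rw [bracket, bracket, bracket, ← ENNReal.ofReal_mul (by positivity)]
  refine ENNReal.ofReal_le_ofReal ?_
  nlinarith [norm_add_le z w, mul_nonneg (norm_nonneg z) (norm_nonneg w)]

theorem bracket_neg (z : V) : bracket (-z) = bracket z := by simp [bracket]

theorem bracket_sub_le (z w : V) : bracket (z - w) ≤ bracket z * bracket w := by
  rw [sub_eq_add_neg, ← bracket_neg w]
  exact bracket_add_le z (-w)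

theorem bracket_rpow_mul_le {N : ℝ} (hN : 0 ≤ N) (u w : V) :
    bracket u ^ (-N) * bracket w ^ (-N) ≤ bracket (w + u) ^ (-N) := by
  rw [← ENNReal.mul_rpow_of_ne_top (bracket_ne_top u) (bracket_ne_top w), ENNReal.rpow_neg,
    ENNReal.rpow_neg, ENNReal.inv_le_inv]
  exact ENNReal.rpow_le_rpow (by rw [add_comm]; exact bracket_add_le u w) hN

theorem bracket_rpow_neg_le {N : ℝ} (hN : 0 ≤ N) (u w : V) :
    bracket u ^ (-N) ≤ bracket w ^ N * bracket (w + u) ^ (-N) := by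
  have h : bracket (w + u) ^ N ≤ bracket w ^ N * bracket u ^ N := by
    rw [← ENNReal.mul_rpow_of_nonneg _ _ hN]
    exact ENNReal.rpow_le_rpow (bracket_add_le w u) hN
  have h0 : ∀ z : V, bracket z ^ N ≠ 0 := fun z => by
    simp [ENNReal.rpow_eq_zero_iff, bracket_ne_zero, bracket_ne_top]
  have ht : ∀ z : V, bracket z ^ N ≠ ⊤ := fun z =>
    ENNReal.rpow_ne_top_of_nonneg hN (bracket_ne_top z)
  rw [ENNReal.rpow_neg, ENNReal.rpow_neg, ← div_eq_mul_inv,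
    ENNReal.le_div_iff_mul_le (Or.inl (h0 _)) (Or.inl (ht _)), mul_comm, ← div_eq_mul_inv,
    ENNReal.div_le_iff_le_mul (Or.inl (h0 _)) (Or.inl (ht _))]
  exact h

theorem bracket_rpow_le_one {N : ℝ} (hN : 0 ≤ N) (u : V) : bracket u ^ (-N) ≤ 1 := by
  rw [ENNReal.rpow_neg, ENNReal.inv_le_one]
  rcases hN.eq_or_lt with rfl | h
  · simp
  · exact ENNReal.one_le_rpow (one_le_bracket u) h

theorem continuous_bracket : Continuous (bracket : V → ℝ≥0∞) :=
  ENNReal.continuous_ofReal.comp (continuous_const.add continuous_norm)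

/-- The Peetre maximal function `sup_w F(z - w) (1 + |w|)^{-N}`. -/
def peetreMax (F : V → ℝ≥0∞) (N : ℝ) (z : V) : ℝ≥0∞ := ⨆ w, F (z - w) * bracket w ^ (-N)

/-- Since `⟨z - w⟩^K ≤ ⟨z⟩^K ⟨w⟩^K`, growth of order `K ≤ N` is absorbed by the weight `⟨w⟩^{-N}`.
-/
theorem peetreMax_ne_top {F : V → ℝ≥0∞} {K N : ℝ} {A : ℝ≥0∞} (hK : 0 ≤ K) (hKN : K ≤ N)
    (hA : A ≠ ⊤) (hg : ∀ z, F z ≤ A * bracket z ^ K) (z : V) : peetreMax F N z ≠ ⊤ := by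
  have hb : A * bracket z ^ K ≠ ⊤ :=
    ENNReal.mul_ne_top hA (ENNReal.rpow_ne_top_of_nonneg hK (bracket_ne_top z))
  refine ne_top_of_le_ne_top hb (iSup_le fun w => ?_)
  calc F (z - w) * bracket w ^ (-N) ≤ A * bracket (z - w) ^ K * bracket w ^ (-N) := by
        gcongr; exact hg _
    _ ≤ A * (bracket z * bracket w) ^ K * bracket w ^ (-N) := by
        gcongr; exact bracket_sub_le z w
    _ = A * bracket z ^ K * (bracket w ^ K * bracket w ^ (-N)) := by
        rw [ENNReal.mul_rpow_of_nonneg _ _ hK]; ring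
    _ ≤ A * bracket z ^ K * 1 := by
        gcongr
        rw [← ENNReal.rpow_add _ _ (bracket_ne_zero w) (bracket_ne_top w),
          show K + -N = -(N - K) by ring]
        exact bracket_rpow_le_one (by linarith) w
    _ = _ := mul_one _

variable [MeasurableSpace V] {μ : Measure V}

/-- The integral `∫ (F(z - u) (1 + |u|)^{-N})^r du`. -/
def peetreIntegral (μ : Measure V) (F : V → ℝ≥0∞) (r N : ℝ) (z : V) : ℝ≥0∞ :=
  ∫⁻ u, (F (z - u) * bracket u ^ (-N)) ^ r ∂μ

/-- Write the integrand as the product of its powers `1 - r` and `r`; the first is bounded by the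
supremum, the second is left under the integral. -/
theorem lintegral_le_peetre {F : V → ℝ≥0∞} {r N : ℝ} (hr : 0 < r) (hr1 : r ≤ 1) (z : V)
    (hP : peetreMax F N z ≠ ⊤) :
    ∫⁻ u, F (z - u) * bracket u ^ (-N) ∂μ
      ≤ peetreMax F N z ^ (1 - r) * peetreIntegral μ F r N z := by
  rw [peetreIntegral, ← lintegral_const_mul' _ _ (ENNReal.rpow_ne_top_of_nonneg (by linarith) hP)]
  refine lintegral_mono fun u => ?_
  calc F (z - u) * bracket u ^ (-N)
      = (F (z - u) * bracket u ^ (-N)) ^ ((1 - r) + r) := by simp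
    _ = (F (z - u) * bracket u ^ (-N)) ^ (1 - r) * (F (z - u) * bracket u ^ (-N)) ^ r :=
        ENNReal.rpow_add_of_nonneg _ _ (by linarith) hr.le
    _ ≤ _ := by
        refine mul_le_mul' (ENNReal.rpow_le_rpow ?_ (by linarith)) le_rfl
        exact le_iSup (fun w => F (z - w) * bracket w ^ (-N)) u

variable [BorelSpace V]

theorem measurable_bracket : Measurable (bracket : V → ℝ≥0∞) := continuous_bracket.measurable

variable [μ.IsAddHaarMeasure]

/-- The self-domination of `F` passes to its maximal function without loss: `⟨u⟩^{-N}⟨w⟩^{-N} ≤ ⟨w +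
u⟩^{-N}`, and the shift by `w` disappears by invariance of the measure. -/
theorem peetreMax_le {F : V → ℝ≥0∞} {N : ℝ} {C : ℝ≥0∞} (hN : 0 ≤ N)
    (hF : ∀ z, F z ≤ C * ∫⁻ u, F (z - u) * bracket u ^ (-N) ∂μ) (z : V) :
    peetreMax F N z ≤ C * ∫⁻ u, F (z - u) * bracket u ^ (-N) ∂μ := by
  refine iSup_le fun w => ?_
  have hb : bracket w ^ (-N) ≠ ⊤ := ne_top_of_le_ne_top ENNReal.one_ne_top (bracket_rpow_le_one hN w)
  calc F (z - w) * bracket w ^ (-N)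
      ≤ (C * ∫⁻ u, F (z - w - u) * bracket u ^ (-N) ∂μ) * bracket w ^ (-N) := by
        gcongr; exact hF _
    _ = C * ∫⁻ u, F (z - w - u) * (bracket u ^ (-N) * bracket w ^ (-N)) ∂μ := by
        rw [mul_assoc, ← lintegral_mul_const' _ _ hb]; simp_rw [mul_assoc]
    _ ≤ C * ∫⁻ u, F (z - (w + u)) * bracket (w + u) ^ (-N) ∂μ := by
        gcongr with u
        · exact le_of_eq (by congr 1; abel)
        · exact bracket_rpow_mul_le hN u w
    _ = _ := by
        rw [lintegral_add_left_eq_self (fun u => F (z - u) * bracket u ^ (-N)) w]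

/-- Combining the two previous bounds gives `P ≤ C P^{1-r} I` for the maximal function `P` and the
integral `I`. Cancelling `P^{1-r}` is legitimate only when `P` is known to be finite. -/
theorem peetreMax_rpow_le {F : V → ℝ≥0∞} {r N : ℝ} {C : ℝ≥0∞} (hr : 0 < r) (hr1 : r ≤ 1)
    (hN : 0 ≤ N) (hF : ∀ z, F z ≤ C * ∫⁻ u, F (z - u) * bracket u ^ (-N) ∂μ) (z : V)
    (hP : peetreMax F N z ≠ ⊤) :
    peetreMax F N z ^ r ≤ C * peetreIntegral μ F r N z := by
  rcases eq_or_ne (peetreMax F N z) 0 with h0 | h0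
  · simp [h0, ENNReal.zero_rpow_of_pos hr]
  have h1 : peetreMax F N z ^ (1 - r) * peetreMax F N z ^ r
      ≤ peetreMax F N z ^ (1 - r) * (C * peetreIntegral μ F r N z) := by
    rw [← ENNReal.rpow_add _ _ h0 hP, sub_add_cancel, ENNReal.rpow_one]
    refine (peetreMax_le hN hF z).trans ?_
    rw [mul_left_comm]
    exact mul_le_mul' le_rfl (lintegral_le_peetre hr hr1 z hP)
  refine (ENNReal.mul_le_mul_iff_right ?_ ?_).1 h1
  · simp [ENNReal.rpow_eq_zero_iff, h0, hP]
  · exact ENNReal.rpow_ne_top_of_nonneg (by linarith) hP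

theorem peetreIntegral_sub_le {F : V → ℝ≥0∞} {r N : ℝ} (hr : 0 < r) (hN : 0 ≤ N) (z w : V) :
    peetreIntegral μ F r N (z - w) ≤ (bracket w ^ N) ^ r * peetreIntegral μ F r N z := by
  have hb : (bracket w ^ N) ^ r ≠ ⊤ := ENNReal.rpow_ne_top_of_nonneg hr.le
    (ENNReal.rpow_ne_top_of_nonneg hN (bracket_ne_top w))
  calc peetreIntegral μ F r N (z - w)
      ≤ ∫⁻ u, (bracket w ^ N) ^ r * (F (z - (w + u)) * bracket (w + u) ^ (-N)) ^ r ∂μ := by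
        refine lintegral_mono fun u => ?_
        rw [← ENNReal.mul_rpow_of_nonneg _ _ hr.le]
        refine ENNReal.rpow_le_rpow ?_ hr.le
        rw [mul_left_comm, sub_sub]
        exact mul_le_mul' le_rfl (bracket_rpow_neg_le hN u w)
    _ = _ := by
        rw [lintegral_const_mul' _ _ hb,
          lintegral_add_left_eq_self (fun u => (F (z - u) * bracket u ^ (-N)) ^ r) w]
        rfl

/-- A function of polynomial growth which is dominated by its own convolutions with rapidly
decreasing kernels satisfies a sub-mean value property for every exponent `r ≤ 1`. -/
theorem rpow_le_peetreIntegral {F : V → ℝ≥0∞} {r N : ℝ} {C : ℝ≥0∞} (hr : 0 < r) (hr1 : r ≤ 1)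
    (hN : 0 ≤ N) (hC : C ≠ 0) (hCt : C ≠ ⊤)
    (hF : ∀ z, F z ≤ C * ∫⁻ u, F (z - u) * bracket u ^ (-N) ∂μ)
    (hF' : ∀ N' : ℝ, 0 ≤ N' → ∃ C' : ℝ≥0∞, C' ≠ ⊤ ∧
      ∀ z, F z ≤ C' * ∫⁻ u, F (z - u) * bracket u ^ (-N') ∂μ)
    (hg : ∃ (K : ℝ) (A : ℝ≥0∞), 0 ≤ K ∧ A ≠ ⊤ ∧ ∀ z, F z ≤ A * bracket z ^ K)
    {x D : ℝ≥0∞} (hD : D ≠ 0) (hDt : D ≠ ⊤) (z : V)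
    (hx : x ≤ D * ∫⁻ u, F (z - u) * bracket u ^ (-N) ∂μ) :
    x ^ r ≤ D ^ r * C ^ (1 - r) * peetreIntegral μ F r N z := by
  -- The infinite case is trivial only because `C` and `D` are non-zero: in `ℝ≥0∞` one has `0 * ⊤ =
  -- 0`.
  rcases eq_or_ne (peetreIntegral μ F r N z) ⊤ with hI | hI
  · rw [hI, ENNReal.mul_top]
    · exact le_top
    · simp [ENNReal.rpow_eq_zero_iff, hC, hCt, hD, hDt]
  -- `N` may be smaller than the growth order `K` of `F`, so finiteness is obtained by a detour
  -- through the exponent `max N K`, where growth guarantees it. The resulting bound on `F(z - w)^r`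
  -- returns to `N` because the integral varies at most like `⟨w⟩^{Nr}`. The constant `C'` found
  -- here depends on the growth of `F`, but serves only to prove finiteness.
  have hP : peetreMax F N z ≠ ⊤ := by
    obtain ⟨K, A, hK, hA, hgr⟩ := hg
    obtain ⟨C', hC', hF1⟩ := hF' (max N K) (hN.trans (le_max_left _ _))
    have h1 : ∀ w, (F (z - w) * bracket w ^ (-N)) ^ r ≤ C' * peetreIntegral μ F r N z := by
      intro w
      have h2 := peetreMax_rpow_le hr hr1 (hN.trans (le_max_left _ _)) hF1 (z - w)
        (peetreMax_ne_top hK (le_max_right _ _) hA hgr _)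
      have h3 : F (z - w) ≤ peetreMax F (max N K) (z - w) := by
        refine le_trans (le_of_eq ?_)
          (le_iSup (fun u => F (z - w - u) * bracket u ^ (-(max N K))) 0)
        simp [bracket_zero]
      have h4 : peetreIntegral μ F r (max N K) (z - w) ≤ peetreIntegral μ F r N (z - w) := by
        refine lintegral_mono fun u => ENNReal.rpow_le_rpow (mul_le_mul' le_rfl ?_) hr.le
        exact ENNReal.rpow_le_rpow_of_exponent_le (one_le_bracket u) (by simp)
      have hb : (bracket w ^ (-N)) ^ r * (bracket w ^ N) ^ r = 1 := by
        rw [← ENNReal.mul_rpow_of_nonneg _ _ hr.le,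
          ← ENNReal.rpow_add _ _ (bracket_ne_zero w) (bracket_ne_top w)]
        simp
      calc (F (z - w) * bracket w ^ (-N)) ^ r
          = F (z - w) ^ r * (bracket w ^ (-N)) ^ r := ENNReal.mul_rpow_of_nonneg _ _ hr.le
        _ ≤ (C' * ((bracket w ^ N) ^ r * peetreIntegral μ F r N z)) * (bracket w ^ (-N)) ^ r := by
            refine mul_le_mul' ?_ le_rfl
            calc F (z - w) ^ r ≤ peetreMax F (max N K) (z - w) ^ r := ENNReal.rpow_le_rpow h3 hr.le
              _ ≤ _ := h2.trans (mul_le_mul' le_rfl (h4.trans (peetreIntegral_sub_le hr hN z w)))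
        _ = C' * peetreIntegral μ F r N z * ((bracket w ^ (-N)) ^ r * (bracket w ^ N) ^ r) := by
            ring
        _ = _ := by rw [hb, mul_one]
    have h5 : peetreMax F N z ≤ (C' * peetreIntegral μ F r N z) ^ r⁻¹ := by
      refine iSup_le fun w => ?_
      rw [ENNReal.le_rpow_inv_iff hr]
      exact h1 w
    exact ne_top_of_le_ne_top
      (ENNReal.rpow_ne_top_of_nonneg (by positivity) (ENNReal.mul_ne_top hC' hI)) h5
  have h1r : 0 ≤ 1 - r := by linarith
  -- With finiteness available, the estimate is rerun with `C` and `D` alone, so the final constant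
  -- does not see the growth of `F`.
  calc x ^ r ≤ (D * (peetreMax F N z ^ (1 - r) * peetreIntegral μ F r N z)) ^ r :=
        ENNReal.rpow_le_rpow (hx.trans (mul_le_mul' le_rfl (lintegral_le_peetre hr hr1 z hP))) hr.le
    _ = D ^ r * ((peetreMax F N z ^ r) ^ (1 - r) * peetreIntegral μ F r N z ^ r) := by
        rw [ENNReal.mul_rpow_of_nonneg _ _ hr.le, ENNReal.mul_rpow_of_nonneg _ _ hr.le,
          ← ENNReal.rpow_mul, ← ENNReal.rpow_mul, mul_comm r]
    _ ≤ D ^ r * ((C * peetreIntegral μ F r N z) ^ (1 - r) * peetreIntegral μ F r N z ^ r) := by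
        refine mul_le_mul' le_rfl (mul_le_mul' (ENNReal.rpow_le_rpow ?_ h1r) le_rfl)
        exact peetreMax_rpow_le hr hr1 hN hF z hP
    _ = D ^ r * C ^ (1 - r) * (peetreIntegral μ F r N z ^ (1 - r) * peetreIntegral μ F r N z ^ r) := by
        rw [ENNReal.mul_rpow_of_nonneg _ _ h1r]; ring
    _ = _ := by
        rw [← ENNReal.rpow_add_of_nonneg _ _ h1r hr.le, sub_add_cancel, ENNReal.rpow_one]

theorem lintegral_bracket_rpow_lt_top [NormedSpace ℝ V] [FiniteDimensional ℝ V] {t : ℝ} (ht : Module.finrank ℝ V < t) :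
    ∫⁻ z : V, bracket z ^ (-t) ∂μ < ⊤ := by
  refine lt_of_eq_of_lt (lintegral_congr fun z => ?_) (finite_integral_one_add_norm (μ := μ) ht)
  rw [bracket, ENNReal.ofReal_rpow_of_pos (by positivity)]

end Bracket

/-! ### Moderateness of the polynomial weights. -/

section Weight

variable {d : ℕ}

theorem weight_pos (s : ℝ) (z : EuclideanSpace ℝ (Fin d ⊕ Fin d)) : 0 < weight s z := by
  unfold weight; positivity

theorem continuous_weight (s : ℝ) : Continuous (weight (d := d) s) := by
  unfold weight
  exact (continuous_const.add (continuous_norm.pow 2)).rpow_const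
    fun z => Or.inl (show (1 : ℝ) + ‖z‖ ^ 2 ≠ 0 by positivity)

/-- Comparability is required both ways because `s` may be negative, in which case the second
inequality is the one that is used. -/
theorem weight_le_of_comparable {s c : ℝ} (hc : 0 < c) {z z' : EuclideanSpace ℝ (Fin d ⊕ Fin d)}
    (h : 1 + ‖z‖ ^ 2 ≤ c * (1 + ‖z'‖ ^ 2)) (h' : 1 + ‖z'‖ ^ 2 ≤ c * (1 + ‖z‖ ^ 2)) :
    weight s z ≤ c ^ (|s| / 2) * weight s z' := by
  unfold weight
  rcases le_total 0 s with hs | hs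
  · rw [abs_of_nonneg hs, ← Real.mul_rpow hc.le (by positivity)]
    exact Real.rpow_le_rpow (by positivity) h (by positivity)
  · have h1 := Real.rpow_le_rpow_of_nonpos (by positivity : (0 : ℝ) < 1 + ‖z'‖ ^ 2) h' (show s / 2 ≤ 0 by linarith)
    rw [Real.mul_rpow hc.le (by positivity)] at h1
    calc (1 + ‖z‖ ^ 2) ^ (s / 2)
        = c ^ (|s| / 2) * (c ^ (s / 2) * (1 + ‖z‖ ^ 2) ^ (s / 2)) := by
          rw [← mul_assoc, ← Real.rpow_add hc, abs_of_nonpos hs,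
            show -s / 2 + s / 2 = 0 by ring, Real.rpow_zero, one_mul]
      _ ≤ _ := by gcongr

/-- Peetre's inequality: `1 + |z|²` and `1 + |z - w|²` differ at most by the factor `2(1 + |w|²)`,
in either direction. It is what lets a weight pass through a convolution, for either sign of `s`. -/
theorem weight_le_mul_weight_sub (s : ℝ) (z w : EuclideanSpace ℝ (Fin d ⊕ Fin d)) :
    weight s z ≤ 2 ^ (|s| / 2) * weight |s| w * weight s (z - w) := by
  have h1 : (2 : ℝ) ^ (|s| / 2) * weight |s| w = (2 * (1 + ‖w‖ ^ 2)) ^ (|s| / 2) := by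
    rw [Real.mul_rpow (by norm_num) (by positivity)]; rfl
  have key : ∀ a b c : ℝ, 0 ≤ a → 0 ≤ b → 0 ≤ c → a ≤ b + c →
      1 + a ^ 2 ≤ 2 * (1 + c ^ 2) * (1 + b ^ 2) := by
    intro a b c ha hb hc h
    nlinarith [sq_nonneg (b - c), mul_nonneg (sq_nonneg b) (sq_nonneg c), sq_nonneg b, sq_nonneg c,
      pow_le_pow_left₀ ha h 2]
  rw [h1]
  refine weight_le_of_comparable (by positivity) ?_ ?_
  · refine key _ _ _ (norm_nonneg _) (norm_nonneg _) (norm_nonneg _) ?_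
    calc ‖z‖ = ‖(z - w) + w‖ := by rw [sub_add_cancel]
      _ ≤ _ := norm_add_le _ _
  · exact key _ _ _ (norm_nonneg _) (norm_nonneg _) (norm_nonneg _) (norm_sub_le _ _)

theorem weight_abs_le_one_add_rpow (s : ℝ) (z : EuclideanSpace ℝ (Fin d ⊕ Fin d)) :
    weight |s| z ≤ (1 + ‖z‖) ^ |s| := by
  unfold weight
  calc (1 + ‖z‖ ^ 2) ^ (|s| / 2) ≤ ((1 + ‖z‖) ^ 2) ^ (|s| / 2) :=
        Real.rpow_le_rpow (by positivity) (by nlinarith [norm_nonneg z]) (by positivity)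
    _ = _ := by
        rw [← Real.rpow_natCast, ← Real.rpow_mul (by positivity)]
        congr 1; push_cast; ring

theorem enorm_weight_le_of_comparable {s c : ℝ} (hc : 0 < c)
    {z z' : EuclideanSpace ℝ (Fin d ⊕ Fin d)}
    (h : 1 + ‖z‖ ^ 2 ≤ c * (1 + ‖z'‖ ^ 2)) (h' : 1 + ‖z'‖ ^ 2 ≤ c * (1 + ‖z‖ ^ 2)) :
    ‖weight s z‖ₑ ≤ ENNReal.ofReal (c ^ (|s| / 2)) * ‖weight s z'‖ₑ := by
  rw [Real.enorm_of_nonneg (weight_pos _ _).le, Real.enorm_of_nonneg (weight_pos _ _).le,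
    ← ENNReal.ofReal_mul (by positivity)]
  exact ENNReal.ofReal_le_ofReal (weight_le_of_comparable hc h h')

theorem enorm_weight_le_mul (s : ℝ) (z w : EuclideanSpace ℝ (Fin d ⊕ Fin d)) :
    ‖weight s z‖ₑ
      ≤ ENNReal.ofReal (2 ^ (|s| / 2)) * ‖weight |s| w‖ₑ * ‖weight s (z - w)‖ₑ := by
  rw [Real.enorm_of_nonneg (weight_pos _ _).le, Real.enorm_of_nonneg (weight_pos _ _).le,
    Real.enorm_of_nonneg (weight_pos _ _).le, ← ENNReal.ofReal_mul (by positivity),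
    ← ENNReal.ofReal_mul (mul_nonneg (by positivity) (weight_pos _ _).le)]
  exact ENNReal.ofReal_le_ofReal (weight_le_mul_weight_sub s z w)

theorem enorm_weight_abs_le_bracket (s : ℝ) (z : EuclideanSpace ℝ (Fin d ⊕ Fin d)) :
    ‖weight |s| z‖ₑ ≤ bracket z ^ |s| := by
  rw [Real.enorm_of_nonneg (weight_pos _ _).le, bracket,
    ENNReal.ofReal_rpow_of_pos (by positivity)]
  exact ENNReal.ofReal_le_ofReal (weight_abs_le_one_add_rpow s z)

/-- Weights are invariant under linear automorphisms, up to a constant factor. -/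
theorem exists_enorm_weight_le_comp (s : ℝ)
    (T : EuclideanSpace ℝ (Fin d ⊕ Fin d) ≃ₗ[ℝ] EuclideanSpace ℝ (Fin d ⊕ Fin d)) :
    ∃ c : ℝ≥0∞, c ≠ 0 ∧ c ≠ ⊤ ∧ ∀ z, ‖weight s z‖ₑ ≤ c * ‖weight s (T z)‖ₑ ∧
      ‖weight s (T z)‖ₑ ≤ c * ‖weight s z‖ₑ := by
  set S := T.toContinuousLinearEquiv with hS
  set K := max 1 (max ‖(S : EuclideanSpace ℝ (Fin d ⊕ Fin d) →L[ℝ]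
      EuclideanSpace ℝ (Fin d ⊕ Fin d))‖
    ‖(S.symm : EuclideanSpace ℝ (Fin d ⊕ Fin d) →L[ℝ]
      EuclideanSpace ℝ (Fin d ⊕ Fin d))‖) with hK
  have h1 : ∀ z, ‖T z‖ ≤ K * ‖z‖ := fun z =>
    ((S : EuclideanSpace ℝ (Fin d ⊕ Fin d) →L[ℝ]
      EuclideanSpace ℝ (Fin d ⊕ Fin d)).le_opNorm z).trans (by
      gcongr; exact (le_max_left _ _).trans (le_max_right _ _))
  have h2 : ∀ z, ‖z‖ ≤ K * ‖T z‖ := fun z => by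
    have := (S.symm : EuclideanSpace ℝ (Fin d ⊕ Fin d) →L[ℝ]
      EuclideanSpace ℝ (Fin d ⊕ Fin d)).le_opNorm (S z)
    simp only [ContinuousLinearEquiv.coe_coe, ContinuousLinearEquiv.symm_apply_apply] at this
    exact this.trans (by gcongr; exacts [(le_max_right _ _).trans (le_max_right _ _), le_rfl])
  have hK1 : 1 ≤ K := le_max_left _ _
  have key : ∀ a b : ℝ, 0 ≤ a → 0 ≤ b → a ≤ K * b → 1 + a ^ 2 ≤ K ^ 2 * (1 + b ^ 2) := by
    intro a b ha hb h
    nlinarith [pow_le_pow_left₀ ha h 2]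
  have hKp : 0 < K ^ 2 := by positivity
  refine ⟨ENNReal.ofReal ((K ^ 2) ^ (|s| / 2)), ?_, ENNReal.ofReal_ne_top, fun z => ⟨?_, ?_⟩⟩
  · simp only [ne_eq, ENNReal.ofReal_eq_zero, not_le]; positivity
  · exact enorm_weight_le_of_comparable hKp (key _ _ (norm_nonneg _) (norm_nonneg _) (h2 z))
      (key _ _ (norm_nonneg _) (norm_nonneg _) (h1 z))
  · exact enorm_weight_le_of_comparable hKp (key _ _ (norm_nonneg _) (norm_nonneg _) (h1 z))
      (key _ _ (norm_nonneg _) (norm_nonneg _) (h2 z))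

end Weight

/-- A linear functional which is bounded for the norm induced by an injection into a normed space
factors through a continuous functional. -/
theorem exists_extension_of_norm_le {X B : Type*} [AddCommGroup X] [Module ℂ X]
    [NormedAddCommGroup B] [NormedSpace ℂ B] (J : X →ₗ[ℂ] B) (hJ : Function.Injective J)
    (f : X →ₗ[ℂ] ℂ) {C : ℝ} (hC : ∀ x, ‖f x‖ ≤ C * ‖J x‖) :
    ∃ F : B →L[ℂ] ℂ, ∀ x, F (J x) = f x := by
  set e := LinearEquiv.ofInjective J hJ with he
  set f₀ : StrongDual ℂ (LinearMap.range J) :=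
    LinearMap.mkContinuous (f.comp e.symm.toLinearMap) C (fun y => by
      obtain ⟨χ, rfl⟩ := e.surjective y
      change ‖f (e.symm (e χ))‖ ≤ C * ‖J χ‖
      rw [e.symm_apply_apply]
      exact hC χ) with hf₀
  obtain ⟨F, hF, -⟩ := exists_extension_norm_eq _ f₀
  refine ⟨F, fun x => ?_⟩
  have h1 := hF (e x)
  rw [show ((e x : _) : B) = J x from rfl] at h1
  rw [h1]
  simp [hf₀]

theorem boundedContinuous_integral_apply {X G W : Type*} [TopologicalSpace X]
    [NormedAddCommGroup G] [NormedSpace ℂ G] [CompleteSpace G] [MeasurableSpace W] {μ : Measure W}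
    {u : W → X →ᵇ G} (hu : Integrable u μ) (x : X) : (∫ w, u w ∂μ) x = ∫ w, u w x ∂μ :=
  ((BoundedContinuousFunction.evalCLM ℂ x).integral_comp_comm hu).symm

/-! ### Interchange of tempered distributions with integrals of Schwartz functions. -/

section Pettis

variable {V : Type} [NormedAddCommGroup V] [NormedSpace ℝ V]

/-- The weighted derivative `x ↦ ‖x‖ᵏ Dⁿφ(x)` of a Schwartz function, as a bounded continuous
function. -/
def weightedDerivFun (k n : ℕ) (φ : 𝓢(V, ℂ)) :
    V →ᵇ (ContinuousMultilinearMap ℝ (fun _ : Fin n => V) ℂ) :=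
  BoundedContinuousFunction.ofNormedAddCommGroup
    (fun x => ((‖x‖ ^ k : ℝ) : ℂ) • iteratedFDeriv ℝ n φ x)
    ((Complex.continuous_ofReal.comp (continuous_norm.pow k)).smul
      ((φ.smooth ⊤).continuous_iteratedFDeriv (mod_cast le_top)))
    (SchwartzMap.seminorm ℝ k n φ) (fun x => by
      rw [norm_smul]
      simpa using SchwartzMap.le_seminorm ℝ k n φ x)

theorem norm_weightedDerivFun_le (k n : ℕ) (φ : 𝓢(V, ℂ)) :
    ‖weightedDerivFun k n φ‖ ≤ SchwartzMap.seminorm ℝ k n φ := by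
  refine (BoundedContinuousFunction.norm_le (apply_nonneg _ _)).2 fun x => ?_
  change ‖((‖x‖ ^ k : ℝ) : ℂ) • iteratedFDeriv ℝ n φ x‖ ≤ _
  rw [norm_smul]
  simpa using SchwartzMap.le_seminorm ℝ k n φ x

/-- The weighted derivative `x ↦ ‖x‖ᵏ Dⁿφ(x)` as a continuous linear map. -/
def weightedDeriv (k n : ℕ) :
    𝓢(V, ℂ) →L[ℂ] (V →ᵇ (ContinuousMultilinearMap ℝ (fun _ : Fin n => V) ℂ)) :=
  SchwartzMap.mkCLMtoNormedSpace (D := V) (E := ℂ) (σ := RingHom.id ℂ) (weightedDerivFun k n)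
    (fun φ ψ => by
      apply BoundedContinuousFunction.ext
      intro x
      have : iteratedFDeriv ℝ n (φ + ψ : 𝓢(V, ℂ)) x
          = iteratedFDeriv ℝ n φ x + iteratedFDeriv ℝ n ψ x :=
        iteratedFDeriv_add_apply (φ.smooth _).contDiffAt (ψ.smooth _).contDiffAt
      change ((‖x‖ ^ k : ℝ) : ℂ) • iteratedFDeriv ℝ n (φ + ψ : 𝓢(V, ℂ)) x
        = ((‖x‖ ^ k : ℝ) : ℂ) • iteratedFDeriv ℝ n φ x
          + ((‖x‖ ^ k : ℝ) : ℂ) • iteratedFDeriv ℝ n ψ x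
      rw [this, smul_add])
    (fun a φ => by
      apply BoundedContinuousFunction.ext
      intro x
      have : iteratedFDeriv ℝ n (a • φ : 𝓢(V, ℂ)) x = a • iteratedFDeriv ℝ n φ x :=
        iteratedFDeriv_const_smul_apply (φ.smooth _).contDiffAt
      change ((‖x‖ ^ k : ℝ) : ℂ) • iteratedFDeriv ℝ n (a • φ : 𝓢(V, ℂ)) x
        = a • ((‖x‖ ^ k : ℝ) : ℂ) • iteratedFDeriv ℝ n φ x
      rw [this, smul_comm])
    ⟨{(k, n)}, 1, zero_le_one, fun φ => by
      rw [one_mul, Finset.sup_singleton]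
      exact norm_weightedDerivFun_le k n φ⟩

theorem weightedDeriv_apply (k n : ℕ) (φ : 𝓢(V, ℂ)) (x : V) :
    weightedDeriv k n φ x = ((‖x‖ ^ k : ℝ) : ℂ) • iteratedFDeriv ℝ n φ x := rfl

theorem seminorm_le_norm_weightedDeriv (k n : ℕ) (φ : 𝓢(V, ℂ)) :
    SchwartzMap.seminorm ℝ k n φ ≤ ‖weightedDeriv k n φ‖ := by
  refine SchwartzMap.seminorm_le_bound ℝ k n φ (norm_nonneg (weightedDeriv k n φ)) fun x => ?_
  refine le_trans (le_of_eq ?_) ((weightedDeriv k n φ).norm_coe_le_norm x)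
  rw [weightedDeriv_apply, norm_smul]
  simp

theorem norm_weightedDeriv_le (k n : ℕ) (φ : 𝓢(V, ℂ)) :
    ‖weightedDeriv k n φ‖ ≤ SchwartzMap.seminorm ℝ k n φ := norm_weightedDerivFun_le k n φ

theorem continuous_iteratedFDeriv_apply (n : ℕ) (x : V) :
    Continuous fun φ : 𝓢(V, ℂ) => iteratedFDeriv ℝ n φ x := by
  have h : Continuous fun φ : 𝓢(V, ℂ) => weightedDeriv 0 n φ x :=
    (BoundedContinuousFunction.evalCLM ℂ x).continuous.comp (weightedDeriv 0 n).continuous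
  simpa [weightedDeriv_apply] using h

theorem continuous_schwartz_apply (x : V) : Continuous fun φ : 𝓢(V, ℂ) => φ x := by
  have h := (continuousMultilinearCurryFin0 ℝ V ℂ).continuous.comp
    (continuous_iteratedFDeriv_apply (V := V) 0 x)
  refine h.congr fun φ => ?_
  simp [iteratedFDeriv_zero_eq_comp]

theorem norm_iteratedFDeriv_le_seminorm (n : ℕ) (φ : 𝓢(V, ℂ)) (x : V) :
    ‖iteratedFDeriv ℝ n φ x‖ ≤ SchwartzMap.seminorm ℝ 0 n φ := by
  simpa using SchwartzMap.le_seminorm ℝ 0 n φ x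

theorem norm_apply_le_seminorm (φ : 𝓢(V, ℂ)) (x : V) : ‖φ x‖ ≤ SchwartzMap.seminorm ℝ 0 0 φ := by
  simpa using norm_iteratedFDeriv_le_seminorm 0 φ x

variable {W : Type*} [TopologicalSpace W] [SecondCountableTopology W] [MeasurableSpace W]
  [OpensMeasurableSpace W] {μ : Measure W} {h : W → ℂ} {φ : W → 𝓢(V, ℂ)}

theorem integrable_smul_of_norm_le_seminorm {G : Type*} [NormedAddCommGroup G] [NormedSpace ℂ G]
    (hh : AEStronglyMeasurable h μ) {k n : ℕ}
    (hint : Integrable (fun w => ‖h w‖ * SchwartzMap.seminorm ℝ k n (φ w)) μ) {u : W → G}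
    (hu : Continuous u) (hle : ∀ w, ‖u w‖ ≤ SchwartzMap.seminorm ℝ k n (φ w)) :
    Integrable (fun w => h w • u w) μ := by
  refine hint.mono' ?_ (Filter.Eventually.of_forall fun w => ?_)
  · exact hh.smul hu.aestronglyMeasurable
  · rw [norm_smul]; gcongr; exact hle w

/-- Differentiation under the integral sign, with the derivative transported through a currying
isometry `L`, so that it can serve as the induction step for iterated derivatives. -/
theorem map_fderiv_integral_smul {G G' : Type*} [NormedAddCommGroup G] [NormedSpace ℝ G]
    [NormedSpace ℂ G] [SMulCommClass ℝ ℂ G] [NormedAddCommGroup G'] [NormedSpace ℝ G']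
    [NormedSpace ℂ G'] (L : (V →L[ℝ] G) ≃ₗᵢ[ℝ] G') (hL : ∀ (c : ℂ) T, L (c • T) = c • L T)
    (hh : AEStronglyMeasurable h μ) {u : W → V → G} (hu : ∀ w, Differentiable ℝ (u w))
    (hi : ∀ x, Integrable (fun w => h w • u w x) μ)
    (hc : ∀ x, Continuous fun w => L (fderiv ℝ (u w) x)) {b : W → ℝ}
    (hb : ∀ w x, ‖L (fderiv ℝ (u w) x)‖ ≤ b w) (hint : Integrable (fun w => ‖h w‖ * b w) μ)
    (x : V) :
    L (fderiv ℝ (fun x => ∫ w, h w • u w x ∂μ) x) = ∫ w, h w • L (fderiv ℝ (u w) x) ∂μ := by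
  have hc' : Continuous fun w => fderiv ℝ (u w) x := 
    (L.symm.continuous.comp (hc x)).congr fun w => L.symm_apply_apply _
  have hder : HasFDerivAt (fun x => ∫ w, h w • u w x ∂μ) (∫ w, h w • fderiv ℝ (u w) x ∂μ) x := by
    refine hasFDerivAt_integral_of_dominated_of_fderiv_le (s := Set.univ)
      (F' := fun x w => h w • fderiv ℝ (u w) x) (bound := fun w => ‖h w‖ * b w) Filter.univ_mem
      (Filter.Eventually.of_forall fun y => (hi y).aestronglyMeasurable) (hi x)
      (hh.smul hc'.aestronglyMeasurable) (Filter.Eventually.of_forall fun w y _ => ?_) hint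
      (Filter.Eventually.of_forall fun w y _ => ?_)
    · rw [norm_smul, ← L.norm_map]; gcongr; exact hb w y
    · exact (hu w y).hasFDerivAt.const_smul (h w)
  rw [hder.fderiv]
  have h3 := L.toContinuousLinearEquiv.integral_comp_comm (μ := μ)
    (fun w => h w • fderiv ℝ (u w) x)
  exact h3.symm.trans (integral_congr_ae (Filter.Eventually.of_forall fun w => hL _ _))

/-- Induction on the order; the domination at each step is by the seminorm of index `(0, n + 1)`,
and measurability comes from continuity of `φ` into the Schwartz space. -/
theorem iteratedFDeriv_integral (hh : AEStronglyMeasurable h μ) (hφ : Continuous φ)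
    (hint : ∀ k n, Integrable (fun w => ‖h w‖ * SchwartzMap.seminorm ℝ k n (φ w)) μ) {ψ : V → ℂ}
    (hψ : ∀ x, ψ x = ∫ w, h w * φ w x ∂μ) (n : ℕ) (x : V) :
    iteratedFDeriv ℝ n ψ x = ∫ w, h w • iteratedFDeriv ℝ n (φ w) x ∂μ := by
  have hi : ∀ n x, Integrable (fun w => h w • iteratedFDeriv ℝ n (φ w) x) μ := fun n x =>
    integrable_smul_of_norm_le_seminorm hh (hint 0 n)
      ((continuous_iteratedFDeriv_apply n x).comp hφ)
      fun w => norm_iteratedFDeriv_le_seminorm n (φ w) x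
  induction n generalizing x with
  | zero =>
    simp only [iteratedFDeriv_zero_eq_comp, Function.comp_apply, hψ]
    have h1 := (continuousMultilinearCurryFin0 ℝ V ℂ).symm.toContinuousLinearEquiv.integral_comp_comm
      (μ := μ) (fun w => h w * φ w x)
    refine h1.symm.trans (integral_congr_ae (Filter.Eventually.of_forall fun w => ?_))
    ext m
    simp
  | succ n ih =>
    have e : iteratedFDeriv ℝ n ψ = fun x => ∫ w, h w • iteratedFDeriv ℝ n (φ w) x ∂μ := funext ih
    have hLs : ∀ (χ : V → ℂ) y,
        (continuousMultilinearCurryLeftEquiv ℝ (fun _ : Fin (n + 1) => V) ℂ).symm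
          (fderiv ℝ (iteratedFDeriv ℝ n χ) y) = iteratedFDeriv ℝ (n + 1) χ y := by
      intro χ y
      rw [iteratedFDeriv_succ_eq_comp_left]
      rfl
    have key := map_fderiv_integral_smul (μ := μ) (h := h)
      (L := (continuousMultilinearCurryLeftEquiv ℝ (fun _ : Fin (n + 1) => V) ℂ).symm)
      (fun c T => by ext m; rfl) hh (u := fun w => iteratedFDeriv ℝ n (φ w))
      (fun w => ((φ w).smooth ⊤).differentiable_iteratedFDeriv (mod_cast WithTop.coe_lt_top _))
      (hi n) (fun x => by
        simp_rw [hLs]; exact (continuous_iteratedFDeriv_apply (n + 1) x).comp hφ)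
      (b := fun w => SchwartzMap.seminorm ℝ 0 (n + 1) (φ w))
      (fun w x => by rw [hLs]; exact norm_iteratedFDeriv_le_seminorm (n + 1) (φ w) x)
      (hint 0 (n + 1)) x
    rw [← hLs, e]
    refine key.trans (integral_congr_ae (Filter.Eventually.of_forall fun w => ?_))
    exact congrArg (h w • ·) (hLs _ _)

/-- A linear functional which is bounded by the norms of finitely many maps into Banach spaces
commutes with every integral which these maps commute with. -/
theorem linear_apply_eq_integral_of_bound {ι : Type*} [Fintype ι] {B : ι → Type*}
    [∀ i, NormedAddCommGroup (B i)] [∀ i, NormedSpace ℂ (B i)] [∀ i, CompleteSpace (B i)]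
    {X : Type*} [AddCommGroup X] [Module ℂ X] (J : ∀ i, X →ₗ[ℂ] B i)
    (hJ : ∀ x, (∀ i, J i x = 0) → x = 0) (f : X →ₗ[ℂ] ℂ) {C : ℝ} (hC : 0 ≤ C)
    (hf : ∀ x, ‖f x‖ ≤ C * ∑ i, ‖J i x‖) {φ : W → X}
    (hh : AEStronglyMeasurable h μ) (hφ : ∀ i, Continuous fun w => J i (φ w)) {b : ι → W → ℝ}
    (hb : ∀ i w, ‖J i (φ w)‖ ≤ b i w) (hbi : ∀ i, Integrable (fun w => ‖h w‖ * b i w) μ) {ψ : X}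
    (hψ : ∀ i, Integrable (fun w => h w • J i (φ w)) μ → J i ψ = ∫ w, h w • J i (φ w) ∂μ) :
    Integrable (fun w => h w * f (φ w)) μ ∧ f ψ = ∫ w, h w * f (φ w) ∂μ := by
  have hint : ∀ i, Integrable (fun w => h w • J i (φ w)) μ := fun i => by
    refine (hbi i).mono' (hh.smul (hφ i).aestronglyMeasurable)
      (Filter.Eventually.of_forall fun w => ?_)
    rw [norm_smul]; gcongr; exact hb i w
  -- By Hahn–Banach, `f` is a continuous functional of the tuple of the `J i`, and continuous
  -- functionals commute with Bochner integrals. The number of indices enters the constant because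
  -- the product carries the supremum norm.
  obtain ⟨F, hF⟩ := exists_extension_of_norm_le (LinearMap.pi J)
    (by
      rw [injective_iff_map_eq_zero]
      exact fun x hx => hJ x fun i => congrFun hx i) f (C := C * Fintype.card ι) (fun x => by
      refine (hf x).trans ?_
      rw [mul_assoc]
      gcongr
      rw [← nsmul_eq_mul]
      exact Finset.sum_le_card_nsmul _ _ _ fun i _ => norm_le_pi_norm (LinearMap.pi J x) i)
  have hJi : Integrable (fun w => h w • LinearMap.pi J (φ w)) μ := Integrable.of_eval hint
  have hval : LinearMap.pi J ψ = ∫ w, h w • LinearMap.pi J (φ w) ∂μ := by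
    funext i
    exact (hψ i (hint i)).trans (eval_integral hint i).symm
  have h1 := F.integrable_comp hJi
  have h2 := F.integral_comp_comm hJi
  simp only [map_smul, hF, smul_eq_mul] at h1 h2
  exact ⟨h1, by rw [h2, ← hval, hF]⟩

/-- A tempered distribution commutes with absolutely convergent integrals of Schwartz functions. -/
theorem tempered_apply_eq_integral {d : ℕ} (f : 𝓢'(EuclideanSpace ℝ (Fin d), ℂ))
    {φ : W → 𝓢(EuclideanSpace ℝ (Fin d), ℂ)}
    (hh : AEStronglyMeasurable h μ) (hφ : Continuous φ)
    (hint : ∀ k n, Integrable (fun w => ‖h w‖ * SchwartzMap.seminorm ℝ k n (φ w)) μ)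
    {ψ : 𝓢(EuclideanSpace ℝ (Fin d), ℂ)} (hψ : ∀ x, ψ x = ∫ w, h w * φ w x ∂μ) :
    Integrable (fun w => h w * f (φ w)) μ ∧ f ψ = ∫ w, h w * f (φ w) ∂μ := by
  classical
  obtain ⟨s, C, hC, hf⟩ := exists_bound f
  -- The index `(0, 0)` is added so that the family of weighted derivatives separates Schwartz
  -- functions.
  set t : Finset (ℕ × ℕ) := insert (0, 0) s with ht
  refine linear_apply_eq_integral_of_bound (ι := t) (B := fun m : t => EuclideanSpace ℝ (Fin d) →ᵇ
      (ContinuousMultilinearMap ℝ (fun _ : Fin m.1.2 => EuclideanSpace ℝ (Fin d)) ℂ))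
    (fun m => (weightedDeriv (V := EuclideanSpace ℝ (Fin d)) m.1.1 m.1.2).toLinearMap)
    (fun χ hχ => ?_) (f : 𝓢(EuclideanSpace ℝ (Fin d), ℂ) →ₗ[ℂ] ℂ) hC (fun χ => ?_) hh
    (fun m => ?_)
    (b := fun m w => SchwartzMap.seminorm ℝ m.1.1 m.1.2 (φ w)) (fun m w => ?_)
    (fun m => hint m.1.1 m.1.2)
    (fun m hm => ?_)
  · have h0 : weightedDeriv 0 0 χ = 0 := hχ ⟨(0, 0), by simp [ht]⟩
    ext x
    have h1 := norm_apply_le_seminorm χ x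
    have h2 := (seminorm_le_norm_weightedDeriv 0 0 χ).trans_eq
      ((congrArg (fun u => ‖u‖) h0).trans
        (norm_zero (E := EuclideanSpace ℝ (Fin d) →ᵇ
          (ContinuousMultilinearMap ℝ (fun _ : Fin 0 => EuclideanSpace ℝ (Fin d)) ℂ))))
    simpa using h1.trans h2
  · refine (hf χ).trans (mul_le_mul_of_nonneg_left ?_ hC)
    calc ∑ m ∈ s, SchwartzMap.seminorm ℝ m.1 m.2 χ
        ≤ ∑ m ∈ t, SchwartzMap.seminorm ℝ m.1 m.2 χ :=
          Finset.sum_le_sum_of_subset_of_nonneg (by simp [ht]) fun _ _ _ => apply_nonneg _ _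
      _ ≤ ∑ m ∈ t, ‖weightedDeriv m.1 m.2 χ‖ :=
          Finset.sum_le_sum fun m _ => seminorm_le_norm_weightedDeriv m.1 m.2 χ
      _ = _ := (Finset.sum_coe_sort t fun m => ‖weightedDeriv m.1 m.2 χ‖).symm
  · exact (weightedDeriv m.1.1 m.1.2).continuous.comp hφ
  · exact norm_weightedDeriv_le m.1.1 m.1.2 (φ w)
  · apply BoundedContinuousFunction.ext
    intro x
    refine Eq.trans ?_ (boundedContinuous_integral_apply hm x).symm
    change ((‖x‖ ^ m.1.1 : ℝ) : ℂ) • iteratedFDeriv ℝ m.1.2 ψ x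
      = ∫ w, h w • ((‖x‖ ^ m.1.1 : ℝ) : ℂ) • iteratedFDeriv ℝ m.1.2 (φ w) x ∂μ
    rw [iteratedFDeriv_integral hh hφ hint hψ]
    simp_rw [smul_comm (h _)]
    rw [integral_smul]

end Pettis

/-! ### Polynomial bounds and joint continuity of translation on the Schwartz space. -/

section Translation

theorem pow_norm_le_of_sub {V : Type*} [NormedAddCommGroup V] (x a : V) (k : ℕ) :
    ‖x‖ ^ k ≤ (1 + ‖a‖) ^ k * (2 ^ k * (1 + ‖x - a‖ ^ k)) := by
  have h1 : ‖x‖ ≤ (1 + ‖a‖) * (1 + ‖x - a‖) := by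
    have := norm_add_le (x - a) a
    rw [sub_add_cancel] at this
    nlinarith [norm_nonneg a, norm_nonneg (x - a), mul_nonneg (norm_nonneg a) (norm_nonneg (x - a))]
  calc ‖x‖ ^ k ≤ ((1 + ‖a‖) * (1 + ‖x - a‖)) ^ k := by gcongr
    _ = (1 + ‖a‖) ^ k * (1 + ‖x - a‖) ^ k := mul_pow _ _ _
    _ ≤ (1 + ‖a‖) ^ k * (2 ^ (k - 1) * (1 ^ k + ‖x - a‖ ^ k)) := by
        gcongr
        exact add_pow_le zero_le_one (norm_nonneg _) k
    _ ≤ _ := by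
        rw [one_pow]
        gcongr
        · norm_num
        · omega

variable {V : Type} [NormedAddCommGroup V] [NormedSpace ℝ V]

theorem iteratedFDeriv_compSubConst (a : V) (ψ : 𝓢(V, ℂ)) (n : ℕ) (x : V) :
    iteratedFDeriv ℝ n (compSubConstCLM ℂ a ψ) x = iteratedFDeriv ℝ n ψ (x - a) :=
  iteratedFDeriv_comp_sub n a x

theorem seminorm_compSubConst_le (k n : ℕ) (a : V) (ψ : 𝓢(V, ℂ)) :
    SchwartzMap.seminorm ℂ k n (compSubConstCLM ℂ a ψ)
      ≤ (1 + ‖a‖) ^ k * (2 ^ k * (SchwartzMap.seminorm ℂ 0 n ψ + SchwartzMap.seminorm ℂ k n ψ)) := by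
  refine SchwartzMap.seminorm_le_bound ℂ k n _ (by positivity) fun x => ?_
  rw [iteratedFDeriv_compSubConst]
  have h0 := SchwartzMap.le_seminorm ℂ 0 n ψ (x - a)
  have hk := SchwartzMap.le_seminorm ℂ k n ψ (x - a)
  rw [pow_zero, one_mul] at h0
  calc ‖x‖ ^ k * ‖iteratedFDeriv ℝ n ψ (x - a)‖
      ≤ (1 + ‖a‖) ^ k * (2 ^ k * (1 + ‖x - a‖ ^ k)) * ‖iteratedFDeriv ℝ n ψ (x - a)‖ := by
        gcongr; exact pow_norm_le_of_sub x a k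
    _ = (1 + ‖a‖) ^ k * (2 ^ k * (‖iteratedFDeriv ℝ n ψ (x - a)‖
          + ‖x - a‖ ^ k * ‖iteratedFDeriv ℝ n ψ (x - a)‖)) := by ring
    _ ≤ _ := by gcongr

/-- Stated for arbitrary continuous seminorms, so that it can be composed with the Fourier transform
when modulations are treated. The power `K` is the largest decay index among the Schwartz seminorms
dominating `q`. -/
theorem exists_seminorm_compSubConst_le (q : Seminorm ℂ 𝓢(V, ℂ)) (hq : Continuous q) :
    ∃ (K : ℕ) (q' : Seminorm ℂ 𝓢(V, ℂ)), Continuous q' ∧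
      ∀ (a : V) (ψ : 𝓢(V, ℂ)), q (compSubConstCLM ℂ a ψ) ≤ (1 + ‖a‖) ^ K * q' ψ := by
  obtain ⟨s, C, -, hs⟩ := Seminorm.bound_of_continuous (schwartz_withSeminorms ℂ V ℂ) q hq
  obtain ⟨Q, hQ, e⟩ := exists_sum_seminorm s (fun m : ℕ × ℕ => C * 2 ^ m.1)
    (fun m => schwartzSeminormFamily ℂ V ℂ (0, m.2) + schwartzSeminormFamily ℂ V ℂ m)
    (fun m => ((schwartz_withSeminorms ℂ V ℂ).continuous_seminorm _).add
      ((schwartz_withSeminorms ℂ V ℂ).continuous_seminorm _))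
  refine ⟨s.sup Prod.fst, Q, hQ, fun a ψ => ?_⟩
  have h1 : q (compSubConstCLM ℂ a ψ)
      ≤ C * ∑ m ∈ s, schwartzSeminormFamily ℂ V ℂ m (compSubConstCLM ℂ a ψ) := by
    refine (hs _).trans ?_
    change (C : ℝ) * _ ≤ _
    gcongr
    refine (Seminorm.le_def.1 (Seminorm.finset_sup_le_sum _ s) _).trans (le_of_eq ?_)
    rw [← FunLike.coeAddMonoidHom_apply, map_sum, Finset.sum_apply]
    rfl
  refine h1.trans ?_
  rw [e, Finset.mul_sum, Finset.mul_sum]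
  refine Finset.sum_le_sum fun m hm => ?_
  have h2 : (1 + ‖a‖) ^ m.1 ≤ (1 + ‖a‖) ^ s.sup Prod.fst :=
    pow_le_pow_right₀ (by linarith [norm_nonneg a]) (Finset.le_sup (f := Prod.fst) hm)
  calc (C : ℝ) * schwartzSeminormFamily ℂ V ℂ m (compSubConstCLM ℂ a ψ)
      ≤ C * ((1 + ‖a‖) ^ m.1 * (2 ^ m.1 * (SchwartzMap.seminorm ℂ 0 m.2 ψ
          + SchwartzMap.seminorm ℂ m.1 m.2 ψ))) := by
        gcongr; exact seminorm_compSubConst_le m.1 m.2 a ψ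
    _ ≤ C * ((1 + ‖a‖) ^ s.sup Prod.fst * (2 ^ m.1 * (SchwartzMap.seminorm ℂ 0 m.2 ψ
          + SchwartzMap.seminorm ℂ m.1 m.2 ψ))) := by gcongr
    _ = (1 + ‖a‖) ^ s.sup Prod.fst * (C * 2 ^ m.1 * (SchwartzMap.seminorm ℂ 0 m.2 ψ
          + SchwartzMap.seminorm ℂ m.1 m.2 ψ)) := by ring
    _ = _ := by simp [schwartzSeminormFamily]

/-- Mean value inequality along the segment from `x - b` to `x - a`. Its points are `x - c` with
`|c| ≤ |a| + |b|`, so the derivative of order `n + 1` is controlled by the polynomial bound for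
translation by `c`. -/
theorem seminorm_compSubConst_sub_le (k n : ℕ) :
    ∃ (K : ℕ) (q' : Seminorm ℂ 𝓢(V, ℂ)), Continuous q' ∧ ∀ (a b : V) (ψ : 𝓢(V, ℂ)),
      SchwartzMap.seminorm ℂ k n (compSubConstCLM ℂ a ψ - compSubConstCLM ℂ b ψ)
        ≤ (1 + (‖a‖ + ‖b‖)) ^ K * q' ψ * ‖a - b‖ := by
  obtain ⟨K, q', hq', h⟩ := exists_seminorm_compSubConst_le
    (schwartzSeminormFamily ℂ V ℂ (k, n + 1)) ((schwartz_withSeminorms ℂ V ℂ).continuous_seminorm _)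
  refine ⟨K, q', hq', fun a b ψ => ?_⟩
  refine SchwartzMap.seminorm_le_bound ℂ k n _ (by positivity) fun x => ?_
  have e : iteratedFDeriv ℝ n (compSubConstCLM ℂ a ψ - compSubConstCLM ℂ b ψ : 𝓢(V, ℂ)) x
      = iteratedFDeriv ℝ n ψ (x - a) - iteratedFDeriv ℝ n ψ (x - b) := by
    rw [← iteratedFDeriv_compSubConst, ← iteratedFDeriv_compSubConst]
    exact iteratedFDeriv_sub_apply (SchwartzMap.smooth _ _).contDiffAt
      (SchwartzMap.smooth _ _).contDiffAt
  rw [e]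
  -- The weight `‖x‖ ^ k` is constant along the segment and is divided out of the derivative bound,
  -- hence must be positive.
  rcases (pow_nonneg (norm_nonneg x) k).eq_or_lt with h0 | hpos
  · rw [← h0, zero_mul]; positivity
  have hd : Differentiable ℝ (iteratedFDeriv ℝ n ψ) :=
    (ψ.smooth ⊤).differentiable_iteratedFDeriv (mod_cast WithTop.coe_lt_top _)
  have hbound : ∀ y ∈ segment ℝ (x - b) (x - a), ‖fderiv ℝ (iteratedFDeriv ℝ n ψ) y‖
      ≤ (1 + (‖a‖ + ‖b‖)) ^ K * q' ψ / ‖x‖ ^ k := by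
    intro y hy
    rw [norm_fderiv_iteratedFDeriv, le_div_iff₀' hpos]
    obtain ⟨t, ht, rfl⟩ := (segment_eq_image ℝ (x - b) (x - a)) ▸ hy
    set c := (1 - t) • b + t • a with hc
    have hy : (1 - t) • (x - b) + t • (x - a) = x - c := by rw [hc]; module
    have hcn : ‖c‖ ≤ ‖a‖ + ‖b‖ := by
      refine (norm_add_le _ _).trans ?_
      rw [norm_smul, norm_smul, Real.norm_of_nonneg ht.1, Real.norm_of_nonneg (by linarith [ht.2])]
      nlinarith [ht.1, ht.2, norm_nonneg a, norm_nonneg b]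
    change ‖x‖ ^ k * ‖iteratedFDeriv ℝ (n + 1) ψ ((1 - t) • (x - b) + t • (x - a))‖ ≤ _
    rw [hy, ← iteratedFDeriv_compSubConst]
    refine (SchwartzMap.le_seminorm ℂ k (n + 1) (compSubConstCLM ℂ c ψ) x).trans
      ((h c ψ).trans ?_)
    gcongr
  have hmv := (convex_segment (x - b) (x - a)).norm_image_sub_le_of_norm_fderiv_le
    (fun y _ => hd y) hbound (left_mem_segment ℝ _ _) (right_mem_segment ℝ _ _)
  have hab : x - a - (x - b) = b - a := by abel
  rw [hab, norm_sub_rev b a] at hmv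
  calc ‖x‖ ^ k * ‖iteratedFDeriv ℝ n ψ (x - a) - iteratedFDeriv ℝ n ψ (x - b)‖
      ≤ ‖x‖ ^ k * ((1 + (‖a‖ + ‖b‖)) ^ K * q' ψ / ‖x‖ ^ k * ‖a - b‖) := by gcongr
    _ = _ := by field_simp

/-- Writing `T_a` for translation, `T_a ψ - T_{a₀} ψ₀ = T_a(ψ - ψ₀) + (T_a ψ₀ - T_{a₀} ψ₀)`: the
first term is small by the locally uniform bound, the second by the Lipschitz estimate. -/
theorem continuous_compSubConst :
    Continuous fun z : V × 𝓢(V, ℂ) => compSubConstCLM ℂ z.1 z.2 := by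
  rw [continuous_iff_continuousAt]
  rintro ⟨a₀, ψ₀⟩
  refine ((schwartz_withSeminorms ℂ V ℂ).tendsto_nhds _ _).2 fun m ε hε => ?_
  obtain ⟨K, q', hq', h⟩ := exists_seminorm_compSubConst_le (schwartzSeminormFamily ℂ V ℂ m)
    ((schwartz_withSeminorms ℂ V ℂ).continuous_seminorm _)
  obtain ⟨K₂, q₂, hq₂, h₂⟩ := seminorm_compSubConst_sub_le (V := V) m.1 m.2
  have hlim : Filter.Tendsto (fun z : V × 𝓢(V, ℂ) => (1 + ‖z.1‖) ^ K * q' (z.2 - ψ₀)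
      + (1 + (‖z.1‖ + ‖a₀‖)) ^ K₂ * q₂ ψ₀ * ‖z.1 - a₀‖) (𝓝 (a₀, ψ₀)) (𝓝 0) := by
    have hc : Continuous (fun z : V × 𝓢(V, ℂ) => (1 + ‖z.1‖) ^ K * q' (z.2 - ψ₀)
      + (1 + (‖z.1‖ + ‖a₀‖)) ^ K₂ * q₂ ψ₀ * ‖z.1 - a₀‖) := by fun_prop
    simpa using hc.tendsto (a₀, ψ₀)
  filter_upwards [hlim.eventually_lt_const hε] with z hz
  refine lt_of_le_of_lt ?_ hz
  have e : compSubConstCLM ℂ z.1 z.2 - compSubConstCLM ℂ a₀ ψ₀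
      = compSubConstCLM ℂ z.1 (z.2 - ψ₀)
        + (compSubConstCLM ℂ z.1 ψ₀ - compSubConstCLM ℂ a₀ ψ₀) := by
    rw [map_sub]; abel
  rw [e]
  refine (map_add_le_add _ _ _).trans (add_le_add (h _ _) (h₂ _ _ _))

end Translation

/-! ### Characters, and modulations as conjugated translations. -/

section TimeFrequency

variable {ι : Type} [Fintype ι]

theorem norm_character (b t : EuclideanSpace ℝ ι) : ‖character b t‖ = 1 := by
  rw [character, Complex.norm_exp]
  simp

theorem character_add_left (a b t : EuclideanSpace ℝ ι) :
    character (a + b) t = character a t * character b t := by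
  rw [character, character, character, ← Complex.exp_add, inner_add_left]
  push_cast; ring_nf

theorem character_add_right (a t u : EuclideanSpace ℝ ι) :
    character a (t + u) = character a t * character a u := by
  rw [character, character, character, ← Complex.exp_add, inner_add_right]
  push_cast; ring_nf

theorem character_neg_left (a t : EuclideanSpace ℝ ι) : character (-a) t = character a (-t) := by
  simp [character]

theorem character_zero_left (t : EuclideanSpace ℝ ι) : character 0 t = 1 := by
  simp [character]

theorem character_zero_right (t : EuclideanSpace ℝ ι) : character t 0 = 1 := by
  simp [character]

theorem conj_character (a t : EuclideanSpace ℝ ι) :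
    (starRingEnd ℂ) (character a t) = character (-a) t := by
  rw [character, character, ← Complex.exp_conj]
  simp [map_ofNat]

theorem continuous_character :
    Continuous fun z : EuclideanSpace ℝ ι × EuclideanSpace ℝ ι => character z.1 z.2 := by
  unfold character; fun_prop

theorem smulLeft_character_apply (b : EuclideanSpace ℝ ι) (ψ : 𝓢(EuclideanSpace ℝ ι, ℂ))
    (t : EuclideanSpace ℝ ι) :
    SchwartzMap.smulLeftCLM ℂ (character b) ψ t = character b t * ψ t := by
  simp [SchwartzMap.smulLeftCLM_apply_apply (character_hasTemperateGrowth _)]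

/-- The Fourier transform turns modulation into translation, so continuity and polynomial bounds for
modulations follow from those for translations without differentiating characters. -/
theorem smulLeft_character_eq (b : EuclideanSpace ℝ ι) (ψ : 𝓢(EuclideanSpace ℝ ι, ℂ)) :
    SchwartzMap.smulLeftCLM ℂ (character b) ψ
      = (FourierTransform.fourierCLE ℂ 𝓢(EuclideanSpace ℝ ι, ℂ)).symm (compSubConstCLM ℂ b
        (FourierTransform.fourierCLE ℂ 𝓢(EuclideanSpace ℝ ι, ℂ) ψ)) := by
  rw [ContinuousLinearEquiv.eq_symm_apply]
  ext ξ
  simp only [FourierTransform.fourierCLE_apply, compSubConstCLM_apply, fourier_coe]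
  rw [Real.fourier_eq, Real.fourier_eq]
  refine integral_congr_ae (Filter.Eventually.of_forall fun t => ?_)
  simp only [smulLeft_character_apply, character, Circle.smul_def, Real.fourierChar_apply,
    smul_eq_mul]
  rw [← mul_assoc, ← Complex.exp_add, inner_sub_right, real_inner_comm]
  congr 2
  push_cast
  rw [real_inner_comm b t]
  ring

theorem timeFreqShift_eq (z : EuclideanSpace ℝ (ι ⊕ ι)) (ψ : 𝓢(EuclideanSpace ℝ ι, ℂ)) :
    timeFreqShift z ψ = (FourierTransform.fourierCLE ℂ 𝓢(EuclideanSpace ℝ ι, ℂ)).symm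
      (compSubConstCLM ℂ (sndPart z) (FourierTransform.fourierCLE ℂ 𝓢(EuclideanSpace ℝ ι, ℂ)
        (compSubConstCLM ℂ (fstPart z) ψ))) :=
  smulLeft_character_eq (sndPart z) _

end TimeFrequency

/-! ### Time-frequency shifts on the Schwartz space; continuity and growth of the short-time Fourier
transform. -/

section TimeFrequencyShift

variable {d : ℕ}

theorem norm_fstPart_le (z : EuclideanSpace ℝ (Fin d ⊕ Fin d)) : ‖fstPart z‖ ≤ ‖z‖ := by
  conv_rhs => rw [← pair_fstPart_sndPart z]
  exact norm_left_le_pair _ _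

theorem norm_sndPart_le (z : EuclideanSpace ℝ (Fin d ⊕ Fin d)) : ‖sndPart z‖ ≤ ‖z‖ := by
  conv_rhs => rw [← pair_fstPart_sndPart z]
  exact norm_right_le_pair _ _

theorem continuous_timeFreqShift :
    Continuous fun z : EuclideanSpace ℝ (Fin d ⊕ Fin d) × 𝓢(EuclideanSpace ℝ (Fin d), ℂ) =>
      timeFreqShift z.1 z.2 := by
  simp_rw [timeFreqShift_eq]
  refine (ContinuousLinearEquiv.continuous _).comp (continuous_compSubConst.comp
    ((continuous_sndPart.comp continuous_fst).prodMk ((ContinuousLinearEquiv.continuous _).comp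
      (continuous_compSubConst.comp ((continuous_fstPart.comp continuous_fst).prodMk
        continuous_snd)))))

theorem exists_seminorm_timeFreqShift_le (q : Seminorm ℂ 𝓢(EuclideanSpace ℝ (Fin d), ℂ))
    (hq : Continuous q) :
    ∃ (K : ℕ) (q' : Seminorm ℂ 𝓢(EuclideanSpace ℝ (Fin d), ℂ)), Continuous q' ∧
      ∀ (z : EuclideanSpace ℝ (Fin d ⊕ Fin d)) (ψ : 𝓢(EuclideanSpace ℝ (Fin d), ℂ)),
        q (timeFreqShift z ψ) ≤ (1 + ‖z‖) ^ K * q' ψ := by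
  set F := FourierTransform.fourierCLE ℂ 𝓢(EuclideanSpace ℝ (Fin d), ℂ) with hF
  obtain ⟨K₁, q₁, hq₁, h₁⟩ := exists_seminorm_compSubConst_le
    (q.comp F.symm.toLinearEquiv.toLinearMap) (hq.comp F.symm.continuous)
  obtain ⟨K₂, q₂, hq₂, h₂⟩ := exists_seminorm_compSubConst_le
    (q₁.comp F.toLinearEquiv.toLinearMap) (hq₁.comp F.continuous)
  refine ⟨K₁ + K₂, q₂, hq₂, fun z ψ => ?_⟩
  rw [timeFreqShift_eq]
  calc q (F.symm (compSubConstCLM ℂ (sndPart z) (F (compSubConstCLM ℂ (fstPart z) ψ))))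
      ≤ (1 + ‖sndPart z‖) ^ K₁ * q₁ (F (compSubConstCLM ℂ (fstPart z) ψ)) := h₁ _ _
    _ ≤ (1 + ‖sndPart z‖) ^ K₁ * ((1 + ‖fstPart z‖) ^ K₂ * q₂ ψ) := by
        gcongr; exact h₂ _ _
    _ ≤ (1 + ‖z‖) ^ K₁ * ((1 + ‖z‖) ^ K₂ * q₂ ψ) := by
        gcongr
        · exact norm_sndPart_le z
        · exact norm_fstPart_le z
    _ = _ := by ring

theorem seminorm_conjSchwartz {V : Type} [NormedAddCommGroup V] [NormedSpace ℝ V] (k n : ℕ)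
    (φ : 𝓢(V, ℂ)) :
    SchwartzMap.seminorm ℝ k n (conjSchwartz φ) ≤ SchwartzMap.seminorm ℝ k n φ := by
  refine SchwartzMap.seminorm_le_bound ℝ k n _ (apply_nonneg _ _) fun x => ?_
  have h : ‖iteratedFDeriv ℝ n (conjSchwartz φ) x‖ = ‖iteratedFDeriv ℝ n φ x‖ :=
    Complex.conjLIE.norm_iteratedFDeriv_comp_left φ x n
  rw [h]
  exact SchwartzMap.le_seminorm ℝ k n φ x

theorem conjSchwartz_conjSchwartz {V : Type} [NormedAddCommGroup V] [NormedSpace ℝ V]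
    (φ : 𝓢(V, ℂ)) : conjSchwartz (conjSchwartz φ) = φ := by
  ext x; simp [conjSchwartz_apply]

theorem continuous_apply_conjSchwartz (f : 𝓢'(EuclideanSpace ℝ (Fin d), ℂ)) :
    Continuous fun φ : 𝓢(EuclideanSpace ℝ (Fin d), ℂ) => f (conjSchwartz φ) :=
  (map_continuous f).comp conjSchwartz.continuous

theorem continuous_stft (φ : 𝓢(EuclideanSpace ℝ (Fin d), ℂ))
    (f : 𝓢'(EuclideanSpace ℝ (Fin d), ℂ)) : Continuous (stft φ f) := by
  have h : Continuous fun z : EuclideanSpace ℝ (Fin d ⊕ Fin d) => timeFreqShift z φ :=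
    Continuous.comp (g := fun z : EuclideanSpace ℝ (Fin d ⊕ Fin d) ×
        𝓢(EuclideanSpace ℝ (Fin d), ℂ) => timeFreqShift z.1 z.2)
      (f := fun z => (z, φ)) continuous_timeFreqShift (Continuous.prodMk_left φ)
  change Continuous fun z => f (conjSchwartz (timeFreqShift z φ))
  exact (continuous_apply_conjSchwartz f).comp h

theorem exists_norm_stft_le (φ : 𝓢(EuclideanSpace ℝ (Fin d), ℂ))
    (f : 𝓢'(EuclideanSpace ℝ (Fin d), ℂ)) :
    ∃ (K : ℕ) (C : ℝ), 0 ≤ C ∧ ∀ z, ‖stft φ f z‖ ≤ C * (1 + ‖z‖) ^ K := by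
  -- `V_φ f(z)` is antilinear in `φ`; the conjugate distribution has the same modulus and yields a
  -- complex seminorm.
  obtain ⟨K, q, -, h⟩ := exists_seminorm_timeFreqShift_le
    ((normSeminorm ℂ ℂ).comp
      (conjDistribution f : 𝓢(EuclideanSpace ℝ (Fin d), ℂ) →ₗ[ℂ] ℂ))
    (continuous_norm.comp (map_continuous (conjDistribution f)))
  refine ⟨K, q φ, apply_nonneg _ _, fun z => ?_⟩
  have h1 := h z φ
  change ‖conjDistribution f (timeFreqShift z φ)‖ ≤ _ at h1
  rw [conjDistribution_apply, RCLike.norm_conj] at h1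
  rw [mul_comm]
  exact h1

theorem exists_enorm_stft_le (φ : 𝓢(EuclideanSpace ℝ (Fin d), ℂ))
    (f : 𝓢'(EuclideanSpace ℝ (Fin d), ℂ)) :
    ∃ (K : ℝ) (A : ℝ≥0∞), 0 ≤ K ∧ A ≠ ⊤ ∧ ∀ z, ‖stft φ f z‖ₑ ≤ A * bracket z ^ K := by
  obtain ⟨K, C, hC, h⟩ := exists_norm_stft_le φ f
  refine ⟨K, ENNReal.ofReal C, K.cast_nonneg, ENNReal.ofReal_ne_top, fun z => ?_⟩
  rw [← ofReal_norm, bracket, ENNReal.rpow_natCast, ← ENNReal.ofReal_pow (by positivity),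
    ← ENNReal.ofReal_mul hC]
  exact ENNReal.ofReal_le_ofReal (h z)

theorem timeFreqShift_timeFreqShift (u w : EuclideanSpace ℝ (Fin d ⊕ Fin d))
    (ψ : 𝓢(EuclideanSpace ℝ (Fin d), ℂ)) :
    timeFreqShift u (timeFreqShift w ψ)
      = character (sndPart w) (-fstPart u) • timeFreqShift (u + w) ψ := by
  ext t
  have h1 : sndPart (u + w) = sndPart u + sndPart w := rfl
  have h2 : fstPart (u + w) = fstPart u + fstPart w := rfl
  simp only [smul_apply, timeFreqShift_apply, h1, h2, smul_eq_mul, sub_eq_add_neg,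
    character_add_left, character_add_right, neg_add]
  rw [add_assoc]
  ring

theorem norm_stft_timeFreqShift (f : 𝓢'(EuclideanSpace ℝ (Fin d), ℂ))
    (ψ : 𝓢(EuclideanSpace ℝ (Fin d), ℂ)) (u w : EuclideanSpace ℝ (Fin d ⊕ Fin d)) :
    ‖stft (timeFreqShift w ψ) f u‖ = ‖stft ψ f (u + w)‖ := by
  simp only [stft, timeFreqShift_timeFreqShift, conjSchwartz_smul, map_smul, norm_smul,
    RCLike.norm_conj, norm_character, one_mul]

end TimeFrequencyShift

/-! ### The form of `L`, and invertibility of the diagonal blocks. -/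

section PartialFourier

/-- If `|G|` had a period `v ≠ 0`, a non-zero value would recur at the points `z₀ - nv`, against the
decay of `G`. This lets translation vectors be read off from moduli. -/
theorem eq_zero_of_norm_sub_eq {V : Type} [NormedAddCommGroup V] [NormedSpace ℝ V]
    {G : 𝓢(V, ℂ)} (hG : G ≠ 0) {v : V} (h : ∀ z, ‖G (z - v)‖ = ‖G z‖) : v = 0 := by
  obtain ⟨z₀, hz₀⟩ : ∃ z, G z ≠ 0 := by
    by_contra! h0
    exact hG (by ext z; simpa using h0 z)
  by_contra hv
  have h1 : ∀ n : ℕ, ‖G (z₀ - (n : ℝ) • v)‖ = ‖G z₀‖ := by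
    intro n
    induction n with
    | zero => simp
    | succ n ih =>
      rw [← ih, ← h (z₀ - (n : ℝ) • v)]
      congr 2
      push_cast
      module
  set C := SchwartzMap.seminorm ℝ 1 0 G
  have h2 : ∀ n : ℕ, ((n : ℝ) * ‖v‖ - ‖z₀‖) * ‖G z₀‖ ≤ C := by
    intro n
    have h3 := SchwartzMap.norm_pow_mul_le_seminorm ℝ G 1 (z₀ - (n : ℝ) • v)
    rw [h1, pow_one] at h3
    refine le_trans ?_ h3
    gcongr
    have h4 := norm_sub_norm_le ((n : ℝ) • v) z₀
    rw [norm_smul, Real.norm_natCast, norm_sub_rev] at h4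
    exact h4
  have hv' : 0 < ‖v‖ := norm_pos_iff.2 hv
  have hz' : 0 < ‖G z₀‖ := norm_pos_iff.2 hz₀
  obtain ⟨n, hn⟩ := exists_nat_gt ((C / ‖G z₀‖ + ‖z₀‖) / ‖v‖)
  have h5 := h2 n
  rw [div_lt_iff₀ hv'] at hn
  have h6 : C / ‖G z₀‖ < (n : ℝ) * ‖v‖ - ‖z₀‖ := by linarith
  rw [div_lt_iff₀ hz'] at h6
  linarith

theorem eq_zero_of_character_eq_one {ι : Type} [Fintype ι] {b : EuclideanSpace ℝ ι}
    (h : ∀ t, character b t = 1) : b = 0 := by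
  by_contra hb
  have hb' : ‖b‖ ^ 2 ≠ 0 := by positivity
  -- At this point the character equals `exp(πi) = -1`.
  have h1 := h ((1 / (2 * ‖b‖ ^ 2)) • b)
  have h2 : 2 * Real.pi * Complex.I * (inner ℝ b ((1 / (2 * ‖b‖ ^ 2)) • b) : ℝ)
      = Real.pi * Complex.I := by
    rw [inner_smul_right, real_inner_self_eq_norm_sq]
    have : 1 / (2 * ‖b‖ ^ 2) * ‖b‖ ^ 2 = 1 / 2 := by field_simp
    rw [this]
    push_cast
    ring
  rw [character, h2, Complex.exp_pi_mul_I] at h1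
  norm_num at h1

theorem exists_schwartz_ne_zero {V : Type} [NormedAddCommGroup V] [InnerProductSpace ℝ V]
    [FiniteDimensional ℝ V] (a : V) : ∃ Ψ : 𝓢(V, ℂ), Ψ a ≠ 0 := by
  let b : ContDiffBump a := ⟨1, 2, one_pos, one_lt_two⟩
  have h1 : HasCompactSupport fun x => ((b x : ℝ) : ℂ) :=
    b.hasCompactSupport.comp_left (g := fun r : ℝ => (r : ℂ)) (by simp)
  have h2 : ContDiff ℝ ∞ fun x => ((b x : ℝ) : ℂ) := Complex.ofRealCLM.contDiff.comp b.contDiff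
  refine ⟨h1.toSchwartzMap h2, ?_⟩
  change ((b a : ℝ) : ℂ) ≠ 0
  rw [b.one_of_mem_closedBall (by simp [b])]
  simp

variable {d : ℕ}

theorem character_pair (a b x y : EuclideanSpace ℝ (Fin d)) :
    character (pair a b) (pair x y) = character a x * character b y := by
  unfold character
  rw [← Complex.exp_add]
  congr 1
  have : inner ℝ (pair a b) (pair x y) = inner ℝ a x + inner ℝ b y := by
    simp [pair, PiLp.inner_apply]
  rw [this]
  push_cast
  ring

theorem inner_toEuclideanLin_transpose {ι : Type} [Fintype ι] [DecidableEq ι]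
    (L : Matrix ι ι ℝ) (x y : EuclideanSpace ℝ ι) :
    inner ℝ x (Matrix.toEuclideanLin L y) = inner ℝ (Matrix.toEuclideanLin L.transpose x) y := by
  rw [← Matrix.conjTranspose_eq_transpose_of_trivial, Matrix.toEuclideanLin_conjTranspose_eq_adjoint,
    LinearMap.adjoint_inner_left]

theorem character_toEuclideanLin {ι : Type} [Fintype ι] [DecidableEq ι]
    (L : Matrix ι ι ℝ) (x y : EuclideanSpace ℝ ι) :
    character x (Matrix.toEuclideanLin L y) = character (Matrix.toEuclideanLin L.transpose x) y := by
  rw [character, inner_toEuclideanLin_transpose, character]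

/-- The image of a pure modulation under a covariant matrix. -/
theorem toEuclideanLin_covariant (M A₁₃ A₂₁ : Matrix (Fin d) (Fin d) ℝ)
    (η₁ η₂ : EuclideanSpace ℝ (Fin d))
    {ζ : EuclideanSpace ℝ ((Fin d ⊕ Fin d) ⊕ (Fin d ⊕ Fin d))}
    (h₁ : fstPart ζ = 0) (h₂ : sndPart ζ = pair η₁ η₂) :
    fstPart (Matrix.toEuclideanLin (Matrix.fromBlocks
       (Matrix.fromBlocks M (1 - M) A₂₁ (-A₂₁))
       (Matrix.fromBlocks A₁₃ A₁₃ (1 - M.transpose) (-M.transpose))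
       (Matrix.fromBlocks 0 0 (-1) 1)
       (Matrix.fromBlocks 1 1 0 0)) ζ)
      = pair (Matrix.toEuclideanLin A₁₃ (η₁ + η₂))
        (η₁ - Matrix.toEuclideanLin M.transpose (η₁ + η₂)) ∧
    sndPart (Matrix.toEuclideanLin (Matrix.fromBlocks
       (Matrix.fromBlocks M (1 - M) A₂₁ (-A₂₁))
       (Matrix.fromBlocks A₁₃ A₁₃ (1 - M.transpose) (-M.transpose))
       (Matrix.fromBlocks 0 0 (-1) 1)
       (Matrix.fromBlocks 1 1 0 0)) ζ)
      = pair (η₁ + η₂) 0 := by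
  have e : ζ = WithLp.toLp 2 (Sum.elim (0 : Fin d ⊕ Fin d → ℝ) (pair η₁ η₂)) := by
    ext i
    rcases i with i | i
    · exact congrArg (fun v : EuclideanSpace ℝ (Fin d ⊕ Fin d) => v i) h₁
    · exact congrArg (fun v : EuclideanSpace ℝ (Fin d ⊕ Fin d) => v i) h₂
  subst e
  constructor <;> ext i <;> rcases i with i | i <;>
    simp [Matrix.toLpLin_apply, pair, fstPart, sndPart, Matrix.fromBlocks_mulVec, Matrix.mulVec_add,
      Matrix.sub_mulVec, Matrix.neg_mulVec, Function.comp_def] <;> ring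

theorem inner_pair (a b x y : EuclideanSpace ℝ (Fin d)) :
    inner ℝ (pair a b) (pair x y) = inner ℝ a x + inner ℝ b y := by
  simp [pair, PiLp.inner_apply]

/-- A covariant metaplectic operator of the form `F₂ T_L` has `L(x, y) = (x + (1 - M)y, x - My)`. -/
theorem exists_eq_partialFourier {M A₁₃ A₂₁ : Matrix (Fin d) (Fin d) ℝ}
    {U : 𝓢(EuclideanSpace ℝ (Fin d ⊕ Fin d), ℂ) ≃L[ℂ] 𝓢(EuclideanSpace ℝ (Fin d ⊕ Fin d), ℂ)}
    (hU : IsMetaplectic (Matrix.fromBlocks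
       (Matrix.fromBlocks M (1 - M) A₂₁ (-A₂₁))
       (Matrix.fromBlocks A₁₃ A₁₃ (1 - M.transpose) (-M.transpose))
       (Matrix.fromBlocks 0 0 (-1) 1)
       (Matrix.fromBlocks 1 1 0 0)) U)
    (hL : IsPartialFourierRescale U) :
    ∃ c₀ : ℂ, c₀ ≠ 0 ∧ ∀ Φ z, U Φ z = c₀ * ∫ y, character (-sndPart z) y *
      Φ (pair (fstPart z + (y - Matrix.toEuclideanLin M y))
        (fstPart z - Matrix.toEuclideanLin M y)) := by
  obtain ⟨L, hLdet, c, hc, hL⟩ := hL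
  refine ⟨c * Real.sqrt |L.det|, ?_, ?_⟩
  · refine mul_ne_zero (norm_ne_zero_iff.1 (by rw [hc]; exact one_ne_zero)) ?_
    rw [Complex.ofReal_ne_zero]
    exact (Real.sqrt_pos.2 (abs_pos.2 hLdet.ne_zero)).ne'
  have hUL : ∀ Φ z, U Φ z = c * Real.sqrt |L.det| * ∫ y, character (-sndPart z) y *
      Φ (Matrix.toEuclideanLin L (pair (fstPart z) y)) := by
    intro Φ z
    rw [hL, partialFourier, ← integral_const_mul, ← integral_const_mul]
    congr 1
    funext y
    rw [rescale]
    ring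
  -- The transpose of `L` is found by testing on the modulation by `η`: composition with `L` changes
  -- it into the modulation by `Lᵀη = (α, β)`, and the partial Fourier transform changes the part
  -- `β` into a translation of the frequency variable.
  have key : ∀ η₁ η₂ : EuclideanSpace ℝ (Fin d),
      Matrix.toEuclideanLin L.transpose (pair η₁ η₂)
        = pair (η₁ + η₂) (η₁ - Matrix.toEuclideanLin M.transpose (η₁ + η₂)) := by
    intro η₁ η₂
    set η := pair η₁ η₂ with hη
    set α := fstPart (Matrix.toEuclideanLin L.transpose η) with hα
    set β := sndPart (Matrix.toEuclideanLin L.transpose η) with hβ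
    have hαβ : Matrix.toEuclideanLin L.transpose η = pair α β := (pair_fstPart_sndPart _).symm
    set ζ : EuclideanSpace ℝ ((Fin d ⊕ Fin d) ⊕ (Fin d ⊕ Fin d)) :=
      WithLp.toLp 2 (Sum.elim 0 η) with hζ
    have hζ₁ : fstPart ζ = 0 := rfl
    have hζ₂ : sndPart ζ = η := rfl
    obtain ⟨b, hb, hUb⟩ := hU.2 ζ
    obtain ⟨e₁, e₂⟩ := toEuclideanLin_covariant M A₁₃ A₂₁ η₁ η₂ hζ₁ hζ₂
    set p := pair (Matrix.toEuclideanLin A₁₃ (η₁ + η₂))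
        (η₁ - Matrix.toEuclideanLin M.transpose (η₁ + η₂)) with hp
    -- The two descriptions of the same operator, from `F₂ T_L` on the left and from the covariant
    -- matrix on the right. Since `U` is onto, `Ψ` is arbitrary.
    have H : ∀ (Ψ : 𝓢(EuclideanSpace ℝ (Fin d ⊕ Fin d), ℂ)) z,
        character α (fstPart z) * Ψ (z - pair 0 β)
          = b * (character (η₁ + η₂) (fstPart z) * Ψ (z - p)) := by
      intro Ψ z
      have h1 := congrArg (fun F : 𝓢(EuclideanSpace ℝ (Fin d ⊕ Fin d), ℂ) => F z)
        (hUb (U.symm Ψ))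
      simp only [smul_apply, timeFreqShift_apply, e₁, e₂, smul_eq_mul,
        ContinuousLinearEquiv.apply_symm_apply] at h1
      have h2 : character (pair (η₁ + η₂) 0) z = character (η₁ + η₂) (fstPart z) := by
        conv_lhs => rw [← pair_fstPart_sndPart z]
        rw [character_pair, character_zero_left, mul_one]
      rw [h2] at h1
      rw [← h1, hUL]
      conv_lhs => rw [← U.apply_symm_apply Ψ, hUL]
      have h3 : fstPart (z - pair 0 β) = fstPart z := by rw [fstPart_sub, fstPart_pair, sub_zero]
      have h4 : sndPart (z - pair 0 β) = sndPart z - β := by rw [sndPart_sub, sndPart_pair]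
      rw [h3, h4, mul_left_comm, ← integral_const_mul]
      congr 2
      funext y
      rw [timeFreqShift_apply, hζ₁, hζ₂, sub_zero, character_toEuclideanLin, hαβ, character_pair,
        neg_sub, sub_eq_add_neg, character_add_left]
      ring
    obtain ⟨Ψ₀, hΨ₀⟩ := exists_schwartz_ne_zero (0 : EuclideanSpace ℝ (Fin d ⊕ Fin d))
    -- Taking moduli removes all phases, so the two translation vectors coincide; the second block
    -- gives `β`.
    have h5 : p - pair 0 β = 0 := by
      refine eq_zero_of_norm_sub_eq (G := Ψ₀) (fun h => hΨ₀ (by rw [h]; rfl)) fun z => ?_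
      have h6 := congrArg norm (H Ψ₀ (z + pair 0 β))
      simp only [norm_mul, norm_character, hb, one_mul, add_sub_cancel_right] at h6
      rw [h6]
      congr 2
      abel
    have hβp : β = η₁ - Matrix.toEuclideanLin M.transpose (η₁ + η₂) := by
      have h6 := congrArg sndPart (sub_eq_zero.1 h5)
      rw [hp, sndPart_pair, sndPart_pair] at h6
      exact h6.symm
    -- With equal translations only the characters are left; `x = 0` gives `b = 1`, and then the
    -- frequencies agree.
    have h7 : ∀ x, character α x = b * character (η₁ + η₂) x := by
      intro x
      obtain ⟨Ψ, hΨ⟩ := exists_schwartz_ne_zero (pair x 0 - p)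
      have h8 := H Ψ (pair x 0)
      rw [← sub_eq_zero.1 h5, ← mul_assoc, fstPart_pair] at h8
      exact mul_right_cancel₀ hΨ h8
    have hb1 : b = 1 := by
      have := h7 0
      rwa [character_zero_right, character_zero_right, mul_one, eq_comm] at this
    have hα' : α = η₁ + η₂ := by
      rw [← sub_eq_zero]
      refine eq_zero_of_character_eq_one fun t => ?_
      rw [sub_eq_add_neg, character_add_left, h7 t, hb1, one_mul, ← character_add_left,
        add_neg_cancel, character_zero_left]
    rw [hαβ, hα', hβp]
  have hLz : ∀ x y : EuclideanSpace ℝ (Fin d), Matrix.toEuclideanLin L (pair x y)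
      = pair (x + (y - Matrix.toEuclideanLin M y)) (x - Matrix.toEuclideanLin M y) := by
    intro x y
    refine ext_inner_left ℝ fun η => ?_
    rw [inner_toEuclideanLin_transpose, ← pair_fstPart_sndPart η, key, inner_pair, inner_pair,
      inner_sub_left, ← inner_toEuclideanLin_transpose]
    simp only [inner_add_left, inner_add_right, inner_sub_right]
    ring
  intro Φ z
  rw [hUL]
  simp only [hLz]

/-- Shifting `y` by `w₁` in the integral collects the shift of `f` into a translation of the phase
point and a unimodular constant. The vector found here is what the shift matrix `E` must produce. -/
theorem norm_wignerSchwartz_timeFreqShift {M : Matrix (Fin d) (Fin d) ℝ}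
    {U : 𝓢(EuclideanSpace ℝ (Fin d ⊕ Fin d), ℂ) ≃L[ℂ] 𝓢(EuclideanSpace ℝ (Fin d ⊕ Fin d), ℂ)}
    {c₀ : ℂ} (hU : ∀ Φ z, U Φ z = c₀ * ∫ y, character (-sndPart z) y *
      Φ (pair (fstPart z + (y - Matrix.toEuclideanLin M y))
        (fstPart z - Matrix.toEuclideanLin M y)))
    (f g : 𝓢(EuclideanSpace ℝ (Fin d), ℂ)) (w z : EuclideanSpace ℝ (Fin d ⊕ Fin d)) :
    ‖wignerSchwartz U (timeFreqShift w f) g z‖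
      = ‖wignerSchwartz U f g (z - pair (Matrix.toEuclideanLin M (fstPart w))
          (sndPart w - Matrix.toEuclideanLin M.transpose (sndPart w)))‖ := by
  simp only [wignerSchwartz, hU, norm_mul]
  congr 1
  rw [← integral_add_right_eq_self _ (fstPart w)]
  set b : ℂ := character (-sndPart z) (fstPart w) * character (sndPart w)
    (fstPart z + (fstPart w - Matrix.toEuclideanLin M (fstPart w))) with hb
  have hb1 : ‖b‖ = 1 := by rw [hb, norm_mul, norm_character, norm_character, one_mul]
  have key : ∀ G H : EuclideanSpace ℝ (Fin d) → ℂ, (∀ y, G y = b * H y) →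
      ‖∫ y, G y‖ = ‖∫ y, H y‖ := by
    intro G H h
    rw [show G = fun y => b * H y from funext h, integral_const_mul, norm_mul, hb1, one_mul]
  apply key
  intro y
  simp only [tensorSchwartz_apply, fstPart_pair, sndPart_pair, timeFreqShift_apply, fstPart_sub,
    sndPart_sub, map_add]
  have e1 : fstPart z + (y + fstPart w - (Matrix.toEuclideanLin M y
      + Matrix.toEuclideanLin M (fstPart w))) - fstPart w
      = fstPart z - Matrix.toEuclideanLin M (fstPart w) + (y - Matrix.toEuclideanLin M y) := by
    abel
  have e2 : fstPart z - (Matrix.toEuclideanLin M y + Matrix.toEuclideanLin M (fstPart w))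
      = fstPart z - Matrix.toEuclideanLin M (fstPart w) - Matrix.toEuclideanLin M y := by
    abel
  have e3 : fstPart z + (y + fstPart w - (Matrix.toEuclideanLin M y
      + Matrix.toEuclideanLin M (fstPart w)))
      = (fstPart z + (fstPart w - Matrix.toEuclideanLin M (fstPart w)))
        + (y + Matrix.toEuclideanLin M (-y)) := by
    rw [map_neg]; abel
  have e4 : -(sndPart z - (sndPart w - Matrix.toEuclideanLin M.transpose (sndPart w)))
      = -sndPart z + (sndPart w + -Matrix.toEuclideanLin M.transpose (sndPart w)) := by abel
  rw [e1, e2, e3, e4, hb]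
  simp only [character_add_left, character_add_right, character_toEuclideanLin,
    character_neg_left (Matrix.toEuclideanLin M.transpose (sndPart w))]
  ring

theorem injective_of_isUnit_det {ι : Type} [Fintype ι] [DecidableEq ι] {T : Matrix ι ι ℝ}
    (hT : IsUnit T.det) : Function.Injective (Matrix.toEuclideanLin T) := by
  intro x y h
  have h1 : ∀ v, Matrix.toEuclideanLin T⁻¹ (Matrix.toEuclideanLin T v) = v := by
    intro v
    rw [← LinearMap.comp_apply, ← Matrix.toLpLin_mul_same, Matrix.nonsing_inv_mul _ hT,
      Matrix.toLpLin_one, LinearMap.id_apply]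
  rw [← h1 x, h, h1]

theorem isUnit_det_of_injective {ι : Type} [Fintype ι] [DecidableEq ι] {T : Matrix ι ι ℝ}
    (hT : ∀ x, Matrix.toEuclideanLin T x = 0 → x = 0) : IsUnit T.det := by
  rw [← Matrix.isUnit_iff_isUnit_det, ← Matrix.mulVec_injective_iff_isUnit]
  intro x y h
  have h1 : WithLp.toLp 2 (x - y) = (0 : EuclideanSpace ℝ ι) := by
    refine hT _ ?_
    rw [Matrix.toLpLin_apply]
    simp only [Matrix.mulVec_sub]
    rw [h, sub_self]
    rfl
  have h2 := congrArg WithLp.ofLp h1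
  exact sub_eq_zero.1 h2

theorem tensorSchwartz_ne_zero {f g : 𝓢(EuclideanSpace ℝ (Fin d), ℂ)} (hf : f ≠ 0) (hg : g ≠ 0) :
    tensorSchwartz f g ≠ 0 := by
  obtain ⟨x, hx⟩ := DFunLike.ne_iff.1 hf
  obtain ⟨y, hy⟩ := DFunLike.ne_iff.1 hg
  refine DFunLike.ne_iff.2 ⟨pair x y, ?_⟩
  rw [tensorSchwartz_apply, fstPart_pair, sndPart_pair]
  exact mul_ne_zero hx hy

theorem conjSchwartz_ne_zero {V : Type} [NormedAddCommGroup V] [NormedSpace ℝ V] {f : 𝓢(V, ℂ)}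
    (hf : f ≠ 0) : conjSchwartz f ≠ 0 := by
  intro h
  apply hf
  rw [← conjSchwartz_conjSchwartz f, h, map_zero]

/-- Shift-invertibility forces the diagonal blocks to be invertible. -/
theorem isUnit_det_of_isShiftInvertible {M : Matrix (Fin d) (Fin d) ℝ}
    {U : 𝓢(EuclideanSpace ℝ (Fin d ⊕ Fin d), ℂ) ≃L[ℂ] 𝓢(EuclideanSpace ℝ (Fin d ⊕ Fin d), ℂ)}
    {c₀ : ℂ} (hU : ∀ Φ z, U Φ z = c₀ * ∫ y, character (-sndPart z) y *
      Φ (pair (fstPart z + (y - Matrix.toEuclideanLin M y))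
        (fstPart z - Matrix.toEuclideanLin M y)))
    (hinv : IsShiftInvertible U) : IsUnit M.det ∧ IsUnit (1 - M).det := by
  obtain ⟨E, hE, hinv⟩ := hinv
  obtain ⟨φ, hφ⟩ := exists_schwartz_ne_zero (0 : EuclideanSpace ℝ (Fin d))
  have hφ0 : φ ≠ 0 := fun h => hφ (by rw [h]; rfl)
  have hW : wignerSchwartz U φ φ ≠ 0 := by
    intro h
    exact tensorSchwartz_ne_zero hφ0 (conjSchwartz_ne_zero hφ0) (U.injective (h.trans
      (map_zero U).symm))
  -- The same modulus is translated by `E w` and by the explicit vector; a non-zero Schwartz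
  -- function allows only one such vector. Testing `w = (x, 0)` and `w = (0, x)` then isolates `M`
  -- and `1 - Mᵀ`.
  have hEw : ∀ w, Matrix.toEuclideanLin E w = pair (Matrix.toEuclideanLin M (fstPart w))
          (sndPart w - Matrix.toEuclideanLin M.transpose (sndPart w)) := by
    intro w
    rw [← sub_eq_zero]
    refine eq_zero_of_norm_sub_eq hW fun z => ?_
    have h1 := (hinv φ φ w (z + pair (Matrix.toEuclideanLin M (fstPart w))
          (sndPart w - Matrix.toEuclideanLin M.transpose (sndPart w)))).symm.trans
      (norm_wignerSchwartz_timeFreqShift hU φ φ w _)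
    rw [add_sub_cancel_right] at h1
    rw [← h1]
    congr 2
    abel
  have hpair : pair (0 : EuclideanSpace ℝ (Fin d)) 0 = 0 := by
    ext i; cases i <;> rfl
  have h0 : ∀ w, Matrix.toEuclideanLin E w = 0 → w = 0 := fun w hw =>
    injective_of_isUnit_det hE (hw.trans (map_zero _).symm)
  constructor
  · refine isUnit_det_of_injective fun x hx => ?_
    have h1 : pair x 0 = 0 := h0 _ (by
      rw [hEw, fstPart_pair, sndPart_pair, hx, map_zero, sub_zero, hpair])
    simpa only [fstPart_pair] using (congrArg fstPart h1).trans (rfl : _ = (0 : EuclideanSpace ℝ _))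
  · rw [← Matrix.det_transpose, Matrix.transpose_sub, Matrix.transpose_one]
    refine isUnit_det_of_injective fun x hx => ?_
    rw [map_sub, LinearMap.sub_apply, Matrix.toLpLin_one, LinearMap.id_apply] at hx
    have h1 : pair 0 x = 0 := h0 _ (by
      rw [hEw, fstPart_pair, sndPart_pair, hx, map_zero, hpair])
    simpa only [sndPart_pair] using (congrArg sndPart h1).trans (rfl : _ = (0 : EuclideanSpace ℝ _))

end PartialFourier

/-! ### `W` as a short-time Fourier transform in rescaled coordinates. -/

section Kernel

variable {d : ℕ}

/-- The invertible linear map with a given invertible matrix. -/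
def matrixEquiv (T : Matrix (Fin d) (Fin d) ℝ) (hT : IsUnit T.det) :
    EuclideanSpace ℝ (Fin d) ≃L[ℝ] EuclideanSpace ℝ (Fin d) :=
  (LinearEquiv.ofLinearMap (Matrix.toEuclideanLin T) (Matrix.toEuclideanLin T⁻¹)
    (by rw [← Matrix.toLpLin_mul_same, Matrix.mul_nonsing_inv _ hT, Matrix.toLpLin_one])
    (by rw [← Matrix.toLpLin_mul_same, Matrix.nonsing_inv_mul _ hT, Matrix.toLpLin_one])
    ).toContinuousLinearEquiv

theorem matrixEquiv_apply (T : Matrix (Fin d) (Fin d) ℝ) (hT : IsUnit T.det)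
    (x : EuclideanSpace ℝ (Fin d)) : matrixEquiv T hT x = Matrix.toEuclideanLin T x := rfl

theorem matrixEquiv_symm_apply (T : Matrix (Fin d) (Fin d) ℝ) (hT : IsUnit T.det)
    (x : EuclideanSpace ℝ (Fin d)) :
    (matrixEquiv T hT).symm x = Matrix.toEuclideanLin T⁻¹ x := rfl

theorem exists_integral_comp_equiv {V : Type} [NormedAddCommGroup V] [InnerProductSpace ℝ V]
    [FiniteDimensional ℝ V] [MeasurableSpace V] [BorelSpace V] (e : V ≃L[ℝ] V) :
    ∃ κ : ℝ, 0 < κ ∧ ∀ F : V → ℂ, ∫ x, F (e x) = κ * ∫ x, F x := by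
  have hdet : LinearMap.det ((e : V ≃ₗ[ℝ] V) : V →ₗ[ℝ] V) ≠ 0 :=
    (LinearEquiv.isUnit_det' (e : V ≃ₗ[ℝ] V)).ne_zero
  refine ⟨|(LinearMap.det ((e : V ≃ₗ[ℝ] V) : V →ₗ[ℝ] V))⁻¹|, by positivity, fun F => ?_⟩
  have h1 := Measure.map_linearMap_addHaar_eq_smul_addHaar (volume : Measure V) hdet
  have h2 := e.toHomeomorph.measurableEmbedding.integral_map (μ := volume) F
  have h3 : Measure.map e.toHomeomorph (volume : Measure V)
      = ENNReal.ofReal |(LinearMap.det ((e : V ≃ₗ[ℝ] V) : V →ₗ[ℝ] V))⁻¹| • volume := h1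
  rw [h3, integral_smul_measure, ENNReal.toReal_ofReal (abs_nonneg _)] at h2
  exact h2.symm

/-- The representation of `(h, g) ↦ U(h ⊗ ḡ)` as a short-time Fourier transform in rescaled phase
space coordinates, up to a factor of constant modulus. -/
structure WignerKernel
    (U : 𝓢(EuclideanSpace ℝ (Fin d ⊕ Fin d), ℂ) ≃L[ℂ] 𝓢(EuclideanSpace ℝ (Fin d ⊕ Fin d), ℂ)) where
  /-- The change of the time variable. -/
  timeEquiv : EuclideanSpace ℝ (Fin d) ≃L[ℝ] EuclideanSpace ℝ (Fin d)
  /-- The change of the frequency variable. -/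
  freqEquiv : EuclideanSpace ℝ (Fin d) ≃L[ℝ] EuclideanSpace ℝ (Fin d)
  /-- The change of variables in the window. -/
  windowEquiv : EuclideanSpace ℝ (Fin d) ≃L[ℝ] EuclideanSpace ℝ (Fin d)
  /-- The factor of constant modulus. -/
  factor : EuclideanSpace ℝ (Fin d ⊕ Fin d) → ℂ
  /-- The modulus of the factor. -/
  modulus : ℝ
  continuous_factor : Continuous factor
  modulus_pos : 0 < modulus
  norm_factor : ∀ z, ‖factor z‖ = modulus
  wigner_eq : ∀ (h g : 𝓢(EuclideanSpace ℝ (Fin d), ℂ)) z, wignerSchwartz U h g z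
    = factor z * ∫ t, h t * (starRingEnd ℂ) (timeFreqShift
        (pair (timeEquiv (fstPart z)) (freqEquiv (sndPart z)))
        (compCLMOfContinuousLinearEquiv ℂ windowEquiv g) t)
  isometry : ∀ Φ, ∫ t, ‖U Φ t‖ ^ 2 = ∫ t, ‖Φ t‖ ^ 2

/-- The substitution `t = x + (1 - M)y`, with `z = (x, ξ)`, sends `y` to `(1 - M)⁻¹(t - x)`. Then
`y·ξ` becomes `(1 - M)⁻ᵀξ·(t - x)`, whose constant part goes into the factor, and the argument of
`g` becomes `-(1 - M)⁻¹M(t - M⁻¹x)`. Invertibility of `1 - M` is needed for the substitution, that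
of `M` for the time shift and the window. -/
theorem nonempty_wignerKernel {M : Matrix (Fin d) (Fin d) ℝ}
    {U : 𝓢(EuclideanSpace ℝ (Fin d ⊕ Fin d), ℂ) ≃L[ℂ] 𝓢(EuclideanSpace ℝ (Fin d ⊕ Fin d), ℂ)}
    (hiso : ∀ Φ, ∫ t, ‖U Φ t‖ ^ 2 = ∫ t, ‖Φ t‖ ^ 2)
    {c₀ : ℂ} (hc₀ : c₀ ≠ 0) (hU : ∀ Φ z, U Φ z = c₀ * ∫ y, character (-sndPart z) y *
      Φ (pair (fstPart z + (y - Matrix.toEuclideanLin M y))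
        (fstPart z - Matrix.toEuclideanLin M y)))
    (hM : IsUnit M.det) (hN : IsUnit (1 - M).det) : Nonempty (WignerKernel U) := by
  set m := matrixEquiv M hM with hm
  set n := matrixEquiv (1 - M) hN with hn
  have hm_apply : ∀ x, Matrix.toEuclideanLin M x = m x := fun x => rfl
  have hn_apply : ∀ x, n x = x - m x := by
    intro x
    rw [hn, hm, matrixEquiv_apply, matrixEquiv_apply, map_sub, LinearMap.sub_apply,
      Matrix.toLpLin_one, LinearMap.id_apply]
  set r := matrixEquiv ((1 - M)⁻¹).transpose (by
    rw [Matrix.det_transpose]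
    exact Matrix.isUnit_nonsing_inv_det _ hN) with hr
  have hr_apply : ∀ ξ t, character ξ (n.symm t) = character (r ξ) t := by
    intro ξ t
    rw [hn, matrixEquiv_symm_apply, character_toEuclideanLin, hr, matrixEquiv_apply]
  obtain ⟨κ, hκ, hint⟩ := exists_integral_comp_equiv n
  refine ⟨⟨m.symm, r, (m.trans n.symm).trans (ContinuousLinearEquiv.neg ℝ),
    fun z => c₀ * κ * character (r (sndPart z)) (fstPart z), ‖c₀‖ * κ, ?_, ?_, ?_, ?_, hiso⟩⟩
  · refine continuous_const.mul (continuous_character.comp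
      ((r.continuous.comp continuous_sndPart).prodMk continuous_fstPart))
  · have := norm_pos_iff.2 hc₀
    positivity
  · intro z
    rw [norm_mul, norm_mul, norm_character, mul_one, Complex.norm_real, Real.norm_of_nonneg hκ.le]
  · intro h g z
    have e1 : ∀ t, fstPart z - m (n.symm (t - fstPart z))
        = -n.symm (m (t - m.symm (fstPart z))) := by
      -- Both sides agree after applying `n = 1 - m`, because `m` and `n` commute.
      have key : ∀ w, fstPart z - m w
          = -n.symm (m (n w + fstPart z - m.symm (fstPart z))) := by
        intro w
        apply n.injective
        rw [map_neg, n.apply_symm_apply, hn_apply, hn_apply]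
        simp only [map_sub, map_add, m.apply_symm_apply]
        abel
      intro t
      have h1 := key (n.symm (t - fstPart z))
      rwa [n.apply_symm_apply, sub_add_cancel] at h1
    set G : EuclideanSpace ℝ (Fin d) → ℂ := fun t => character (-sndPart z)
      (n.symm (t - fstPart z)) * (h t * (starRingEnd ℂ) (g (fstPart z
        - m (n.symm (t - fstPart z))))) with hG
    have e2 : ∀ y, character (-sndPart z) y * tensorSchwartz h (conjSchwartz g)
        (pair (fstPart z + (y - Matrix.toEuclideanLin M y))
          (fstPart z - Matrix.toEuclideanLin M y)) = G (n y + fstPart z) := by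
      intro y
      simp only [hG, tensorSchwartz_apply, fstPart_pair, sndPart_pair, conjSchwartz_apply, hm_apply,
        add_sub_cancel_right, n.symm_apply_apply, ← hn_apply]
      rw [add_comm]
    have e3 : ∀ t, G t = character (r (sndPart z)) (fstPart z) * (h t * (starRingEnd ℂ)
        (timeFreqShift (pair (m.symm (fstPart z)) (r (sndPart z)))
        (compCLMOfContinuousLinearEquiv ℂ ((m.trans n.symm).trans (ContinuousLinearEquiv.neg ℝ))
          g) t)) := by
      intro t
      have e4 : compCLMOfContinuousLinearEquiv ℂ
          ((m.trans n.symm).trans (ContinuousLinearEquiv.neg ℝ)) g (t - m.symm (fstPart z))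
          = g (fstPart z - m (n.symm (t - fstPart z))) := by rw [e1]; rfl
      simp only [hG, timeFreqShift_apply, fstPart_pair, sndPart_pair, map_mul, conj_character, e4]
      generalize (starRingEnd ℂ) (g (fstPart z - m (n.symm (t - fstPart z)))) = γ
      rw [hr_apply, map_neg, character_neg_left, character_neg_left, neg_sub, sub_eq_add_neg,
        character_add_right]
      ring
    rw [wignerSchwartz, hU]
    simp only [e2]
    rw [hint (fun t => G (t + fstPart z)), integral_add_right_eq_self G]
    simp only [e3]
    rw [integral_const_mul]
    ring

end Kernel

/-! ### Polarization of the isometry, and testing against Schwartz functions. -/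

section Isometry

/-- Polarization. The metaplectic operator is only assumed to preserve norms, whereas the duality
arguments need it to preserve inner products. -/
theorem inner_eq_of_norm_eq {X H : Type*} [AddCommGroup X] [Module ℂ X] [NormedAddCommGroup H]
    [InnerProductSpace ℂ H] (T T' : X →ₗ[ℂ] H) (h : ∀ x, ‖T x‖ = ‖T' x‖) (x y : X) :
    inner ℂ (T x) (T y) = inner ℂ (T' x) (T' y) := by
  rw [inner_eq_sum_norm_sq_div_four, inner_eq_sum_norm_sq_div_four (T' x)]
  simp only [← map_smul, ← map_add, ← map_sub, h]

variable {V : Type} [NormedAddCommGroup V] [InnerProductSpace ℝ V] [FiniteDimensional ℝ V]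
  [MeasurableSpace V] [BorelSpace V]

theorem inner_toLp_eq_integral (Φ Ψ : 𝓢(V, ℂ)) :
    inner ℂ (Φ.toLp 2) (Ψ.toLp 2) = ∫ x, (starRingEnd ℂ) (Φ x) * Ψ x := by
  rw [L2.inner_def]
  refine integral_congr_ae ?_
  filter_upwards [Φ.coeFn_toLp 2, Ψ.coeFn_toLp 2] with x h1 h2
  rw [h1, h2, RCLike.inner_apply, mul_comm]

theorem norm_toLp_sq_eq_integral (Φ : 𝓢(V, ℂ)) : ‖Φ.toLp 2‖ ^ 2 = ∫ x, ‖Φ x‖ ^ 2 := by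
  have h1 := inner_toLp_eq_integral Φ Φ
  have h2 : ∀ x, (starRingEnd ℂ) (Φ x) * Φ x = ((‖Φ x‖ ^ 2 : ℝ) : ℂ) := fun x => by
    rw [Complex.conj_mul']; push_cast; rfl
  simp only [h2] at h1
  rw [inner_self_eq_norm_sq_to_K, integral_complex_ofReal] at h1
  exact Complex.ofReal_injective ((Complex.ofReal_pow _ _).trans h1)

theorem integral_conj_mul_of_isometry {U : 𝓢(V, ℂ) ≃L[ℂ] 𝓢(V, ℂ)}
    (h : ∀ Φ, ∫ t, ‖U Φ t‖ ^ 2 = ∫ t, ‖Φ t‖ ^ 2) (Φ Ψ : 𝓢(V, ℂ)) :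
    ∫ x, (starRingEnd ℂ) (U Φ x) * U Ψ x = ∫ x, (starRingEnd ℂ) (Φ x) * Ψ x := by
  rw [← inner_toLp_eq_integral, ← inner_toLp_eq_integral]
  let T : 𝓢(V, ℂ) →ₗ[ℂ] Lp ℂ 2 (volume : Measure V) := (toLpCLM ℂ ℂ 2 volume).toLinearMap
  let R : 𝓢(V, ℂ) →ₗ[ℂ] 𝓢(V, ℂ) := U.toLinearEquiv.toLinearMap
  have hT : ∀ Φ, T Φ = Φ.toLp 2 := fun _ => rfl
  have hR : ∀ Φ, R Φ = U Φ := fun _ => rfl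
  have h1 := inner_eq_of_norm_eq (T ∘ₗ R) T (fun Φ => by
    rw [LinearMap.comp_apply, hT, hT, hR, ← sq_eq_sq₀ (norm_nonneg _) (norm_nonneg _),
      norm_toLp_sq_eq_integral, norm_toLp_sq_eq_integral, h]) Φ Ψ
  simpa only [LinearMap.comp_apply, hT, hR] using h1

theorem integrable_norm_mul_of_le (Φ : 𝓢(V, ℂ)) {b : V → ℝ} (hb : AEStronglyMeasurable b)
    {K : ℕ} {C : ℝ} (h : ∀ z, ‖b z‖ ≤ C * (1 + ‖z‖) ^ K) : Integrable fun z => ‖Φ z‖ * b z := by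
  have h1 : Integrable fun z => C * (2 ^ K * (‖z‖ ^ 0 * ‖Φ z‖ + ‖z‖ ^ K * ‖Φ z‖)) :=
    (((Φ.integrable_pow_mul volume 0).add (Φ.integrable_pow_mul volume K)).const_mul _).const_mul _
  have hC : 0 ≤ C := by
    have := (norm_nonneg _).trans (h 0)
    simpa using this
  refine h1.mono' (Φ.continuous.norm.aestronglyMeasurable.mul hb)
    (Filter.Eventually.of_forall fun z => ?_)
  rw [norm_mul, norm_norm]
  have h2 : (1 + ‖z‖) ^ K ≤ 2 ^ K * (1 + ‖z‖ ^ K) := by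
    have h3 := add_pow_le zero_le_one (norm_nonneg z) K
    rw [one_pow] at h3
    refine h3.trans ?_
    gcongr
    · exact one_le_two
    · omega
  calc ‖Φ z‖ * ‖b z‖ ≤ ‖Φ z‖ * (C * (2 ^ K * (1 + ‖z‖ ^ K))) := by
        gcongr
        exact (h z).trans (by gcongr)
    _ = _ := by ring

theorem eq_of_integral_mul_schwartz_eq {F G : V → ℂ} (hF : Continuous F) (hG : Continuous G)
    (h : ∀ φ : 𝓢(V, ℂ), ∫ x, φ x * F x = ∫ x, φ x * G x) : F = G := by
  have h1 : F =ᵐ[volume] G := by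
    refine ae_eq_of_integral_contDiff_smul_eq hF.locallyIntegrable hG.locallyIntegrable
      fun g hg hgc => ?_
    have h2 : HasCompactSupport fun x => ((g x : ℝ) : ℂ) :=
      hgc.comp_left (g := fun r : ℝ => (r : ℂ)) (by simp)
    have h3 := h (h2.toSchwartzMap (Complex.ofRealCLM.contDiff.comp hg))
    simp only [Complex.real_smul]
    exact h3
  exact (hF.ae_eq_iff_eq volume hG).1 h1

theorem ae_eq_of_integral_mul_schwartz_eq {F G : V → ℂ} (hF : LocallyIntegrable F)
    (hG : LocallyIntegrable G)
    (h : ∀ φ : 𝓢(V, ℂ), ∫ x, φ x * F x = ∫ x, φ x * G x) : F =ᵐ[volume] G := by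
  refine ae_eq_of_integral_contDiff_smul_eq hF hG fun g hg hgc => ?_
  have h2 : HasCompactSupport fun x => ((g x : ℝ) : ℂ) :=
    hgc.comp_left (g := fun r : ℝ => (r : ℂ)) (by simp)
  have h3 := h (h2.toSchwartzMap (Complex.ofRealCLM.contDiff.comp hg))
  simp only [Complex.real_smul]
  exact h3

end Isometry

/-! ### The function representing `W(f, g)` for Schwartz windows. -/

section Wigner

variable {d : ℕ}
  {U : 𝓢(EuclideanSpace ℝ (Fin d ⊕ Fin d), ℂ) ≃L[ℂ] 𝓢(EuclideanSpace ℝ (Fin d ⊕ Fin d), ℂ)}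

theorem integral_eq_integral_pair {H : EuclideanSpace ℝ (Fin d ⊕ Fin d) → ℂ}
    (hH : Integrable H) :
    ∫ z, H z = ∫ x : EuclideanSpace ℝ (Fin d), ∫ y : EuclideanSpace ℝ (Fin d), H (pair x y) := by
  rw [← measurePreserving_pair.integral_comp measurableEmbedding_pair H]
  exact integral_prod _ ((measurePreserving_pair.integrable_comp_emb measurableEmbedding_pair).2 hH)

theorem coe_schwartz_apply (g ψ : 𝓢(EuclideanSpace ℝ (Fin d), ℂ)) :
    (g : 𝓢'(EuclideanSpace ℝ (Fin d), ℂ)) ψ = ∫ x, ψ x * g x :=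
  SchwartzMap.toTemperedDistributionCLM_apply_apply volume g ψ

theorem partialCLM_conjDistribution_apply (g : 𝓢(EuclideanSpace ℝ (Fin d), ℂ))
    (Θ : 𝓢(EuclideanSpace ℝ (Fin d ⊕ Fin d), ℂ)) (x : EuclideanSpace ℝ (Fin d)) :
    partialCLM (conjDistribution (g : 𝓢'(EuclideanSpace ℝ (Fin d), ℂ))) Θ x
      = ∫ y, Θ (pair x y) * (starRingEnd ℂ) (g y) := by
  change conjDistribution (g : 𝓢'(EuclideanSpace ℝ (Fin d), ℂ)) (slice x Θ) = _
  rw [conjDistribution_apply, coe_schwartz_apply, ← integral_conj]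
  simp only [conjSchwartz_apply, slice_apply, map_mul, Complex.conj_conj]

theorem integral_mul_partialCLM (h g : 𝓢(EuclideanSpace ℝ (Fin d), ℂ))
    (Θ : 𝓢(EuclideanSpace ℝ (Fin d ⊕ Fin d), ℂ)) :
    ∫ x, h x * partialCLM (conjDistribution (g : 𝓢'(EuclideanSpace ℝ (Fin d), ℂ))) Θ x
      = ∫ z, Θ z * tensorSchwartz h (conjSchwartz g) z := by
  have h1 : Integrable fun z => Θ z * tensorSchwartz h (conjSchwartz g) z :=
    Θ.integrable.mul_bdd (c := SchwartzMap.seminorm ℝ 0 0 (tensorSchwartz h (conjSchwartz g)))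
      (tensorSchwartz h (conjSchwartz g)).continuous.aestronglyMeasurable
      (Filter.Eventually.of_forall fun z => norm_le_seminorm ℝ _ z)
  rw [integral_eq_integral_pair h1]
  refine integral_congr_ae (Filter.Eventually.of_forall fun x => ?_)
  simp only [partialCLM_conjDistribution_apply, tensorSchwartz_apply, fstPart_pair, sndPart_pair,
    conjSchwartz_apply]
  rw [← integral_const_mul]
  refine integral_congr_ae (Filter.Eventually.of_forall fun y => ?_)
  simp only
  ring

/-- The phase space coordinates in which `U(h ⊗ ḡ)` is a short-time Fourier transform. -/
def WignerKernel.phaseMap (K : WignerKernel U) (z : EuclideanSpace ℝ (Fin d ⊕ Fin d)) :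
    EuclideanSpace ℝ (Fin d ⊕ Fin d) :=
  pair (K.timeEquiv (fstPart z)) (K.freqEquiv (sndPart z))

/-- The window of the short-time Fourier transform associated with `g`. -/
def WignerKernel.window (K : WignerKernel U) :
    𝓢(EuclideanSpace ℝ (Fin d), ℂ) →L[ℂ] 𝓢(EuclideanSpace ℝ (Fin d), ℂ) :=
  compCLMOfContinuousLinearEquiv ℂ K.windowEquiv

theorem WignerKernel.wigner_eq_stft (K : WignerKernel U) (h g : 𝓢(EuclideanSpace ℝ (Fin d), ℂ))
    (z : EuclideanSpace ℝ (Fin d ⊕ Fin d)) :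
    wignerSchwartz U h g z = K.factor z *
      stft (K.window g) (h : 𝓢'(EuclideanSpace ℝ (Fin d), ℂ)) (K.phaseMap z) := by
  rw [K.wigner_eq, stft, coe_schwartz_apply]
  simp only [conjSchwartz_apply, mul_comm (h _)]
  rfl

theorem WignerKernel.continuous_phaseMap (K : WignerKernel U) : Continuous K.phaseMap :=
  continuous_pair.comp ((K.timeEquiv.continuous.comp continuous_fstPart).prodMk
    (K.freqEquiv.continuous.comp continuous_sndPart))

theorem WignerKernel.exists_norm_phaseMap_le (K : WignerKernel U) :
    ∃ C : ℝ, 1 ≤ C ∧ ∀ z, 1 + ‖K.phaseMap z‖ ≤ C * (1 + ‖z‖) := by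
  set a := ‖K.timeEquiv.toContinuousLinearMap‖
  set b := ‖K.freqEquiv.toContinuousLinearMap‖
  have ha : 0 ≤ a := norm_nonneg _
  have hb : 0 ≤ b := norm_nonneg _
  refine ⟨1 + a + b, by linarith, fun z => ?_⟩
  have h1 := norm_le_fst_add_snd (K.phaseMap z)
  have h2 : ‖fstPart (K.phaseMap z)‖ ≤ a * ‖z‖ := by
    rw [phaseMap, fstPart_pair]
    exact (K.timeEquiv.toContinuousLinearMap.le_opNorm _).trans
      (mul_le_mul_of_nonneg_left (norm_fstPart_le z) ha)
  have h3 : ‖sndPart (K.phaseMap z)‖ ≤ b * ‖z‖ := by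
    rw [phaseMap, sndPart_pair]
    exact (K.freqEquiv.toContinuousLinearMap.le_opNorm _).trans
      (mul_le_mul_of_nonneg_left (norm_sndPart_le z) hb)
  nlinarith [norm_nonneg z]

/-- `W(f, g)` is a rescaled short-time Fourier transform, for Schwartz windows `g`. -/
theorem WignerKernel.isGivenBy_wigner (K : WignerKernel U) (f : 𝓢'(EuclideanSpace ℝ (Fin d), ℂ))
    (g : 𝓢(EuclideanSpace ℝ (Fin d), ℂ)) :
    IsGivenBy (wigner U f (g : 𝓢'(EuclideanSpace ℝ (Fin d), ℂ)))
      (fun z => K.factor z * stft (K.window g) f (K.phaseMap z)) := by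
  refine ⟨(K.continuous_factor.mul ((continuous_stft _ f).comp
    K.continuous_phaseMap)).aestronglyMeasurable, fun Φ => ?_⟩
  set γ := K.window g with hγ
  set Θ := conjSchwartz (U.symm (conjSchwartz Φ)) with hΘ
  set κ : EuclideanSpace ℝ (Fin d ⊕ Fin d) → 𝓢(EuclideanSpace ℝ (Fin d), ℂ) :=
    fun z => conjSchwartz (timeFreqShift (K.phaseMap z) γ) with hκ
  have hκc : Continuous κ := by
    have h1 : Continuous fun z : EuclideanSpace ℝ (Fin d ⊕ Fin d) => timeFreqShift z γ :=
      Continuous.comp (g := fun z : EuclideanSpace ℝ (Fin d ⊕ Fin d) ×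
          𝓢(EuclideanSpace ℝ (Fin d), ℂ) => timeFreqShift z.1 z.2)
        (f := fun z => (z, γ)) continuous_timeFreqShift (Continuous.prodMk_left γ)
    exact conjSchwartz.continuous.comp (h1.comp K.continuous_phaseMap)
  have hκn : ∀ z t, ‖κ z t‖ ≤ SchwartzMap.seminorm ℝ 0 0 γ := by
    intro z t
    rw [hκ, conjSchwartz_apply, RCLike.norm_conj, timeFreqShift_apply, norm_mul, norm_character,
      one_mul]
    exact norm_le_seminorm ℝ _ _
  set w : EuclideanSpace ℝ (Fin d ⊕ Fin d) → ℂ := fun z => Φ z * K.factor z with hw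
  have hwc : Continuous w := Φ.continuous.mul K.continuous_factor
  have hwn : ∀ z, ‖w z‖ = ‖Φ z‖ * K.modulus := fun z => by rw [hw, norm_mul, K.norm_factor]
  have hwi : Integrable w := by
    refine (Φ.integrable.norm.mul_const K.modulus).mono' hwc.aestronglyMeasurable
      (Filter.Eventually.of_forall fun z => (hwn z).le)
  -- The test function that `f` sees is the superposition of the conjugated atoms `κ z` with
  -- coefficients `w z`. Tested against a Schwartz function `h`, this is the unitarity of `U`
  -- combined with the kernel formula for `W(h, g)`.
  have hψ : (partialCLM (conjDistribution (g : 𝓢'(EuclideanSpace ℝ (Fin d), ℂ))) Θ :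
      EuclideanSpace ℝ (Fin d) → ℂ) = fun x => ∫ z, w z * κ z x := by
    refine eq_of_integral_mul_schwartz_eq (SchwartzMap.continuous _) ?_ fun h => ?_
    · refine continuous_of_dominated (bound := fun z => ‖w z‖ * SchwartzMap.seminorm ℝ 0 0 γ)
        (fun x => ?_) (fun x => ?_) (hwi.norm.mul_const _) ?_
      · exact (hwc.mul ((continuous_schwartz_apply x).comp hκc)).aestronglyMeasurable
      · refine Filter.Eventually.of_forall fun z => ?_
        rw [norm_mul]
        gcongr
        exact hκn z x
      · exact Filter.Eventually.of_forall fun z => continuous_const.mul (κ z).continuous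
    · rw [integral_mul_partialCLM]
      have h1 := integral_conj_mul_of_isometry K.isometry (U.symm (conjSchwartz Φ))
        (tensorSchwartz h (conjSchwartz g))
      rw [U.apply_symm_apply] at h1
      simp only [conjSchwartz_apply, Complex.conj_conj] at h1
      have h2 : ∀ z, Θ z = (starRingEnd ℂ) (U.symm (conjSchwartz Φ) z) := fun z => rfl
      simp only [h2]
      rw [← h1]
      have h3 : ∀ z, Φ z * U (tensorSchwartz h (conjSchwartz g)) z
          = ∫ t, w z * (h t * κ z t) := by
        intro z
        rw [integral_const_mul, hw, mul_assoc]
        exact congrArg (Φ z * ·) (K.wigner_eq h g z)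
      simp only [h3]
      rw [integral_integral_swap]
      · refine integral_congr_ae (Filter.Eventually.of_forall fun t => ?_)
        simp only
        rw [← integral_const_mul]
        refine integral_congr_ae (Filter.Eventually.of_forall fun z => ?_)
        simp only
        ring
      · have h4 : Integrable (fun p : EuclideanSpace ℝ (Fin d ⊕ Fin d) ×
            EuclideanSpace ℝ (Fin d) => w p.1 * h p.2) (volume.prod volume) :=
          hwi.mul_prod h.integrable
        have h5 : Continuous (Function.uncurry fun z t => κ z t) := by
          have h6 : (Function.uncurry fun z t => κ z t) = fun p : EuclideanSpace ℝ (Fin d ⊕ Fin d) ×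
              EuclideanSpace ℝ (Fin d) => (starRingEnd ℂ) (character (sndPart (K.phaseMap p.1)) p.2
                * γ (p.2 - fstPart (K.phaseMap p.1))) := by
            funext p
            rw [Function.uncurry, hκ, conjSchwartz_apply, timeFreqShift_apply]
          rw [h6]
          have h7 := (K.continuous_phaseMap.comp
            (continuous_fst (X := EuclideanSpace ℝ (Fin d ⊕ Fin d)) (Y := EuclideanSpace ℝ (Fin d))))
          refine Complex.continuous_conj.comp (Continuous.mul ?_ ?_)
          · exact continuous_character.comp ((continuous_sndPart.comp h7).prodMk continuous_snd)
          · exact γ.continuous.comp (continuous_snd.sub (continuous_fstPart.comp h7))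
        have h6 := h4.mul_bdd (c := SchwartzMap.seminorm ℝ 0 0 γ) h5.aestronglyMeasurable
          (Filter.Eventually.of_forall fun p => hκn p.1 p.2)
        refine h6.congr (Filter.Eventually.of_forall fun p => ?_)
        simp only [Function.uncurry]
        ring
  -- It remains to apply `f` under the integral. Absolute convergence in every seminorm holds
  -- because the atoms grow polynomially in `z` while `Φ` decays rapidly.
  have key := tempered_apply_eq_integral f hwc.aestronglyMeasurable hκc (μ := volume)
    (fun k n => ?_) (fun x => congrFun hψ x)
  · have e : ∀ z, w z * f (κ z) = Φ z * (K.factor z * stft γ f (K.phaseMap z)) := fun z => by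
      rw [hw, mul_assoc]; rfl
    simp only [e] at key
    exact key
  · obtain ⟨N, q', hq', hq⟩ := exists_seminorm_timeFreqShift_le
      (SchwartzMap.seminorm ℂ k n) ((schwartz_withSeminorms ℂ _ ℂ).continuous_seminorm (k, n))
    obtain ⟨C, hC, hCz⟩ := K.exists_norm_phaseMap_le
    have h1 := integrable_norm_mul_of_le Φ (b := fun z => K.modulus *
      SchwartzMap.seminorm ℝ k n (κ z)) (K := N) (C := K.modulus * (C ^ N * q' γ)) ?_ ?_
    · refine h1.congr (Filter.Eventually.of_forall fun z => ?_)
      simp only [hwn]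
      ring
    · exact (continuous_const.mul (((schwartz_withSeminorms ℝ _ ℂ).continuous_seminorm
        (k, n)).comp hκc)).aestronglyMeasurable
    · intro z
      rw [norm_mul, Real.norm_of_nonneg K.modulus_pos.le,
        Real.norm_of_nonneg (apply_nonneg _ _), mul_assoc]
      refine mul_le_mul_of_nonneg_left ?_ K.modulus_pos.le
      calc SchwartzMap.seminorm ℝ k n (κ z)
          ≤ SchwartzMap.seminorm ℝ k n (timeFreqShift (K.phaseMap z) γ) :=
            seminorm_conjSchwartz k n _
        _ ≤ (1 + ‖K.phaseMap z‖) ^ N * q' γ := hq _ _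
        _ ≤ (C * (1 + ‖z‖)) ^ N * q' γ := by
            have := apply_nonneg q' γ
            gcongr
            exact hCz z
        _ = _ := by rw [mul_pow]; ring

end Wigner

/-! ### Reproducing formula and pointwise convolution bound. -/

section Reproducing

variable {d : ℕ}
  {U : 𝓢(EuclideanSpace ℝ (Fin d ⊕ Fin d), ℂ) ≃L[ℂ] 𝓢(EuclideanSpace ℝ (Fin d ⊕ Fin d), ℂ)}

theorem mixE_one_one {H : EuclideanSpace ℝ (Fin d ⊕ Fin d) → ℝ≥0∞} (hH : Measurable H) :
    mixE 1 1 H = ∫⁻ z, H z := by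
  rw [mixE, lintegral_eq_lintegral_pair hH]
  simp only [eLpNorm_one_eq_lintegral_enorm, enorm_eq_self]

/-- The phase space coordinates as a linear automorphism. -/
def WignerKernel.phaseEquiv (K : WignerKernel U) :
    EuclideanSpace ℝ (Fin d ⊕ Fin d) ≃ₗ[ℝ] EuclideanSpace ℝ (Fin d ⊕ Fin d) where
  toFun := K.phaseMap
  invFun z := pair (K.timeEquiv.symm (fstPart z)) (K.freqEquiv.symm (sndPart z))
  map_add' z w := by
    have h1 : fstPart (z + w) = fstPart z + fstPart w := rfl
    have h2 : sndPart (z + w) = sndPart z + sndPart w := rfl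
    rw [phaseMap, h1, h2, map_add, map_add, ← pair_add]
    rfl
  map_smul' c z := by
    have h1 : fstPart (c • z) = c • fstPart z := rfl
    have h2 : sndPart (c • z) = c • sndPart z := rfl
    rw [phaseMap, h1, h2, map_smul, map_smul, pair_eq, map_smul, map_smul, ← smul_add, ← pair_eq]
    rfl
  left_inv z := by
    simp only [phaseMap, fstPart_pair, sndPart_pair, ContinuousLinearEquiv.symm_apply_apply,
      pair_fstPart_sndPart]
  right_inv z := by
    simp only [phaseMap, fstPart_pair, sndPart_pair, ContinuousLinearEquiv.apply_symm_apply,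
      pair_fstPart_sndPart]

theorem WignerKernel.phaseEquiv_apply (K : WignerKernel U)
    (z : EuclideanSpace ℝ (Fin d ⊕ Fin d)) : K.phaseEquiv z = K.phaseMap z := rfl

theorem WignerKernel.continuous_phaseEquiv_symm (K : WignerKernel U) :
    Continuous K.phaseEquiv.symm := K.phaseEquiv.symm.toContinuousLinearEquiv.continuous

theorem WignerKernel.exists_mixE_comp_phaseEquiv_symm (K : WignerKernel U) (p q : ℝ≥0∞) :
    ∃ c : ℝ≥0∞, c ≠ 0 ∧ c ≠ ⊤ ∧ ∀ H : EuclideanSpace ℝ (Fin d ⊕ Fin d) → ℝ≥0∞,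
      mixE p q (fun z => H (K.phaseEquiv.symm z)) = c * mixE p q H :=
  exists_mixE_comp_linearEquiv p q K.timeEquiv.symm.toLinearEquiv K.freqEquiv.symm.toLinearEquiv

theorem WignerKernel.exists_mixE_comp_phaseMap (K : WignerKernel U) (p q : ℝ≥0∞) :
    ∃ c : ℝ≥0∞, c ≠ 0 ∧ c ≠ ⊤ ∧ ∀ H : EuclideanSpace ℝ (Fin d ⊕ Fin d) → ℝ≥0∞,
      mixE p q (fun z => H (K.phaseMap z)) = c * mixE p q H :=
  exists_mixE_comp_linearEquiv p q K.timeEquiv.toLinearEquiv K.freqEquiv.toLinearEquiv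

theorem WignerKernel.exists_lintegral_comp_phaseMap (K : WignerKernel U) :
    ∃ c : ℝ≥0∞, c ≠ 0 ∧ c ≠ ⊤ ∧ ∀ H : EuclideanSpace ℝ (Fin d ⊕ Fin d) → ℝ≥0∞, Measurable H →
      ∫⁻ z, H (K.phaseMap z) = c * ∫⁻ z, H z := by
  obtain ⟨c, h0, ht, h⟩ := K.exists_mixE_comp_phaseMap 1 1
  refine ⟨c, h0, ht, fun H hH => ?_⟩
  rw [← mixE_one_one hH, ← h]
  exact (mixE_one_one (hH.comp K.continuous_phaseMap.measurable)).symm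

theorem WignerKernel.window_surjective (K : WignerKernel U)
    (ψ : 𝓢(EuclideanSpace ℝ (Fin d), ℂ)) : ∃ g, K.window g = ψ := by
  refine ⟨compCLMOfContinuousLinearEquiv ℂ K.windowEquiv.symm ψ, ?_⟩
  ext x
  change ψ (K.windowEquiv.symm (K.windowEquiv x)) = ψ x
  rw [K.windowEquiv.symm_apply_apply]

theorem norm_stft_schwartz_timeFreqShift (ψ h : 𝓢(EuclideanSpace ℝ (Fin d), ℂ))
    (u v : EuclideanSpace ℝ (Fin d ⊕ Fin d)) :
    ‖stft ψ (timeFreqShift u h : 𝓢'(EuclideanSpace ℝ (Fin d), ℂ)) v‖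
      = ‖stft ψ (h : 𝓢'(EuclideanSpace ℝ (Fin d), ℂ)) (v - u)‖ := by
  rw [stft, stft, coe_schwartz_apply, coe_schwartz_apply,
    ← integral_add_right_eq_self _ (fstPart u)]
  set b : ℂ := character (-sndPart v) (fstPart u) * character (sndPart u) (fstPart u) with hb
  have hb1 : ‖b‖ = 1 := by rw [hb, norm_mul, norm_character, norm_character, one_mul]
  have key : ∀ G H : EuclideanSpace ℝ (Fin d) → ℂ, (∀ y, G y = b * H y) →
      ‖∫ y, G y‖ = ‖∫ y, H y‖ := by
    intro G H h
    rw [show G = fun y => b * H y from funext h, integral_const_mul, norm_mul, hb1, one_mul]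
  apply key
  intro t
  simp only [conjSchwartz_apply, timeFreqShift_apply, map_mul, conj_character, fstPart_sub,
    sndPart_sub, add_sub_cancel_right]
  have e1 : t + fstPart u - fstPart v = t - (fstPart v - fstPart u) := by abel
  have e2 : -(sndPart v - sndPart u) = -sndPart v + sndPart u := by abel
  rw [e1, e2, hb, character_add_right, character_add_right, character_add_left]
  ring

theorem WignerKernel.norm_wigner_timeFreqShift (K : WignerKernel U)
    (h γ : 𝓢(EuclideanSpace ℝ (Fin d), ℂ)) (u w : EuclideanSpace ℝ (Fin d ⊕ Fin d)) :
    ‖wignerSchwartz U (timeFreqShift u h) γ w‖ = K.modulus *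
      ‖stft (K.window γ) (h : 𝓢'(EuclideanSpace ℝ (Fin d), ℂ)) (K.phaseMap w - u)‖ := by
  rw [K.wigner_eq_stft, norm_mul, K.norm_factor, norm_stft_schwartz_timeFreqShift]

theorem schwartz_exists_enorm_le_bracket {V : Type} [NormedAddCommGroup V] [NormedSpace ℝ V]
    (G : 𝓢(V, ℂ)) (N : ℝ) :
    ∃ C : ℝ≥0∞, C ≠ ⊤ ∧ ∀ z, bracket z ^ N * ‖G z‖ₑ ≤ C := by
  obtain ⟨n, hn⟩ := exists_nat_ge N
  have h := one_add_le_sup_seminorm_apply (𝕜 := ℝ) (m := (n, 0)) le_rfl le_rfl G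
  refine ⟨ENNReal.ofReal (2 ^ n * ((Finset.Iic (n, 0)).sup
    fun m => SchwartzMap.seminorm ℝ m.1 m.2) G), ENNReal.ofReal_ne_top, fun z => ?_⟩
  have h1 := h z
  rw [norm_iteratedFDeriv_zero] at h1
  calc bracket z ^ N * ‖G z‖ₑ ≤ bracket z ^ (n : ℝ) * ‖G z‖ₑ := by
        gcongr
        exact one_le_bracket z
    _ = ENNReal.ofReal ((1 + ‖z‖) ^ n * ‖G z‖) := by
        rw [bracket, ENNReal.rpow_natCast, ← ENNReal.ofReal_pow (by positivity), ← ofReal_norm,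
          ENNReal.ofReal_mul (by positivity)]
    _ ≤ _ := ENNReal.ofReal_le_ofReal h1

/-- The rapid decay comes for free: `U` maps the tensor product to a Schwartz function, which is
this transform up to a factor of constant modulus and a linear change of variables. -/
theorem WignerKernel.exists_enorm_stft_schwartz_le (K : WignerKernel U)
    (ψ h : 𝓢(EuclideanSpace ℝ (Fin d), ℂ)) {N : ℝ} (hN : 0 ≤ N) :
    ∃ C : ℝ≥0∞, C ≠ ⊤ ∧ ∀ v,
      ‖stft ψ (h : 𝓢'(EuclideanSpace ℝ (Fin d), ℂ)) v‖ₑ ≤ C * bracket v ^ (-N) := by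
  obtain ⟨g, rfl⟩ := K.window_surjective ψ
  obtain ⟨C, hC, h1⟩ := schwartz_exists_enorm_le_bracket (wignerSchwartz U h g) N
  obtain ⟨b, hb, h2⟩ := K.exists_norm_phaseMap_le
  have hκ : ENNReal.ofReal K.modulus ≠ 0 := by
    rw [ne_eq, ENNReal.ofReal_eq_zero, not_le]; exact K.modulus_pos
  refine ⟨ENNReal.ofReal b ^ N * C / ENNReal.ofReal K.modulus, ?_, fun v => ?_⟩
  · exact ENNReal.div_ne_top (ENNReal.mul_ne_top (ENNReal.rpow_ne_top_of_nonneg hN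
      ENNReal.ofReal_ne_top) hC) hκ
  · obtain ⟨z, rfl⟩ : ∃ z, K.phaseMap z = v := ⟨K.phaseEquiv.symm v, K.phaseEquiv.apply_symm_apply v⟩
    have h3 := h1 z
    rw [K.wigner_eq_stft, enorm_mul, ← ofReal_norm (K.factor z), K.norm_factor] at h3
    have h4 : bracket (K.phaseMap z) ≤ ENNReal.ofReal b * bracket z := by
      rw [bracket, bracket, ← ENNReal.ofReal_mul (by linarith)]
      exact ENNReal.ofReal_le_ofReal (h2 z)
    have h5 : bracket (K.phaseMap z) ^ N ≠ 0 := by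
      simp [ENNReal.rpow_eq_zero_iff, bracket_ne_zero, bracket_ne_top]
    have h6 : bracket (K.phaseMap z) ^ N ≠ ⊤ :=
      ENNReal.rpow_ne_top_of_nonneg hN (bracket_ne_top _)
    rw [ENNReal.rpow_neg, ← div_eq_mul_inv, ENNReal.le_div_iff_mul_le (Or.inl h5) (Or.inl h6),
      ENNReal.le_div_iff_mul_le (Or.inl hκ) (Or.inl ENNReal.ofReal_ne_top)]
    calc _ = bracket (K.phaseMap z) ^ N * (ENNReal.ofReal K.modulus *
          ‖stft (K.window g) (h : 𝓢'(EuclideanSpace ℝ (Fin d), ℂ)) (K.phaseMap z)‖ₑ) := by ring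
      _ ≤ (ENNReal.ofReal b * bracket z) ^ N * (ENNReal.ofReal K.modulus *
          ‖stft (K.window g) (h : 𝓢'(EuclideanSpace ℝ (Fin d), ℂ)) (K.phaseMap z)‖ₑ) := by
          gcongr
      _ ≤ _ := by
          rw [ENNReal.mul_rpow_of_nonneg _ _ hN, mul_assoc]
          gcongr

theorem tensorDistribution_conj_tensorSchwartz (f g : 𝓢'(EuclideanSpace ℝ (Fin d), ℂ))
    (h γ : 𝓢(EuclideanSpace ℝ (Fin d), ℂ)) :
    tensorDistribution f (conjDistribution g) (conjSchwartz (tensorSchwartz h (conjSchwartz γ)))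
      = f (conjSchwartz h) * (starRingEnd ℂ) (g (conjSchwartz γ)) := by
  rw [tensorDistribution_apply]
  have e : partialCLM (conjDistribution g) (conjSchwartz (tensorSchwartz h (conjSchwartz γ)))
      = (starRingEnd ℂ) (g (conjSchwartz γ)) • conjSchwartz h := by
    ext x
    change conjDistribution g (slice x _) = _
    have h1 : slice x (conjSchwartz (tensorSchwartz h (conjSchwartz γ)))
        = (starRingEnd ℂ) (h x) • γ := by
      ext y
      simp only [slice_apply, conjSchwartz_apply, tensorSchwartz_apply, fstPart_pair, sndPart_pair,
        map_mul, Complex.conj_conj, smul_apply, smul_eq_mul]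
    rw [h1, map_smul, conjDistribution_apply, smul_apply, conjSchwartz_apply, smul_eq_mul,
      smul_eq_mul, mul_comm]
  rw [e, map_smul, smul_eq_mul, mul_comm]

/-- The reproducing formula for a time-frequency representation given by a function. -/
theorem stft_mul_eq_integral {f g : 𝓢'(EuclideanSpace ℝ (Fin d), ℂ)}
    {F : EuclideanSpace ℝ (Fin d ⊕ Fin d) → ℂ} (hF : IsGivenBy (wigner U f g) F)
    (h γ : 𝓢(EuclideanSpace ℝ (Fin d), ℂ)) (z : EuclideanSpace ℝ (Fin d ⊕ Fin d)) :
    stft h f z * (starRingEnd ℂ) (g (conjSchwartz γ))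
      = ∫ w, (starRingEnd ℂ) (wignerSchwartz U (timeFreqShift z h) γ w) * F w := by
  -- Test `W(f, g)` on the conjugate of `U(π(z)h ⊗ γ̄)`: the inverse of `U` in the extension to
  -- distributions cancels `U`, leaving `f ⊗ ḡ` on a pure tensor, where it factors.
  have h1 := (hF.2 (conjSchwartz (wignerSchwartz U (timeFreqShift z h) γ))).2
  simp only [conjSchwartz_apply] at h1
  rw [← h1, stft, ← tensorDistribution_conj_tensorSchwartz]
  change _ = tensorDistribution f (conjDistribution g) (conjSchwartz (U.symm (conjSchwartz
    (conjSchwartz (U (tensorSchwartz (timeFreqShift z h) (conjSchwartz γ)))))))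
  rw [conjSchwartz_conjSchwartz, U.symm_apply_apply]

/-- Divide the reproducing formula by a non-zero value of `g`. The modulus of its kernel is that of
a short-time Fourier transform of Schwartz functions at `P w - z`, with `P` the phase map, hence
decays rapidly; the variable `u = z - P w` makes the integral a convolution. The constant depends on
`g` but not on `f`. -/
theorem WignerKernel.exists_enorm_stft_le_lintegral (K : WignerKernel U)
    {g : 𝓢'(EuclideanSpace ℝ (Fin d), ℂ)} (hg : g ≠ 0) (h : 𝓢(EuclideanSpace ℝ (Fin d), ℂ))
    {N : ℝ} (hN : 0 ≤ N) :
    ∃ C : ℝ≥0∞, C ≠ 0 ∧ C ≠ ⊤ ∧ ∀ (f : 𝓢'(EuclideanSpace ℝ (Fin d), ℂ))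
      (F : EuclideanSpace ℝ (Fin d ⊕ Fin d) → ℂ), Measurable F → IsGivenBy (wigner U f g) F →
      ∀ z, ‖stft h f z‖ₑ
        ≤ C * ∫⁻ u, ‖F (K.phaseEquiv.symm (z - u))‖ₑ * bracket u ^ (-N) := by
  obtain ⟨γ', hγ'⟩ : ∃ γ', g γ' ≠ 0 := by
    by_contra! h0
    exact hg (by ext γ; exact h0 γ)
  obtain ⟨γ, rfl⟩ : ∃ γ, conjSchwartz γ = γ' := ⟨conjSchwartz γ', conjSchwartz_conjSchwartz γ'⟩
  obtain ⟨c, hc0, hct, hc⟩ := K.exists_lintegral_comp_phaseMap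
  obtain ⟨B, hBt, hB⟩ := K.exists_enorm_stft_schwartz_le (K.window γ) h hN
  have hg0 : ‖g (conjSchwartz γ)‖ₑ ≠ 0 := by simpa using hγ'
  -- `B + 1` instead of `B` keeps the constant non-zero, as the Peetre argument requires.
  refine ⟨ENNReal.ofReal K.modulus * (B + 1) * c / ‖g (conjSchwartz γ)‖ₑ, ?_, ?_,
    fun f F hFm hF z => ?_⟩
  · have := K.modulus_pos
    simp [hc0, this]
  · exact ENNReal.div_ne_top (ENNReal.mul_ne_top (ENNReal.mul_ne_top ENNReal.ofReal_ne_top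
      (by simp [hBt])) hct) hg0
  have h1 := congrArg (fun x : ℂ => ‖x‖ₑ) (stft_mul_eq_integral hF h γ z)
  simp only [enorm_mul, RCLike.enorm_conj] at h1
  rw [← ENNReal.mul_div_right_comm, ENNReal.le_div_iff_mul_le (Or.inl hg0) (Or.inl enorm_ne_top), h1]
  have hm1 : Measurable fun v => ‖F (K.phaseEquiv.symm v)‖ₑ :=
    (hFm.comp K.continuous_phaseEquiv_symm.measurable).enorm
  have hm2 : Measurable fun v : EuclideanSpace ℝ (Fin d ⊕ Fin d) => bracket (v - z) ^ (-N) :=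
    (measurable_bracket.comp (measurable_id.sub_const z)).pow_const _
  calc ‖∫ w, (starRingEnd ℂ) (wignerSchwartz U (timeFreqShift z h) γ w) * F w‖ₑ
      ≤ ∫⁻ w, ‖(starRingEnd ℂ) (wignerSchwartz U (timeFreqShift z h) γ w) * F w‖ₑ :=
        enorm_integral_le_lintegral_enorm _
    _ ≤ ∫⁻ w, ENNReal.ofReal K.modulus * (B + 1) * (‖F (K.phaseEquiv.symm (K.phaseMap w))‖ₑ *
          bracket (K.phaseMap w - z) ^ (-N)) := by
        refine lintegral_mono fun w => ?_
        rw [enorm_mul, RCLike.enorm_conj, ← ofReal_norm (wignerSchwartz U _ γ w),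
          K.norm_wigner_timeFreqShift, ENNReal.ofReal_mul K.modulus_pos.le, ofReal_norm,
          ← K.phaseEquiv_apply, LinearEquiv.symm_apply_apply, mul_assoc, mul_assoc]
        gcongr ENNReal.ofReal K.modulus * ?_
        rw [mul_left_comm, mul_comm]
        gcongr
        exact (hB _).trans (by gcongr; exact le_self_add)
    _ = ENNReal.ofReal K.modulus * (B + 1) * (c * ∫⁻ v, ‖F (K.phaseEquiv.symm v)‖ₑ *
          bracket (v - z) ^ (-N)) := by
        rw [lintegral_const_mul' _ _ (ENNReal.mul_ne_top ENNReal.ofReal_ne_top (by simp [hBt])),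
          hc (fun v => ‖F (K.phaseEquiv.symm v)‖ₑ * bracket (v - z) ^ (-N)) (hm1.mul hm2)]
    _ = _ := by
        rw [← lintegral_sub_left_eq_self _ z, ← mul_assoc]
        simp only [sub_sub_cancel_left, bracket_neg]

end Reproducing

/-! ### Window independence for all exponents, and the equivalence for Schwartz windows. -/

section WindowIndependence

variable {d : ℕ}
  {U : 𝓢(EuclideanSpace ℝ (Fin d ⊕ Fin d), ℂ) ≃L[ℂ] 𝓢(EuclideanSpace ℝ (Fin d ⊕ Fin d), ℂ)}

theorem coe_schwartz_ne_zero {g : 𝓢(EuclideanSpace ℝ (Fin d), ℂ)} (hg : g ≠ 0) :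
    (g : 𝓢'(EuclideanSpace ℝ (Fin d), ℂ)) ≠ 0 := by
  intro h
  apply hg
  have h1 : (g : EuclideanSpace ℝ (Fin d) → ℂ) = fun _ => 0 := by
    refine eq_of_integral_mul_schwartz_eq g.continuous continuous_const fun φ => ?_
    rw [← coe_schwartz_apply, h]
    simp
  ext x
  exact congrFun h1 x

theorem WignerKernel.window_ne_zero (K : WignerKernel U) {g : 𝓢(EuclideanSpace ℝ (Fin d), ℂ)}
    (hg : g ≠ 0) : K.window g ≠ 0 := by
  intro h
  apply hg
  ext x
  have h1 := congrArg (fun ψ : 𝓢(EuclideanSpace ℝ (Fin d), ℂ) => ψ (K.windowEquiv.symm x)) h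
  change g (K.windowEquiv (K.windowEquiv.symm x)) = 0 at h1
  rwa [K.windowEquiv.apply_symm_apply] at h1

/-- Every Schwartz window `ψ` is the rescaled window of some `g`, so `V_ψ f` is itself the function
representing `W(f, g)` in the new coordinates. With `h = ψ` this is the self-domination needed for
the Peetre argument. -/
theorem WignerKernel.exists_enorm_stft_le_lintegral_stft (K : WignerKernel U)
    {ψ : 𝓢(EuclideanSpace ℝ (Fin d), ℂ)} (hψ : ψ ≠ 0) (h : 𝓢(EuclideanSpace ℝ (Fin d), ℂ))
    {N : ℝ} (hN : 0 ≤ N) :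
    ∃ C : ℝ≥0∞, C ≠ 0 ∧ C ≠ ⊤ ∧ ∀ (f : 𝓢'(EuclideanSpace ℝ (Fin d), ℂ)) z,
      ‖stft h f z‖ₑ ≤ C * ∫⁻ u, ‖stft ψ f (z - u)‖ₑ * bracket u ^ (-N) := by
  obtain ⟨g, rfl⟩ := K.window_surjective ψ
  have hg : g ≠ 0 := by
    rintro rfl
    exact hψ (map_zero _)
  obtain ⟨C, hC0, hCt, hC⟩ := K.exists_enorm_stft_le_lintegral (coe_schwartz_ne_zero hg) h hN
  have hκ : ENNReal.ofReal K.modulus ≠ 0 := by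
    rw [ne_eq, ENNReal.ofReal_eq_zero, not_le]; exact K.modulus_pos
  refine ⟨C * ENNReal.ofReal K.modulus, mul_ne_zero hC0 hκ,
    ENNReal.mul_ne_top hCt ENNReal.ofReal_ne_top, fun f z => ?_⟩
  refine (hC f (fun z => K.factor z * stft (K.window g) f (K.phaseMap z)) (K.continuous_factor.mul ((continuous_stft _ f).comp
    K.continuous_phaseMap)).measurable (K.isGivenBy_wigner f g) z).trans (le_of_eq ?_)
  rw [mul_assoc, ← lintegral_const_mul' _ _ ENNReal.ofReal_ne_top]
  congr 1
  refine lintegral_congr fun u => ?_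
  rw [enorm_mul, ← ofReal_norm (K.factor _), K.norm_factor, ← K.phaseEquiv_apply,
    LinearEquiv.apply_symm_apply, mul_assoc]

theorem measurable_enorm_weight (s : ℝ) :
    Measurable fun z : EuclideanSpace ℝ (Fin d ⊕ Fin d) => ‖weight s z‖ₑ :=
  (continuous_weight s).measurable.enorm

/-- The modulation space (quasi-)norms of different Schwartz windows are equivalent. -/
theorem WignerKernel.exists_modulationNorm_le (K : WignerKernel U)
    {ψ : 𝓢(EuclideanSpace ℝ (Fin d), ℂ)} (hψ : ψ ≠ 0) (h : 𝓢(EuclideanSpace ℝ (Fin d), ℂ))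
    {p q : ℝ≥0∞} (hp : p ≠ 0) (hq : q ≠ 0) (s : ℝ) :
    ∃ C : ℝ≥0∞, C ≠ ⊤ ∧ ∀ f : 𝓢'(EuclideanSpace ℝ (Fin d), ℂ),
      modulationNorm h p q s f ≤ C * modulationNorm ψ p q s f := by
  -- `r = min(1, p, q)`, so that `p / r` and `q / r` are at least 1.
  obtain ⟨r, hr, hr1, hrp, hrq⟩ : ∃ r : ℝ, 0 < r ∧ r ≤ 1 ∧ ENNReal.ofReal r ≤ p ∧
      ENNReal.ofReal r ≤ q := by
    have h1 : min 1 (min p q) ≠ ⊤ := ne_top_of_le_ne_top ENNReal.one_ne_top (min_le_left _ _)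
    refine ⟨(min 1 (min p q)).toReal, ENNReal.toReal_pos ?_ h1, ?_, ?_, ?_⟩
    · exact (lt_min one_pos (lt_min (pos_iff_ne_zero.2 hp) (pos_iff_ne_zero.2 hq))).ne'
    · exact ENNReal.toReal_le_of_le_ofReal zero_le_one (by simp)
    · rw [ENNReal.ofReal_toReal h1]; exact (min_le_right _ _).trans (min_le_left _ _)
    · rw [ENNReal.ofReal_toReal h1]; exact (min_le_right _ _).trans (min_le_right _ _)
  have hr0 : ENNReal.ofReal r ≠ 0 := by simpa using hr
  set n : ℝ := Module.finrank ℝ (EuclideanSpace ℝ (Fin d ⊕ Fin d)) + 1 with hn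
  have hn0 : 0 < n := by positivity
  -- Chosen so that the `r`-th power of `⟨u⟩^{|s|} ⟨u⟩^{-N}` is `⟨u⟩^{-n}`, integrable since `n`
  -- exceeds the dimension; the part `|s|` pays for moving the weight from `z` to `z - u`.
  set N : ℝ := |s| + n / r with hNdef
  have hN : 0 ≤ N := by positivity
  obtain ⟨C, hC0, hCt, hC⟩ := K.exists_enorm_stft_le_lintegral_stft hψ ψ hN
  obtain ⟨D, hD0, hDt, hD⟩ := K.exists_enorm_stft_le_lintegral_stft hψ h hN
  set c := ENNReal.ofReal (2 ^ (|s| / 2)) with hc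
  set k : EuclideanSpace ℝ (Fin d ⊕ Fin d) → ℝ≥0∞ := fun u => bracket u ^ (-n) with hk
  have hkm : Measurable k := measurable_bracket.pow_const _
  have hkt : ∀ u, k u ≠ ⊤ := fun u =>
    ne_top_of_le_ne_top ENNReal.one_ne_top (bracket_rpow_le_one hn0.le u)
  set A := D ^ r * C ^ (1 - r) * c ^ r with hA
  have hAt : A ≠ ⊤ := by
    refine ENNReal.mul_ne_top (ENNReal.mul_ne_top ?_ ?_) ?_
    · exact ENNReal.rpow_ne_top_of_nonneg hr.le hDt
    · exact ENNReal.rpow_ne_top_of_nonneg (by linarith) hCt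
    · exact ENNReal.rpow_ne_top_of_nonneg hr.le ENNReal.ofReal_ne_top
  have hkint : ∫⁻ u, k u ≠ ⊤ := (lintegral_bracket_rpow_lt_top (by simp [hn])).ne
  refine ⟨(A * ∫⁻ u, k u) ^ (1 / r), ENNReal.rpow_ne_top_of_nonneg (by positivity)
    (ENNReal.mul_ne_top hAt hkint), fun f => ?_⟩
  set H : EuclideanSpace ℝ (Fin d ⊕ Fin d) → ℝ≥0∞ := fun z => ‖weight s z‖ₑ * ‖stft ψ f z‖ₑ
  have hH : Measurable H := (measurable_enorm_weight s).mul (continuous_stft ψ f).measurable.enorm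
  have key : ∀ z, (‖weight s z‖ₑ * ‖stft h f z‖ₑ) ^ r
      ≤ A * ∫⁻ u, k u * (fun v => H v ^ r) (z - u) := by
    intro z
    have h1 := rpow_le_peetreIntegral (μ := volume) (F := fun z => ‖stft ψ f z‖ₑ) hr hr1 hN hC0 hCt
      (hC f) (fun N' hN' => by
        obtain ⟨C', -, hC't, hC'⟩ := K.exists_enorm_stft_le_lintegral_stft hψ ψ hN'
        exact ⟨C', hC't, hC' f⟩) (exists_enorm_stft_le ψ f) hD0 hDt z (hD f z)
    calc (‖weight s z‖ₑ * ‖stft h f z‖ₑ) ^ r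
        ≤ ‖weight s z‖ₑ ^ r * (D ^ r * C ^ (1 - r) *
            ∫⁻ u, (‖stft ψ f (z - u)‖ₑ * bracket u ^ (-N)) ^ r) := by
          rw [ENNReal.mul_rpow_of_nonneg _ _ hr.le]
          gcongr
          exact h1
      _ = D ^ r * C ^ (1 - r) * ∫⁻ u, (‖weight s z‖ₑ *
            (‖stft ψ f (z - u)‖ₑ * bracket u ^ (-N))) ^ r := by
          rw [mul_left_comm, ← lintegral_const_mul' _ _
            (ENNReal.rpow_ne_top_of_nonneg hr.le enorm_ne_top)]
          simp only [ENNReal.mul_rpow_of_nonneg _ _ hr.le]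
      _ ≤ D ^ r * C ^ (1 - r) * ∫⁻ u, c ^ r * (k u * H (z - u) ^ r) := by
          gcongr with u
          have e : k u = (bracket u ^ |s| * bracket u ^ (-N)) ^ r := by
            change bracket u ^ (-n) = _
            rw [← ENNReal.rpow_add _ _ (bracket_ne_zero u) (bracket_ne_top u), ← ENNReal.rpow_mul]
            congr 1
            rw [hNdef]
            field_simp
            ring
          rw [e, ← ENNReal.mul_rpow_of_nonneg _ _ hr.le, ← ENNReal.mul_rpow_of_nonneg _ _ hr.le]
          refine ENNReal.rpow_le_rpow ?_ hr.le
          calc ‖weight s z‖ₑ * (‖stft ψ f (z - u)‖ₑ * bracket u ^ (-N))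
              ≤ (c * bracket u ^ |s| * ‖weight s (z - u)‖ₑ) *
                (‖stft ψ f (z - u)‖ₑ * bracket u ^ (-N)) := by
                gcongr
                refine (enorm_weight_le_mul s z u).trans ?_
                gcongr
                exact enorm_weight_abs_le_bracket s u
            _ = _ := by ring
      _ = _ := by
          rw [lintegral_const_mul' _ _ (ENNReal.rpow_ne_top_of_nonneg hr.le ENNReal.ofReal_ne_top),
            ← mul_assoc]
  have hpr : p / ENNReal.ofReal r * ENNReal.ofReal r = p :=
    ENNReal.div_mul_cancel hr0 ENNReal.ofReal_ne_top
  have hqr : q / ENNReal.ofReal r * ENNReal.ofReal r = q :=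
    ENNReal.div_mul_cancel hr0 ENNReal.ofReal_ne_top
  have hp1 : 1 ≤ p / ENNReal.ofReal r := by
    rw [ENNReal.le_div_iff_mul_le (Or.inl hr0) (Or.inl ENNReal.ofReal_ne_top), one_mul]
    exact hrp
  have hq1 : 1 ≤ q / ENNReal.ofReal r := by
    rw [ENNReal.le_div_iff_mul_le (Or.inl hr0) (Or.inl ENNReal.ofReal_ne_top), one_mul]
    exact hrq
  -- Young's inequality is applied to the `r`-th powers, in the Banach range `(p / r, q / r)`.
  have h2 : mixE p q (fun z => ‖weight s z‖ₑ * ‖stft h f z‖ₑ) ^ r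
      ≤ (A * ∫⁻ u, k u) * mixE p q H ^ r := by
    have e1 := mixE_rpow (p / ENNReal.ofReal r) (q / ENNReal.ofReal r) hr
      (fun z => ‖weight s z‖ₑ * ‖stft h f z‖ₑ)
    have e2 := mixE_rpow (p / ENNReal.ofReal r) (q / ENNReal.ofReal r) hr H
    rw [hpr, hqr] at e1 e2
    rw [← e1, ← e2, mul_assoc]
    refine (mixE_mono _ _ key).trans ?_
    rw [mixE_const_mul _ _ hAt]
    gcongr
    exact mixE_convolution_le hp1 hq1 (hH.pow_const r) hkm hkt measurable_id
  rw [modulationNorm, modulationNorm, mixedNorm_eq_mixE, mixedNorm_eq_mixE]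
  have h3 := ENNReal.rpow_le_rpow h2 (z := 1 / r) (by positivity)
  rw [ENNReal.mul_rpow_of_nonneg _ _ (by positivity : 0 ≤ 1 / r), ← ENNReal.rpow_mul,
    ← ENNReal.rpow_mul, mul_one_div_cancel hr.ne', ENNReal.rpow_one, ENNReal.rpow_one] at h3
  exact h3

theorem exists_mixE_weight_comp_le {p q : ℝ≥0∞} (s : ℝ)
    (T : EuclideanSpace ℝ (Fin d ⊕ Fin d) ≃ₗ[ℝ] EuclideanSpace ℝ (Fin d ⊕ Fin d))
    (hT : ∃ c : ℝ≥0∞, c ≠ 0 ∧ c ≠ ⊤ ∧ ∀ H : EuclideanSpace ℝ (Fin d ⊕ Fin d) → ℝ≥0∞,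
      mixE p q (fun z => H (T z)) = c * mixE p q H) :
    ∃ C : ℝ≥0∞, C ≠ ⊤ ∧ ∀ H : EuclideanSpace ℝ (Fin d ⊕ Fin d) → ℝ≥0∞,
      mixE p q (fun z => ‖weight s z‖ₑ * H (T z))
        ≤ C * mixE p q (fun z => ‖weight s z‖ₑ * H z) := by
  obtain ⟨c, -, hct, hc⟩ := hT
  obtain ⟨b, -, hbt, hb⟩ := exists_enorm_weight_le_comp s T
  refine ⟨b * c, ENNReal.mul_ne_top hbt hct, fun H => ?_⟩
  calc mixE p q (fun z => ‖weight s z‖ₑ * H (T z))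
      ≤ mixE p q (fun z => b * (‖weight s (T z)‖ₑ * H (T z))) := by
        refine mixE_mono _ _ fun z => ?_
        rw [← mul_assoc]
        gcongr
        exact (hb z).1
    _ = _ := by
        rw [mixE_const_mul _ _ hbt, hc (fun z => ‖weight s z‖ₑ * H z), mul_assoc]

/-- Test on a bump function equal to 1 near the given point. This yields uniqueness of the
representing function, so that the infimum defining the norm of a distribution is attained by any
representative. -/
theorem IsGivenBy.locallyIntegrable {T : 𝓢'(EuclideanSpace ℝ (Fin d ⊕ Fin d), ℂ)}
    {F : EuclideanSpace ℝ (Fin d ⊕ Fin d) → ℂ} (hF : IsGivenBy T F) : LocallyIntegrable F := by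
  intro a
  let b : ContDiffBump a := ⟨1, 2, one_pos, one_lt_two⟩
  have h1 : HasCompactSupport fun x => ((b x : ℝ) : ℂ) :=
    b.hasCompactSupport.comp_left (g := fun r : ℝ => (r : ℂ)) (by simp)
  have h2 : ContDiff ℝ ∞ fun x => ((b x : ℝ) : ℂ) := Complex.ofRealCLM.contDiff.comp b.contDiff
  have h3 := (hF.2 (h1.toSchwartzMap h2)).1
  refine ⟨Metric.closedBall a 1, Metric.closedBall_mem_nhds a one_pos, ?_⟩
  refine (h3.integrableOn (s := Metric.closedBall a 1)).congr_fun (fun z hz => ?_)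
    measurableSet_closedBall
  change ((b z : ℝ) : ℂ) * F z = F z
  rw [b.one_of_mem_closedBall hz]
  simp

theorem IsGivenBy.ae_eq {T : 𝓢'(EuclideanSpace ℝ (Fin d ⊕ Fin d), ℂ)}
    {F G : EuclideanSpace ℝ (Fin d ⊕ Fin d) → ℂ} (hF : IsGivenBy T F) (hG : IsGivenBy T G) :
    F =ᵐ[volume] G :=
  ae_eq_of_integral_mul_schwartz_eq hF.locallyIntegrable hG.locallyIntegrable fun φ =>
    (hF.2 φ).2.symm.trans (hG.2 φ).2

theorem IsGivenBy.congr {T : 𝓢'(EuclideanSpace ℝ (Fin d ⊕ Fin d), ℂ)}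
    {F G : EuclideanSpace ℝ (Fin d ⊕ Fin d) → ℂ} (hF : IsGivenBy T F) (h : F =ᵐ[volume] G) :
    IsGivenBy T G := by
  refine ⟨hF.1.congr h, fun Φ => ?_⟩
  have e : (fun z => Φ z * F z) =ᵐ[volume] fun z => Φ z * G z := by
    filter_upwards [h] with z hz
    rw [hz]
  exact ⟨(hF.2 Φ).1.congr e, (hF.2 Φ).2.trans (integral_congr_ae e)⟩

theorem mixedNorm_congr_ae {p q : ℝ≥0∞} {s : ℝ} {F G : EuclideanSpace ℝ (Fin d ⊕ Fin d) → ℂ}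
    (h : F =ᵐ[volume] G) : mixedNorm p q s F = mixedNorm p q s G := by
  rw [mixedNorm_eq_mixE, mixedNorm_eq_mixE]
  refine le_antisymm (mixE_mono_ae p q ?_) (mixE_mono_ae p q ?_) <;>
  · filter_upwards [h] with z hz
    rw [hz]

/-- The lower bound is required for every representing function, the upper bound only for `f` in the
modulation space. Elsewhere the upper bound is trivial, because the common constant is non-zero and
so its product with `⊤` is `⊤`. -/
theorem memModulation_iff_and_equivalence {p q : ℝ≥0∞} {s : ℝ}
    {φ : 𝓢(EuclideanSpace ℝ (Fin d), ℂ)}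
    {W : 𝓢'(EuclideanSpace ℝ (Fin d), ℂ) → 𝓢'(EuclideanSpace ℝ (Fin d ⊕ Fin d), ℂ)}
    {C₁ C₂ : ℝ≥0∞} (hC₁ : C₁ ≠ ⊤) (hC₂ : C₂ ≠ ⊤)
    (h₁ : ∀ f F, IsGivenBy (W f) F → modulationNorm φ p q s f ≤ C₁ * mixedNorm p q s F)
    (h₂ : ∀ f, modulationNorm φ p q s f < ⊤ →
      distMixedNorm p q s (W f) ≤ C₂ * modulationNorm φ p q s f) :
    (∀ f, MemModulation φ p q s f ↔ MemMixed p q s (W f)) ∧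
    ∃ C : NNReal, 0 < C ∧ ∀ f, modulationNorm φ p q s f ≤ C * distMixedNorm p q s (W f) ∧
      distMixedNorm p q s (W f) ≤ C * modulationNorm φ p q s f := by
  have hmem : ∀ f, MemMixed p q s (W f) ↔ distMixedNorm p q s (W f) < ⊤ := by
    intro f
    simp only [distMixedNorm, iInf_lt_iff, MemMixed, exists_prop]
  set C : NNReal := C₁.toNNReal + C₂.toNNReal + 1 with hC
  have hC1 : C₁ ≤ C := by
    rw [← ENNReal.coe_toNNReal hC₁, hC]
    exact_mod_cast le_add_right le_self_add
  have hC2 : C₂ ≤ C := by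
    rw [← ENNReal.coe_toNNReal hC₂, hC]
    exact_mod_cast le_add_right le_add_self
  have hC0 : 0 < C := by positivity
  have b₁ : ∀ f, modulationNorm φ p q s f ≤ C * distMixedNorm p q s (W f) := by
    intro f
    have hC0' : (C : ℝ≥0∞) ≠ 0 := by exact_mod_cast hC0.ne'
    rw [← ENNReal.div_le_iff' hC0' ENNReal.coe_ne_top]
    refine le_iInf₂ fun F hF => ?_
    rw [ENNReal.div_le_iff' hC0' ENNReal.coe_ne_top]
    refine (h₁ f F hF).trans ?_
    gcongr
  have b₂ : ∀ f, distMixedNorm p q s (W f) ≤ C * modulationNorm φ p q s f := by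
    intro f
    rcases (le_top (a := modulationNorm φ p q s f)).lt_or_eq with h | h
    · refine (h₂ f h).trans ?_
      gcongr
    · rw [h, ENNReal.mul_top (by exact_mod_cast hC0.ne')]
      exact le_top
  refine ⟨fun f => ?_, C, hC0, fun f => ⟨b₁ f, b₂ f⟩⟩
  rw [hmem, MemModulation]
  exact ⟨fun h => (b₂ f).trans_lt (ENNReal.mul_lt_top ENNReal.coe_lt_top h),
    fun h => (b₁ f).trans_lt (ENNReal.mul_lt_top ENNReal.coe_lt_top h)⟩

/-- The representing function is explicit, so its norm is comparable to the modulation norm with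
window `K.window g`; changing this window to `φ` and back gives the two bounds. -/
theorem WignerKernel.schwartz_window (K : WignerKernel U) {p q : ℝ≥0∞} (hp : p ≠ 0) (hq : q ≠ 0)
    (s : ℝ) {φ g : 𝓢(EuclideanSpace ℝ (Fin d), ℂ)} (hφ : φ ≠ 0) (hg : g ≠ 0) :
    (∀ f, MemModulation φ p q s f ↔
      MemMixed p q s (wigner U f (g : 𝓢'(EuclideanSpace ℝ (Fin d), ℂ)))) ∧
    ∃ C : NNReal, 0 < C ∧ ∀ f, modulationNorm φ p q s f ≤
        C * distMixedNorm p q s (wigner U f (g : 𝓢'(EuclideanSpace ℝ (Fin d), ℂ))) ∧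
      distMixedNorm p q s (wigner U f (g : 𝓢'(EuclideanSpace ℝ (Fin d), ℂ))) ≤
        C * modulationNorm φ p q s f := by
  have hκ : ENNReal.ofReal K.modulus ≠ 0 := by
    rw [ne_eq, ENNReal.ofReal_eq_zero, not_le]; exact K.modulus_pos
  obtain ⟨a, hat, ha⟩ := K.exists_modulationNorm_le (K.window_ne_zero hg) φ hp hq s
  obtain ⟨b, hbt, hb⟩ := K.exists_modulationNorm_le hφ (K.window g) hp hq s
  obtain ⟨c, hct, hc⟩ := exists_mixE_weight_comp_le s K.phaseEquiv (K.exists_mixE_comp_phaseMap p q)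
  obtain ⟨c', hct', hc'⟩ := exists_mixE_weight_comp_le s K.phaseEquiv.symm
    (K.exists_mixE_comp_phaseEquiv_symm p q)
  have e : ∀ f, mixedNorm p q s (fun z => K.factor z * stft (K.window g) f (K.phaseMap z))
      = ENNReal.ofReal K.modulus *
        mixE p q (fun z => ‖weight s z‖ₑ * ‖stft (K.window g) f (K.phaseEquiv z)‖ₑ) := by
    intro f
    rw [mixedNorm_eq_mixE, ← mixE_const_mul _ _ ENNReal.ofReal_ne_top]
    congr 1
    funext z
    rw [enorm_mul, ← ofReal_norm (K.factor z), K.norm_factor, K.phaseEquiv_apply]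
    ring
  refine memModulation_iff_and_equivalence (C₁ := a * c' / ENNReal.ofReal K.modulus)
    (C₂ := ENNReal.ofReal K.modulus * c * b)
    (ENNReal.div_ne_top (ENNReal.mul_ne_top hat hct') hκ)
    (ENNReal.mul_ne_top (ENNReal.mul_ne_top ENNReal.ofReal_ne_top hct) hbt)
    (fun f F hF => ?_) (fun f _ => ?_)
  · rw [mixedNorm_congr_ae (hF.ae_eq (K.isGivenBy_wigner f g)), e, ← mul_assoc,
      ENNReal.div_mul_cancel hκ ENNReal.ofReal_ne_top, mul_assoc]
    refine (ha f).trans ?_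
    gcongr
    rw [modulationNorm, mixedNorm_eq_mixE]
    simpa only [LinearEquiv.apply_symm_apply] using
      hc' fun v => ‖stft (K.window g) f (K.phaseEquiv v)‖ₑ
  · refine (iInf₂_le _ (K.isGivenBy_wigner f g)).trans ?_
    rw [e, mul_assoc, mul_assoc]
    gcongr
    refine (hc fun z => ‖stft (K.window g) f z‖ₑ).trans ?_
    gcongr
    rw [← mixedNorm_eq_mixE]
    exact hb f

end WindowIndependence

/-! ### Lower bound for general windows; Moyal's relation and the inversion formula. -/

section Inversion

variable {d : ℕ}
  {U : 𝓢(EuclideanSpace ℝ (Fin d ⊕ Fin d), ℂ) ≃L[ℂ] 𝓢(EuclideanSpace ℝ (Fin d ⊕ Fin d), ℂ)}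

/-- The pointwise convolution bound followed by Young's inequality. The decay `|s| + n` leaves the
integrable kernel `⟨u⟩^{-n}` once the weight has been moved under the integral. -/
theorem WignerKernel.exists_modulationNorm_le_mixedNorm (K : WignerKernel U)
    {g : 𝓢'(EuclideanSpace ℝ (Fin d), ℂ)} (hg : g ≠ 0) (φ : 𝓢(EuclideanSpace ℝ (Fin d), ℂ))
    {p q : ℝ≥0∞} (hp : 1 ≤ p) (hq : 1 ≤ q) (s : ℝ) :
    ∃ C : ℝ≥0∞, C ≠ ⊤ ∧ ∀ (f : 𝓢'(EuclideanSpace ℝ (Fin d), ℂ)) F, IsGivenBy (wigner U f g) F →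
      modulationNorm φ p q s f ≤ C * mixedNorm p q s F := by
  set n : ℝ := Module.finrank ℝ (EuclideanSpace ℝ (Fin d ⊕ Fin d)) + 1 with hn
  have hn0 : 0 < n := by positivity
  obtain ⟨C, -, hCt, hC⟩ := K.exists_enorm_stft_le_lintegral hg φ (N := |s| + n) (by positivity)
  obtain ⟨c', hct', hc'⟩ := exists_mixE_weight_comp_le s K.phaseEquiv.symm
    (K.exists_mixE_comp_phaseEquiv_symm p q)
  set c := ENNReal.ofReal (2 ^ (|s| / 2)) with hc
  have hct : c ≠ ⊤ := ENNReal.ofReal_ne_top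
  set k : EuclideanSpace ℝ (Fin d ⊕ Fin d) → ℝ≥0∞ := fun u => bracket u ^ (-n) with hk
  have hkm : Measurable k := measurable_bracket.pow_const _
  have hkt : ∀ u, k u ≠ ⊤ := fun u =>
    ne_top_of_le_ne_top ENNReal.one_ne_top (bracket_rpow_le_one hn0.le u)
  have hkint : ∫⁻ u, k u ≠ ⊤ := (lintegral_bracket_rpow_lt_top (by simp [hn])).ne
  refine ⟨C * c * ((∫⁻ u, k u) * c'), ENNReal.mul_ne_top (ENNReal.mul_ne_top hCt hct)
    (ENNReal.mul_ne_top hkint hct'), fun f F₀ hF₀ => ?_⟩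
  -- A measurable representative, as the pointwise bound requires; neither the distribution nor the
  -- norm changes.
  obtain ⟨F, hFm, hF, hFF⟩ : ∃ F, Measurable F ∧ IsGivenBy (wigner U f g) F ∧
      mixedNorm p q s F₀ = mixedNorm p q s F :=
    ⟨hF₀.1.mk F₀, hF₀.1.stronglyMeasurable_mk.measurable, hF₀.congr hF₀.1.ae_eq_mk,
      mixedNorm_congr_ae hF₀.1.ae_eq_mk⟩
  rw [hFF]
  set H : EuclideanSpace ℝ (Fin d ⊕ Fin d) → ℝ≥0∞ := fun z =>
    ‖weight s z‖ₑ * ‖F (K.phaseEquiv.symm z)‖ₑ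
  have hH : Measurable H := (measurable_enorm_weight s).mul
    (hFm.comp K.continuous_phaseEquiv_symm.measurable).enorm
  have key : ∀ z, ‖weight s z‖ₑ * ‖stft φ f z‖ₑ ≤ C * c * ∫⁻ u, k u * H (z - u) := by
    intro z
    calc ‖weight s z‖ₑ * ‖stft φ f z‖ₑ
        ≤ ‖weight s z‖ₑ * (C * ∫⁻ u, ‖F (K.phaseEquiv.symm (z - u))‖ₑ *
            bracket u ^ (-(|s| + n))) := by gcongr; exact hC f F hFm hF z
      _ = C * ∫⁻ u, ‖weight s z‖ₑ * (‖F (K.phaseEquiv.symm (z - u))‖ₑ *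
            bracket u ^ (-(|s| + n))) := by
          rw [mul_left_comm, ← lintegral_const_mul' _ _ enorm_ne_top]
      _ ≤ C * ∫⁻ u, c * (k u * H (z - u)) := by
          gcongr C * ?_
          refine lintegral_mono fun u => ?_
          simp only
          have e : k u = bracket u ^ |s| * bracket u ^ (-(|s| + n)) := by
            rw [← ENNReal.rpow_add _ _ (bracket_ne_zero u) (bracket_ne_top u)]
            change bracket u ^ (-n) = _
            congr 1
            ring
          rw [e]
          calc ‖weight s z‖ₑ * (‖F (K.phaseEquiv.symm (z - u))‖ₑ * bracket u ^ (-(|s| + n)))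
              ≤ (c * bracket u ^ |s| * ‖weight s (z - u)‖ₑ) *
                (‖F (K.phaseEquiv.symm (z - u))‖ₑ * bracket u ^ (-(|s| + n))) := by
                gcongr
                refine (enorm_weight_le_mul s z u).trans ?_
                gcongr
                exact enorm_weight_abs_le_bracket s u
            _ = _ := by ring
      _ = _ := by rw [lintegral_const_mul' _ _ hct, mul_assoc]
  rw [modulationNorm, mixedNorm_eq_mixE, mixedNorm_eq_mixE]
  refine (mixE_mono _ _ key).trans ?_
  rw [mixE_const_mul _ _ (ENNReal.mul_ne_top hCt hct), mul_assoc (C * c),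
    mul_assoc (∫⁻ u, k u)]
  gcongr
  refine (mixE_convolution_le hp hq hH hkm hkt measurable_id).trans ?_
  gcongr
  exact hc' fun z => ‖F z‖ₑ

theorem WignerKernel.integrable_norm_stft_mul (K : WignerKernel U)
    (ψ h : 𝓢(EuclideanSpace ℝ (Fin d), ℂ)) {b : EuclideanSpace ℝ (Fin d ⊕ Fin d) → ℝ}
    (hb : AEStronglyMeasurable b) {k : ℕ} {C : ℝ} (hbC : ∀ z, ‖b z‖ ≤ C * (1 + ‖z‖) ^ k) :
    Integrable fun v => ‖stft ψ (h : 𝓢'(EuclideanSpace ℝ (Fin d), ℂ)) v‖ * b v := by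
  refine ⟨(continuous_stft ψ _).norm.aestronglyMeasurable.mul hb, ?_⟩
  set n : ℝ := Module.finrank ℝ (EuclideanSpace ℝ (Fin d ⊕ Fin d)) + 1 with hn
  obtain ⟨B, hBt, hB⟩ := K.exists_enorm_stft_schwartz_le ψ h (N := k + n) (by positivity)
  have hC : 0 ≤ C := by
    have := (norm_nonneg _).trans (hbC 0)
    simpa using this
  rw [HasFiniteIntegral]
  calc ∫⁻ v, ‖‖stft ψ (h : 𝓢'(EuclideanSpace ℝ (Fin d), ℂ)) v‖ * b v‖ₑ
      ≤ ∫⁻ v, (B * ENNReal.ofReal C) * bracket v ^ (-n) := by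
        refine lintegral_mono fun v => ?_
        rw [enorm_mul, enorm_norm]
        have h1 : ‖b v‖ₑ ≤ ENNReal.ofReal C * bracket v ^ (k : ℝ) := by
          rw [← ofReal_norm, bracket, ENNReal.rpow_natCast, ← ENNReal.ofReal_pow (by positivity),
            ← ENNReal.ofReal_mul hC]
          exact ENNReal.ofReal_le_ofReal (hbC v)
        have e : bracket v ^ (-n) = bracket v ^ (-(k + n)) * bracket v ^ (k : ℝ) := by
          rw [← ENNReal.rpow_add _ _ (bracket_ne_zero v) (bracket_ne_top v)]
          congr 1
          ring
        rw [e]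
        calc _ ≤ B * bracket v ^ (-(k + n)) * (ENNReal.ofReal C * bracket v ^ (k : ℝ)) :=
              mul_le_mul' (hB v) h1
          _ = _ := by ring
    _ = (B * ENNReal.ofReal C) * ∫⁻ v : EuclideanSpace ℝ (Fin d ⊕ Fin d), bracket v ^ (-n) :=
        lintegral_const_mul' _ _ (ENNReal.mul_ne_top hBt ENNReal.ofReal_ne_top)
    _ < ⊤ := ENNReal.mul_lt_top (ENNReal.mul_lt_top hBt.lt_top ENNReal.ofReal_lt_top)
        (lintegral_bracket_rpow_lt_top (by simp [hn]))

theorem WignerKernel.integrable_stft (K : WignerKernel U)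
    (ψ h : 𝓢(EuclideanSpace ℝ (Fin d), ℂ)) :
    Integrable (stft ψ (h : 𝓢'(EuclideanSpace ℝ (Fin d), ℂ))) := by
  have h1 := K.integrable_norm_stft_mul ψ h (b := fun _ => 1) aestronglyMeasurable_const
    (k := 0) (C := 1) (by simp)
  simp only [mul_one] at h1
  exact (integrable_norm_iff (continuous_stft ψ _).aestronglyMeasurable).1 h1

theorem integrable_mul_schwartz {V : Type} [NormedAddCommGroup V] [InnerProductSpace ℝ V]
    [FiniteDimensional ℝ V] [MeasurableSpace V] [BorelSpace V] (Φ Ψ : 𝓢(V, ℂ)) :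
    Integrable fun x => Φ x * Ψ x :=
  Φ.integrable.mul_bdd (c := SchwartzMap.seminorm ℝ 0 0 Ψ) Ψ.continuous.aestronglyMeasurable
    (Filter.Eventually.of_forall fun z => norm_le_seminorm ℝ _ z)

/-- Moyal's orthogonality relation. -/
theorem WignerKernel.exists_moyal (K : WignerKernel U) {φ : 𝓢(EuclideanSpace ℝ (Fin d), ℂ)}
    (hφ : φ ≠ 0) :
    ∃ m : ℂ, m ≠ 0 ∧ ∀ a b : 𝓢(EuclideanSpace ℝ (Fin d), ℂ),
      ∫ v, (starRingEnd ℂ) (stft φ (a : 𝓢'(EuclideanSpace ℝ (Fin d), ℂ)) v) *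
        stft φ (b : 𝓢'(EuclideanSpace ℝ (Fin d), ℂ)) v
      = m * ∫ x, (starRingEnd ℂ) (a x) * b x := by
  obtain ⟨g, rfl⟩ := K.window_surjective φ
  have hg : g ≠ 0 := by
    rintro rfl
    exact hφ (map_zero _)
  obtain ⟨c, hc, hint⟩ := exists_integral_comp_equiv K.phaseEquiv.toContinuousLinearEquiv
  set I : ℂ := ∫ y, (starRingEnd ℂ) (g y) * g y with hI
  have hI0 : I ≠ 0 := by
    rw [hI, ← inner_toLp_eq_integral, inner_self_ne_zero]
    intro h
    exact hg ((injective_toLp 2 volume) (h.trans (map_zero (toLpCLM ℂ ℂ 2 volume)).symm))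
  have hκ : (K.modulus : ℂ) ≠ 0 := by exact_mod_cast K.modulus_pos.ne'
  have hc' : (c : ℂ) ≠ 0 := by exact_mod_cast hc.ne'
  -- The isometry `U` preserves the inner product of `a ⊗ ḡ` and `b ⊗ ḡ`: without `U` it is `I`
  -- times that of `a` and `b`, with `U` it is the integral on the left times `modulus²` and the
  -- Jacobian `c`.
  refine ⟨I / (K.modulus ^ 2 * c), div_ne_zero hI0 (by positivity), fun a b => ?_⟩
  have h1 := integral_conj_mul_of_isometry K.isometry (tensorSchwartz a (conjSchwartz g))
    (tensorSchwartz b (conjSchwartz g))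
  have h2 : ∫ z, (starRingEnd ℂ) (tensorSchwartz a (conjSchwartz g) z) *
      tensorSchwartz b (conjSchwartz g) z = I * ∫ x, (starRingEnd ℂ) (a x) * b x := by
    have h20 : Integrable fun z => (starRingEnd ℂ) (tensorSchwartz a (conjSchwartz g) z) *
        tensorSchwartz b (conjSchwartz g) z := integrable_mul_schwartz
      (conjSchwartz (tensorSchwartz a (conjSchwartz g))) (tensorSchwartz b (conjSchwartz g))
    rw [integral_eq_integral_pair h20, ← integral_const_mul]
    refine integral_congr_ae (Filter.Eventually.of_forall fun x => ?_)
    simp only [tensorSchwartz_apply, fstPart_pair, sndPart_pair, conjSchwartz_apply, map_mul,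
      Complex.conj_conj]
    rw [hI, ← integral_mul_const]
    refine integral_congr_ae (Filter.Eventually.of_forall fun y => ?_)
    simp only
    ring
  have h3 : ∫ z, (starRingEnd ℂ) (U (tensorSchwartz a (conjSchwartz g)) z) *
      U (tensorSchwartz b (conjSchwartz g)) z = K.modulus ^ 2 * c *
      ∫ v, (starRingEnd ℂ) (stft (K.window g) (a : 𝓢'(EuclideanSpace ℝ (Fin d), ℂ)) v) *
        stft (K.window g) (b : 𝓢'(EuclideanSpace ℝ (Fin d), ℂ)) v := by
    rw [mul_assoc, ← hint (fun v => (starRingEnd ℂ) (stft (K.window g)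
      (a : 𝓢'(EuclideanSpace ℝ (Fin d), ℂ)) v) *
        stft (K.window g) (b : 𝓢'(EuclideanSpace ℝ (Fin d), ℂ)) v), ← integral_const_mul]
    refine integral_congr_ae (Filter.Eventually.of_forall fun z => ?_)
    have h4 : (starRingEnd ℂ) (K.factor z) * K.factor z = K.modulus ^ 2 := by
      rw [Complex.conj_mul', K.norm_factor]
    change (starRingEnd ℂ) (wignerSchwartz U a g z) * wignerSchwartz U b g z
      = K.modulus ^ 2 * ((starRingEnd ℂ) (stft (K.window g) (a : 𝓢'(EuclideanSpace ℝ (Fin d), ℂ))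
        (K.phaseMap z)) * stft (K.window g) (b : 𝓢'(EuclideanSpace ℝ (Fin d), ℂ)) (K.phaseMap z))
    rw [K.wigner_eq_stft, K.wigner_eq_stft, map_mul, ← h4]
    ring
  rw [h2, h3] at h1
  rw [div_mul_eq_mul_div, ← h1, mul_div_cancel_left₀ _ (by positivity)]

theorem continuous_conjSchwartz_timeFreqShift (φ : 𝓢(EuclideanSpace ℝ (Fin d), ℂ)) :
    Continuous fun w : EuclideanSpace ℝ (Fin d ⊕ Fin d) => conjSchwartz (timeFreqShift w φ) := by
  have h1 : Continuous fun z : EuclideanSpace ℝ (Fin d ⊕ Fin d) => timeFreqShift z φ :=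
    Continuous.comp (g := fun z : EuclideanSpace ℝ (Fin d ⊕ Fin d) ×
        𝓢(EuclideanSpace ℝ (Fin d), ℂ) => timeFreqShift z.1 z.2)
      (f := fun z => (z, φ)) continuous_timeFreqShift (Continuous.prodMk_left φ)
  exact conjSchwartz.continuous.comp h1

theorem continuous_conjSchwartz_timeFreqShift_apply (φ : 𝓢(EuclideanSpace ℝ (Fin d), ℂ)) :
    Continuous fun z : EuclideanSpace ℝ (Fin d ⊕ Fin d) × EuclideanSpace ℝ (Fin d) =>
      conjSchwartz (timeFreqShift z.1 φ) z.2 := by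
  simp only [conjSchwartz_apply, timeFreqShift_apply]
  refine Complex.continuous_conj.comp (Continuous.mul ?_ ?_)
  · exact continuous_character.comp ((continuous_sndPart.comp continuous_fst).prodMk continuous_snd)
  · exact φ.continuous.comp (continuous_snd.sub (continuous_fstPart.comp continuous_fst))

theorem norm_conjSchwartz_timeFreqShift_le (φ : 𝓢(EuclideanSpace ℝ (Fin d), ℂ))
    (w : EuclideanSpace ℝ (Fin d ⊕ Fin d)) (t : EuclideanSpace ℝ (Fin d)) :
    ‖conjSchwartz (timeFreqShift w φ) t‖ ≤ SchwartzMap.seminorm ℝ 0 0 φ := by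
  rw [conjSchwartz_apply, RCLike.norm_conj, timeFreqShift_apply, norm_mul, norm_character, one_mul]
  exact norm_le_seminorm ℝ _ _

/-- The inversion formula for the short-time Fourier transform. -/
theorem WignerKernel.exists_inversion (K : WignerKernel U) {φ : 𝓢(EuclideanSpace ℝ (Fin d), ℂ)}
    (hφ : φ ≠ 0) :
    ∃ m : ℂ, m ≠ 0 ∧ ∀ (g : 𝓢'(EuclideanSpace ℝ (Fin d), ℂ)) (ψ : 𝓢(EuclideanSpace ℝ (Fin d), ℂ)),
      g ψ = m * ∫ w, (starRingEnd ℂ) (stft φ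
        (conjSchwartz ψ : 𝓢'(EuclideanSpace ℝ (Fin d), ℂ)) w) * stft φ g w := by
  obtain ⟨m, hm, hM⟩ := K.exists_moyal hφ
  refine ⟨m⁻¹, inv_ne_zero hm, fun g ψ => ?_⟩
  set c : EuclideanSpace ℝ (Fin d ⊕ Fin d) → ℂ := fun w => m⁻¹ * (starRingEnd ℂ) (stft φ
    (conjSchwartz ψ : 𝓢'(EuclideanSpace ℝ (Fin d), ℂ)) w) with hc
  have hcc : Continuous c := continuous_const.mul
    (Complex.continuous_conj.comp (continuous_stft φ _))
  have hcn : ∀ w, ‖c w‖ = ‖m⁻¹‖ * ‖stft φ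
      (conjSchwartz ψ : 𝓢'(EuclideanSpace ℝ (Fin d), ℂ)) w‖ := fun w => by
    rw [hc, norm_mul, RCLike.norm_conj]
  have hci : Integrable c := by
    refine ((K.integrable_stft φ (conjSchwartz ψ)).norm.const_mul ‖m⁻¹‖).mono'
      hcc.aestronglyMeasurable (Filter.Eventually.of_forall fun w => (hcn w).le)
  have hκc := continuous_conjSchwartz_timeFreqShift φ
  -- Moyal's relation with `conj ψ` as one entry and an arbitrary Schwartz function as the other is
  -- the weak form of this expansion; both sides are continuous, so it holds pointwise. Then `g` is
  -- applied under the integral.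
  have hψ : (ψ : EuclideanSpace ℝ (Fin d) → ℂ)
      = fun y => ∫ w, c w * conjSchwartz (timeFreqShift w φ) y := by
    refine eq_of_integral_mul_schwartz_eq ψ.continuous ?_ fun h => ?_
    · refine continuous_of_dominated (bound := fun z => ‖c z‖ * SchwartzMap.seminorm ℝ 0 0 φ)
        (fun x => ?_) (fun x => ?_) (hci.norm.mul_const _) ?_
      · exact (hcc.mul ((continuous_schwartz_apply x).comp hκc)).aestronglyMeasurable
      · refine Filter.Eventually.of_forall fun z => ?_
        rw [norm_mul]
        gcongr
        exact norm_conjSchwartz_timeFreqShift_le φ z x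
      · exact Filter.Eventually.of_forall fun z => continuous_const.mul (SchwartzMap.continuous _)
    · have h1 := hM (conjSchwartz ψ) h
      simp only [conjSchwartz_apply, Complex.conj_conj] at h1
      have h2 : ∫ x, h x * ψ x = m⁻¹ * (m * ∫ x, ψ x * h x) := by
        rw [inv_mul_cancel_left₀ hm]
        simp only [mul_comm]
      rw [h2, ← h1, ← integral_const_mul]
      have h3 : ∀ w, m⁻¹ * ((starRingEnd ℂ) (stft φ
          (conjSchwartz ψ : 𝓢'(EuclideanSpace ℝ (Fin d), ℂ)) w) *
          stft φ (h : 𝓢'(EuclideanSpace ℝ (Fin d), ℂ)) w)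
          = ∫ t, c w * (h t * conjSchwartz (timeFreqShift w φ) t) := by
        intro w
        rw [integral_const_mul, hc, ← mul_assoc, stft, stft, coe_schwartz_apply h]
        simp only [mul_comm (h _)]
        rfl
      simp only [h3]
      rw [integral_integral_swap]
      · refine integral_congr_ae (Filter.Eventually.of_forall fun t => ?_)
        simp only
        rw [← integral_const_mul]
        refine integral_congr_ae (Filter.Eventually.of_forall fun z => ?_)
        simp only
        ring
      · have h4 : Integrable (fun p : EuclideanSpace ℝ (Fin d ⊕ Fin d) ×
            EuclideanSpace ℝ (Fin d) => c p.1 * h p.2) (volume.prod volume) :=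
          hci.mul_prod h.integrable
        have h6 := h4.mul_bdd (c := SchwartzMap.seminorm ℝ 0 0 φ)
          (continuous_conjSchwartz_timeFreqShift_apply φ).aestronglyMeasurable
          (Filter.Eventually.of_forall fun p => norm_conjSchwartz_timeFreqShift_le φ p.1 p.2)
        refine h6.congr (Filter.Eventually.of_forall fun p => ?_)
        simp only [Function.uncurry]
        ring
  have key := (tempered_apply_eq_integral g hcc.aestronglyMeasurable hκc (μ := volume)
    (fun k n => ?_) (fun x => congrFun hψ x)).2
  · rw [key, ← integral_const_mul]
    refine integral_congr_ae (Filter.Eventually.of_forall fun w => ?_)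
    simp only [hc, mul_assoc]
    rfl
  · obtain ⟨N, q', hq', hq⟩ := exists_seminorm_timeFreqShift_le
      (SchwartzMap.seminorm ℂ k n) ((schwartz_withSeminorms ℂ _ ℂ).continuous_seminorm (k, n))
    have h1 := (K.integrable_norm_stft_mul φ (conjSchwartz ψ) (b := fun w =>
      SchwartzMap.seminorm ℝ k n (conjSchwartz (timeFreqShift w φ))) (k := N) (C := q' φ)
      ?_ ?_).const_mul ‖m⁻¹‖
    · refine h1.congr (Filter.Eventually.of_forall fun z => ?_)
      simp only [hcn]
      ring
    · exact (((schwartz_withSeminorms ℝ _ ℂ).continuous_seminorm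
        (k, n)).comp hκc).aestronglyMeasurable
    · intro z
      rw [Real.norm_of_nonneg (apply_nonneg _ _), mul_comm]
      exact (seminorm_conjSchwartz k n _).trans (hq _ _)

end Inversion

/-! ### Dependence of slices of Schwartz functions on the frozen variable. -/

section Slices

variable {d : ℕ}

/-- Freezing the first variable at `x` is freezing it at `0` after a translation, so continuity of
translation suffices. -/
theorem continuous_slice (Φ : 𝓢(EuclideanSpace ℝ (Fin d ⊕ Fin d), ℂ)) :
    Continuous fun x : EuclideanSpace ℝ (Fin d) => slice x Φ := by
  have h1 : ∀ x : EuclideanSpace ℝ (Fin d),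
      slice x Φ = slice 0 (compSubConstCLM ℂ (-(inlL d x)) Φ) := by
    intro x
    ext y
    rw [slice_apply, slice_apply, compSubConstCLM_apply, pair_eq, pair_eq, map_zero]
    congr 1
    abel
  simp only [h1]
  have h2 : Continuous fun x : EuclideanSpace ℝ (Fin d) => compSubConstCLM ℂ (-(inlL d x)) Φ :=
    Continuous.comp (g := fun z : EuclideanSpace ℝ (Fin d ⊕ Fin d) ×
        𝓢(EuclideanSpace ℝ (Fin d ⊕ Fin d), ℂ) => compSubConstCLM ℂ z.1 z.2)
      (f := fun x => (-(inlL d x), Φ)) continuous_compSubConst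
      ((Continuous.prodMk_left Φ).comp (inlL d).continuous.neg)
  exact (slice 0).continuous.comp h2

theorem integrable_seminorm_slice (Φ : 𝓢(EuclideanSpace ℝ (Fin d ⊕ Fin d), ℂ)) (k n : ℕ) :
    Integrable fun x : EuclideanSpace ℝ (Fin d) => SchwartzMap.seminorm ℝ k n (slice x Φ) := by
  have h1 := integrable_of_le_of_pow_mul_le (μ := (volume : Measure (EuclideanSpace ℝ (Fin d))))
    (f := fun x => SchwartzMap.seminorm ℝ k n (slice x Φ)) (k := 0)
    (C₁ := SchwartzMap.seminorm ℝ (0 + k) n Φ)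
    (C₂ := SchwartzMap.seminorm ℝ (0 + (volume : Measure
      (EuclideanSpace ℝ (Fin d))).integrablePower + k) n Φ)
    (fun x => ?_) (fun x => ?_) ?_
  · simpa only [pow_zero, one_mul, Real.norm_of_nonneg (apply_nonneg _ _)] using h1
  · rw [Real.norm_of_nonneg (apply_nonneg _ _)]
    simpa using pow_mul_slice_le x Φ 0 (k, n)
  · rw [Real.norm_of_nonneg (apply_nonneg _ _)]
    exact pow_mul_slice_le x Φ _ (k, n)
  · exact (((schwartz_withSeminorms ℝ _ ℂ).continuous_seminorm
      (k, n)).comp (continuous_slice Φ)).aestronglyMeasurable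

/-- The exchange of the two blocks of a Schwartz function. -/
def swapSchwartz : 𝓢(EuclideanSpace ℝ (Fin d ⊕ Fin d), ℂ) →L[ℂ]
    𝓢(EuclideanSpace ℝ (Fin d ⊕ Fin d), ℂ) :=
  compCLMOfContinuousLinearEquiv ℂ (LinearIsometryEquiv.piLpCongrLeft 2 ℝ ℝ
    (Equiv.sumComm (Fin d) (Fin d))).toContinuousLinearEquiv

theorem slice_swapSchwartz_apply (Φ : 𝓢(EuclideanSpace ℝ (Fin d ⊕ Fin d), ℂ))
    (x y : EuclideanSpace ℝ (Fin d)) : slice y (swapSchwartz Φ) x = Φ (pair x y) := by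
  rw [slice_apply]
  change Φ (LinearIsometryEquiv.piLpCongrLeft 2 ℝ ℝ (Equiv.sumComm (Fin d) (Fin d)) (pair y x)) = _
  congr 1
  ext i
  cases i <;> rfl

end Slices

/-! ### Windows in `M¹`: superposition of Schwartz windows and the upper bound. -/

section GeneralWindow

variable {d : ℕ}
  {U : 𝓢(EuclideanSpace ℝ (Fin d ⊕ Fin d), ℂ) ≃L[ℂ] 𝓢(EuclideanSpace ℝ (Fin d ⊕ Fin d), ℂ)}

/-- The superposition of `f ⊗ ḡ` from the tensors `f ⊗ conj (π(w)φ)`. -/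
theorem WignerKernel.exists_tensorDistribution_eq_integral (K : WignerKernel U)
    {φ : 𝓢(EuclideanSpace ℝ (Fin d), ℂ)} (hφ : φ ≠ 0) :
    ∃ m : ℂ, ∀ f g : 𝓢'(EuclideanSpace ℝ (Fin d), ℂ), Integrable (stft φ g) →
      ∀ Θ : 𝓢(EuclideanSpace ℝ (Fin d ⊕ Fin d), ℂ),
      tensorDistribution f (conjDistribution g) Θ = m * ∫ w, (starRingEnd ℂ) (stft φ g w) *
        tensorDistribution f (conjDistribution
          (timeFreqShift w φ : 𝓢'(EuclideanSpace ℝ (Fin d), ℂ))) Θ := by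
  obtain ⟨m, -, hM⟩ := K.exists_inversion hφ
  refine ⟨(starRingEnd ℂ) m, fun f g hg Θ => ?_⟩
  -- The functions `Θ(·, y)`, with the second variable frozen, obtained by swapping the blocks;
  -- these are what `f` acts on.
  set σ : EuclideanSpace ℝ (Fin d) → 𝓢(EuclideanSpace ℝ (Fin d), ℂ) :=
    fun y => slice y (swapSchwartz Θ) with hσ
  have hσc : Continuous σ := continuous_slice _
  have hσa : ∀ x y, σ y x = Θ (pair x y) := fun x y => slice_swapSchwartz_apply Θ x y
  set κ : EuclideanSpace ℝ (Fin d ⊕ Fin d) → EuclideanSpace ℝ (Fin d) → ℂ :=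
    fun w y => conjSchwartz (timeFreqShift w φ) y with hκ
  have hκn : ∀ w y, ‖κ w y‖ ≤ SchwartzMap.seminorm ℝ 0 0 φ :=
    norm_conjSchwartz_timeFreqShift_le φ
  have hκc : Continuous fun z : EuclideanSpace ℝ (Fin d ⊕ Fin d) × EuclideanSpace ℝ (Fin d) =>
      κ z.1 z.2 := continuous_conjSchwartz_timeFreqShift_apply φ
  set a : EuclideanSpace ℝ (Fin d ⊕ Fin d) → ℂ := fun w =>
    (starRingEnd ℂ) m * (starRingEnd ℂ) (stft φ g w) with ha
  have hac : Continuous a := continuous_const.mul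
    (Complex.continuous_conj.comp (continuous_stft φ g))
  have hai : Integrable a := by
    refine (hg.norm.const_mul ‖m‖).mono' hac.aestronglyMeasurable
      (Filter.Eventually.of_forall fun w => ?_)
    rw [ha, norm_mul, RCLike.norm_conj, RCLike.norm_conj]
  have hseg : ∀ k n, Integrable (fun z : EuclideanSpace ℝ (Fin d ⊕ Fin d) ×
      EuclideanSpace ℝ (Fin d) => ‖a z.1 * κ z.1 z.2‖ * SchwartzMap.seminorm ℝ k n (σ z.2))
      (volume.prod volume) := by
    intro k n
    have h1 := hai.norm.mul_prod (integrable_seminorm_slice (swapSchwartz Θ) k n)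
    have h2 := h1.mul_bdd (c := SchwartzMap.seminorm ℝ 0 0 φ) hκc.norm.aestronglyMeasurable
      (Filter.Eventually.of_forall fun p => by rw [norm_norm]; exact hκn p.1 p.2)
    refine h2.congr (Filter.Eventually.of_forall fun p => ?_)
    simp only [norm_mul, hσ]
    ring
  -- By the inversion formula for `g`, the test function that `f` sees is a double integral over
  -- `(w, y)` of the `σ y`. Then `f` goes under this integral once, Fubini separates `w` from `y`,
  -- and for each `w` the inner integral is recombined into `f` applied to one test function.
  have hχ : ∀ x, partialCLM (conjDistribution g) Θ x
      = ∫ z : EuclideanSpace ℝ (Fin d ⊕ Fin d) × EuclideanSpace ℝ (Fin d),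
        (a z.1 * κ z.1 z.2) * σ z.2 x ∂(volume.prod volume) := by
    intro x
    change conjDistribution g (slice x Θ) = _
    have hi : Integrable (fun z : EuclideanSpace ℝ (Fin d ⊕ Fin d) × EuclideanSpace ℝ (Fin d) =>
        (a z.1 * κ z.1 z.2) * σ z.2 x) (volume.prod volume) := by
      refine (hseg 0 0).mono' ?_ (Filter.Eventually.of_forall fun z => ?_)
      · exact (((hac.comp continuous_fst).mul hκc).mul ((continuous_schwartz_apply x).comp
          (hσc.comp continuous_snd))).aestronglyMeasurable
      · rw [norm_mul]
        gcongr
        exact norm_apply_le_seminorm _ _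
    rw [integral_prod _ hi, conjDistribution_apply, hM, map_mul, ← integral_conj,
      ← integral_const_mul]
    refine integral_congr_ae (Filter.Eventually.of_forall fun w => ?_)
    simp only [conjSchwartz_conjSchwartz, map_mul, Complex.conj_conj, mul_assoc]
    rw [integral_const_mul, stft, coe_schwartz_apply, ha]
    simp only [hσa, slice_apply]
    ring
  have hF := tempered_apply_eq_integral f (μ := volume.prod volume)
    (h := fun z : EuclideanSpace ℝ (Fin d ⊕ Fin d) × EuclideanSpace ℝ (Fin d) => a z.1 * κ z.1 z.2)
    (φ := fun z => σ z.2) ((hac.comp continuous_fst).mul hκc).aestronglyMeasurable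
    (hσc.comp continuous_snd) hseg hχ
  rw [tensorDistribution_apply, hF.2, integral_prod _ hF.1, ← integral_const_mul]
  refine integral_congr_ae (Filter.Eventually.of_forall fun w => ?_)
  simp only [mul_assoc]
  rw [integral_const_mul, tensorDistribution_apply, ha, mul_assoc]
  congr 2
  refine (tempered_apply_eq_integral f (μ := volume) (h := κ w) (φ := σ)
    (SchwartzMap.continuous _).aestronglyMeasurable hσc (fun k n => ?_) fun x => ?_).2.symm
  · have h1 := (integrable_seminorm_slice (swapSchwartz Θ) k n).mul_bdd
      (c := SchwartzMap.seminorm ℝ 0 0 φ) (SchwartzMap.continuous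
        (conjSchwartz (timeFreqShift w φ))).norm.aestronglyMeasurable
      (Filter.Eventually.of_forall fun p => by rw [norm_norm]; exact hκn w p)
    refine h1.congr (Filter.Eventually.of_forall fun y => ?_)
    simp only [hσ]
    rw [mul_comm]
  · rw [partialCLM_conjDistribution_apply]
    refine integral_congr_ae (Filter.Eventually.of_forall fun y => ?_)
    simp only [hσa]
    rw [mul_comm]
    rfl

/-- Composition with the linear map `A` of the window turns `π(w)` into `π(Rw)`, where `R(w₁, w₂) =
(A⁻¹w₁, Aᵀw₂)`. A shift of the window translates the modulus of the transform by `Rw`, hence by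
`-P⁻¹Rw` before the phase map `P`. -/
theorem WignerKernel.exists_norm_stft_window_timeFreqShift (K : WignerKernel U) :
    ∃ B : EuclideanSpace ℝ (Fin d ⊕ Fin d) →L[ℝ] EuclideanSpace ℝ (Fin d ⊕ Fin d),
      ∀ (f : 𝓢'(EuclideanSpace ℝ (Fin d), ℂ)) (g : 𝓢(EuclideanSpace ℝ (Fin d), ℂ)) w z,
      ‖stft (K.window (timeFreqShift w g)) f (K.phaseMap z)‖
        = ‖stft (K.window g) f (K.phaseMap (z - B w))‖ := by
  set A := K.windowEquiv with hA
  set R : EuclideanSpace ℝ (Fin d ⊕ Fin d) →L[ℝ] EuclideanSpace ℝ (Fin d ⊕ Fin d) :=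
    (inlL d).comp (A.symm.toContinuousLinearMap.comp (fstL d)) +
    (inrL d).comp ((ContinuousLinearMap.adjoint A.toContinuousLinearMap).comp (sndL d)) with hR
  have hRw : ∀ w, R w = pair (A.symm (fstPart w))
      (ContinuousLinearMap.adjoint A.toContinuousLinearMap (sndPart w)) := fun w => by
    rw [pair_eq]; rfl
  refine ⟨-(K.phaseEquiv.symm.toContinuousLinearEquiv.toContinuousLinearMap.comp R),
    fun f g w z => ?_⟩
  have h1 : K.window (timeFreqShift w g) = timeFreqShift (R w) (K.window g) := by
    ext t
    change timeFreqShift w g (A t) = _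
    rw [timeFreqShift_apply, timeFreqShift_apply, hRw, fstPart_pair, sndPart_pair]
    change _ = _ * g (A (t - A.symm (fstPart w)))
    rw [map_sub A, A.apply_symm_apply]
    congr 1
    rw [character, character, ContinuousLinearMap.adjoint_inner_left]
    rfl
  have h2 : K.phaseMap (z - (-(K.phaseEquiv.symm.toContinuousLinearEquiv.toContinuousLinearMap.comp
      R)) w) = K.phaseMap z + R w := by
    rw [← K.phaseEquiv_apply, ← K.phaseEquiv_apply]
    change K.phaseEquiv (z - -(K.phaseEquiv.symm (R w))) = _
    rw [sub_neg_eq_add, map_add, LinearEquiv.apply_symm_apply]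
  rw [h1, h2, norm_stft_timeFreqShift]

theorem exists_enorm_weight_abs_le_of_linear (s : ℝ)
    (B : EuclideanSpace ℝ (Fin d ⊕ Fin d) →L[ℝ] EuclideanSpace ℝ (Fin d ⊕ Fin d)) :
    ∃ c : ℝ≥0∞, c ≠ ⊤ ∧ ∀ w, ‖weight |s| (B w)‖ₑ ≤ c * ‖weight |s| w‖ₑ := by
  refine ⟨ENNReal.ofReal ((1 + ‖B‖ ^ 2) ^ (|s| / 2)), ENNReal.ofReal_ne_top, fun w => ?_⟩
  rw [Real.enorm_of_nonneg (weight_pos _ _).le, Real.enorm_of_nonneg (weight_pos _ _).le,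
    ← ENNReal.ofReal_mul (by positivity)]
  refine ENNReal.ofReal_le_ofReal ?_
  unfold weight
  rw [← Real.mul_rpow (by positivity) (by positivity)]
  refine Real.rpow_le_rpow (by positivity) ?_ (by positivity)
  have h1 := pow_le_pow_left₀ (norm_nonneg _) (B.le_opNorm w) 2
  nlinarith [sq_nonneg ‖w‖, sq_nonneg ‖B‖]

theorem modulationNorm_one_one (φ : 𝓢(EuclideanSpace ℝ (Fin d), ℂ)) (s : ℝ)
    (g : 𝓢'(EuclideanSpace ℝ (Fin d), ℂ)) :
    modulationNorm φ 1 1 s g = ∫⁻ w, ‖weight s w‖ₑ * ‖stft φ g w‖ₑ := by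
  rw [modulationNorm, mixedNorm_eq_mixE, mixE_one_one]
  exact (measurable_enorm_weight s).mul (continuous_stft φ g).measurable.enorm

theorem one_le_enorm_weight_abs (s : ℝ) (w : EuclideanSpace ℝ (Fin d ⊕ Fin d)) :
    1 ≤ ‖weight |s| w‖ₑ := by
  rw [Real.enorm_of_nonneg (weight_pos _ _).le, ENNReal.one_le_ofReal]
  exact Real.one_le_rpow (by nlinarith [sq_nonneg ‖w‖]) (by positivity)

theorem integrable_stft_of_memModulation {φ : 𝓢(EuclideanSpace ℝ (Fin d), ℂ)} {s : ℝ}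
    {g : 𝓢'(EuclideanSpace ℝ (Fin d), ℂ)} (hg : MemModulation φ 1 1 |s| g) :
    Integrable (stft φ g) := by
  refine ⟨(continuous_stft φ g).aestronglyMeasurable, ?_⟩
  rw [MemModulation, modulationNorm_one_one] at hg
  refine lt_of_le_of_lt (lintegral_mono fun w => ?_) hg
  exact le_mul_of_one_le_left' (one_le_enorm_weight_abs s w)

/-- The superposition of the functions `|W(f, π(w)φ)|` with the weights `|V_φ g(w)|`. -/
def WignerKernel.superposition (K : WignerKernel U) (φ : 𝓢(EuclideanSpace ℝ (Fin d), ℂ))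
    (f g : 𝓢'(EuclideanSpace ℝ (Fin d), ℂ)) (z : EuclideanSpace ℝ (Fin d ⊕ Fin d)) : ℝ≥0∞ :=
  ∫⁻ w, ‖stft φ g w‖ₑ * ‖stft (K.window (timeFreqShift w φ)) f (K.phaseMap z)‖ₑ

/-- Shifting the window translates the modulus, so the superposition is a generalized convolution,
with shifts `B w`. The weight moves under the integral at the cost of `v_{|s|}(Bw) ≤ b v_{|s|}(w)`,
and the kernel `v_{|s|}|V_φ g|` is integrable exactly because `g` lies in the weighted `M¹`. -/
theorem WignerKernel.exists_mixE_superposition_le (K : WignerKernel U)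
    {φ : 𝓢(EuclideanSpace ℝ (Fin d), ℂ)} (hφ : φ ≠ 0) {p q : ℝ≥0∞} (hp : 1 ≤ p) (hq : 1 ≤ q)
    (s : ℝ) {g : 𝓢'(EuclideanSpace ℝ (Fin d), ℂ)} (hg : MemModulation φ 1 1 |s| g) :
    ∃ C : ℝ≥0∞, C ≠ ⊤ ∧ ∀ f : 𝓢'(EuclideanSpace ℝ (Fin d), ℂ),
      mixE p q (fun z => ‖weight s z‖ₑ * K.superposition φ f g z)
        ≤ C * modulationNorm φ p q s f := by
  obtain ⟨B, hB⟩ := K.exists_norm_stft_window_timeFreqShift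
  obtain ⟨b, hbt, hb⟩ := exists_enorm_weight_abs_le_of_linear s B
  obtain ⟨c, hct, hc⟩ := exists_mixE_weight_comp_le s K.phaseEquiv (K.exists_mixE_comp_phaseMap p q)
  obtain ⟨a, hat, ha⟩ := K.exists_modulationNorm_le hφ (K.window φ)
    (zero_lt_one.trans_le hp).ne' (zero_lt_one.trans_le hq).ne' s
  set c₂ := ENNReal.ofReal (2 ^ (|s| / 2)) with hc₂
  have hc₂t : c₂ ≠ ⊤ := ENNReal.ofReal_ne_top
  set k : EuclideanSpace ℝ (Fin d ⊕ Fin d) → ℝ≥0∞ := fun w => ‖weight |s| w‖ₑ * ‖stft φ g w‖ₑ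
  have hkm : Measurable k := (measurable_enorm_weight _).mul (continuous_stft φ g).measurable.enorm
  have hkt : ∀ u, k u ≠ ⊤ := fun u => ENNReal.mul_ne_top enorm_ne_top enorm_ne_top
  have hkint : ∫⁻ u, k u ≠ ⊤ := by
    rw [MemModulation, modulationNorm_one_one] at hg
    exact hg.ne
  refine ⟨c₂ * b * ((∫⁻ w, k w) * (c * a)), ENNReal.mul_ne_top (ENNReal.mul_ne_top hc₂t hbt)
    (ENNReal.mul_ne_top hkint (ENNReal.mul_ne_top hct hat)), fun f => ?_⟩
  set H : EuclideanSpace ℝ (Fin d ⊕ Fin d) → ℝ≥0∞ := fun z =>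
    ‖weight s z‖ₑ * ‖stft (K.window φ) f (K.phaseMap z)‖ₑ
  have hH : Measurable H := (measurable_enorm_weight s).mul
    ((continuous_stft _ f).comp K.continuous_phaseMap).measurable.enorm
  have key : ∀ z, ‖weight s z‖ₑ * K.superposition φ f g z
      ≤ c₂ * b * ∫⁻ w, k w * H (z - B w) := by
    intro z
    rw [superposition, ← lintegral_const_mul' _ _ enorm_ne_top,
      ← lintegral_const_mul' _ _ (ENNReal.mul_ne_top hc₂t hbt)]
    refine lintegral_mono fun w => ?_
    have e : ‖stft (K.window (timeFreqShift w φ)) f (K.phaseMap z)‖ₑ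
        = ‖stft (K.window φ) f (K.phaseMap (z - B w))‖ₑ := by
      rw [← ofReal_norm, hB, ofReal_norm]
    simp only [e]
    calc ‖weight s z‖ₑ * (‖stft φ g w‖ₑ * ‖stft (K.window φ) f (K.phaseMap (z - B w))‖ₑ)
        ≤ (c₂ * (b * ‖weight |s| w‖ₑ) * ‖weight s (z - B w)‖ₑ) *
          (‖stft φ g w‖ₑ * ‖stft (K.window φ) f (K.phaseMap (z - B w))‖ₑ) := by
          gcongr
          refine (enorm_weight_le_mul s z (B w)).trans ?_
          gcongr
          exact hb w
      _ = _ := by ring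
  refine (mixE_mono _ _ key).trans ?_
  rw [mixE_const_mul _ _ (ENNReal.mul_ne_top hc₂t hbt), mul_assoc (c₂ * b),
    mul_assoc (∫⁻ w, k w), mul_assoc c]
  gcongr
  refine (mixE_convolution_le hp hq hH hkm hkt B.continuous.measurable).trans ?_
  gcongr
  refine (hc fun z => ‖stft (K.window φ) f z‖ₑ).trans ?_
  gcongr
  rw [← mixedNorm_eq_mixE]
  exact ha f

theorem mixE_schwartz_lt_top {p q : ℝ≥0∞} (hp : 1 ≤ p) (hq : 1 ≤ q) (s : ℝ)
    (Φ : 𝓢(EuclideanSpace ℝ (Fin d ⊕ Fin d), ℂ)) :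
    mixE p q (fun z => ‖weight s z‖ₑ * ‖Φ z‖ₑ) < ⊤ := by
  set n : ℝ := Module.finrank ℝ (EuclideanSpace ℝ (Fin d)) + 1 with hn
  have hn0 : 0 ≤ n := by positivity
  -- `|s|` absorbs the weight, and one factor `⟨z⟩^{-n}` is spent on each block, leaving a product
  -- whose mixed norm splits.
  obtain ⟨C, hCt, hC⟩ := schwartz_exists_enorm_le_bracket Φ (|s| + 2 * n)
  set k : EuclideanSpace ℝ (Fin d) → ℝ≥0∞ := fun u => bracket u ^ (-n) with hk
  have hk1 : ∀ u, k u ≤ 1 := fun u => bracket_rpow_le_one hn0 u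
  have hkint : ∫⁻ u, k u ≠ ⊤ := (lintegral_bracket_rpow_lt_top (by simp [hn])).ne
  have hle : ∀ z, ‖weight s z‖ₑ * ‖Φ z‖ₑ ≤ C * (k (sndPart z) * k (fstPart z)) := by
    intro z
    have h1 : ‖weight s z‖ₑ ≤ bracket z ^ |s| := by
      refine le_trans ?_ (enorm_weight_abs_le_bracket s z)
      rw [Real.enorm_of_nonneg (weight_pos _ _).le, Real.enorm_of_nonneg (weight_pos _ _).le]
      refine ENNReal.ofReal_le_ofReal (Real.rpow_le_rpow_of_exponent_le
        (by nlinarith [sq_nonneg ‖z‖]) ?_)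
      have := le_abs_self s
      linarith
    have h2 : bracket z ^ (-n) ≤ k (fstPart z) := by
      change bracket z ^ (-n) ≤ bracket (fstPart z) ^ (-n)
      rw [ENNReal.rpow_neg, ENNReal.rpow_neg, ENNReal.inv_le_inv]
      exact ENNReal.rpow_le_rpow (ENNReal.ofReal_le_ofReal (by
        have := norm_fstPart_le z; linarith)) hn0
    have h3 : bracket z ^ (-n) ≤ k (sndPart z) := by
      change bracket z ^ (-n) ≤ bracket (sndPart z) ^ (-n)
      rw [ENNReal.rpow_neg, ENNReal.rpow_neg, ENNReal.inv_le_inv]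
      exact ENNReal.rpow_le_rpow (ENNReal.ofReal_le_ofReal (by
        have := norm_sndPart_le z; linarith)) hn0
    have e : bracket z ^ |s| = bracket z ^ (|s| + 2 * n) * (bracket z ^ (-n) * bracket z ^ (-n)) := by
      rw [← ENNReal.rpow_add _ _ (bracket_ne_zero z) (bracket_ne_top z),
        ← ENNReal.rpow_add _ _ (bracket_ne_zero z) (bracket_ne_top z)]
      congr 1
      ring
    calc ‖weight s z‖ₑ * ‖Φ z‖ₑ ≤ bracket z ^ |s| * ‖Φ z‖ₑ := by gcongr
      _ = (bracket z ^ (|s| + 2 * n) * ‖Φ z‖ₑ) * (bracket z ^ (-n) * bracket z ^ (-n)) := by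
          rw [e]; ring
      _ ≤ C * (k (sndPart z) * k (fstPart z)) := by
          gcongr
          exact hC z
  refine (mixE_mono p q hle).trans_lt ?_
  rw [mixE_const_mul _ _ hCt]
  refine ENNReal.mul_lt_top hCt.lt_top ?_
  have h1 : mixE p q (fun z : EuclideanSpace ℝ (Fin d ⊕ Fin d) => k (sndPart z) * k (fstPart z))
      = eLpNorm k p volume * eLpNorm k q volume := by
    unfold mixE
    simp only [fstPart_pair, sndPart_pair]
    have h2 : ∀ ξ : EuclideanSpace ℝ (Fin d), eLpNorm (fun x : EuclideanSpace ℝ (Fin d) =>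
        k ξ * k x) p volume = eLpNorm k p volume * k ξ := fun ξ => by
      rw [eLpNorm_const_mul_ennreal (ne_top_of_le_ne_top ENNReal.one_ne_top (hk1 ξ)), mul_comm]
    simp_rw [h2]
    rw [eLpNorm_const_mul_ennreal (eLpNorm_lt_top_of_le_one hp hk1 hkint).ne]
  rw [h1]
  exact ENNReal.mul_lt_top (eLpNorm_lt_top_of_le_one hp hk1 hkint)
    (eLpNorm_lt_top_of_le_one hq hk1 hkint)

theorem enorm_weight_mul_neg (s : ℝ) (z : EuclideanSpace ℝ (Fin d ⊕ Fin d)) :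
    ‖weight s z‖ₑ * ‖weight (-s) z‖ₑ = 1 := by
  rw [← enorm_mul, weight, weight, ← Real.rpow_add (by positivity)]
  ring_nf
  simp

theorem WignerKernel.continuous_stft_window_timeFreqShift (K : WignerKernel U)
    (φ : 𝓢(EuclideanSpace ℝ (Fin d), ℂ)) (f : 𝓢'(EuclideanSpace ℝ (Fin d), ℂ)) :
    Continuous fun a : EuclideanSpace ℝ (Fin d ⊕ Fin d) × EuclideanSpace ℝ (Fin d ⊕ Fin d) =>
      stft (K.window (timeFreqShift a.1 φ)) f (K.phaseMap a.2) := by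
  have h1 : Continuous fun z : EuclideanSpace ℝ (Fin d ⊕ Fin d) => timeFreqShift z φ :=
    Continuous.comp (g := fun z : EuclideanSpace ℝ (Fin d ⊕ Fin d) ×
        𝓢(EuclideanSpace ℝ (Fin d), ℂ) => timeFreqShift z.1 z.2)
      (f := fun z => (z, φ)) continuous_timeFreqShift (Continuous.prodMk_left φ)
  have h2 : Continuous fun a : EuclideanSpace ℝ (Fin d ⊕ Fin d) ×
      EuclideanSpace ℝ (Fin d ⊕ Fin d) => K.window (timeFreqShift a.1 φ) :=
    K.window.continuous.comp (h1.comp continuous_fst)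
  have h3 : Continuous fun a : EuclideanSpace ℝ (Fin d ⊕ Fin d) ×
      EuclideanSpace ℝ (Fin d ⊕ Fin d) =>
        timeFreqShift (K.phaseMap a.2) (K.window (timeFreqShift a.1 φ)) :=
    Continuous.comp (g := fun z : EuclideanSpace ℝ (Fin d ⊕ Fin d) ×
        𝓢(EuclideanSpace ℝ (Fin d), ℂ) => timeFreqShift z.1 z.2)
      (f := fun a : EuclideanSpace ℝ (Fin d ⊕ Fin d) × EuclideanSpace ℝ (Fin d ⊕ Fin d) =>
        (K.phaseMap a.2, K.window (timeFreqShift a.1 φ))) continuous_timeFreqShift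
      ((K.continuous_phaseMap.comp continuous_snd).prodMk h2)
  exact (continuous_apply_conjSchwartz f).comp h3

/-- For a window `g` in `M¹`, the distribution `W(f, g)` is a function, with norm estimate. -/
theorem WignerKernel.exists_distMixedNorm_le (K : WignerKernel U)
    {φ : 𝓢(EuclideanSpace ℝ (Fin d), ℂ)} (hφ : φ ≠ 0) {p q : ℝ≥0∞} (hp : 1 ≤ p) (hq : 1 ≤ q)
    (s : ℝ) {g : 𝓢'(EuclideanSpace ℝ (Fin d), ℂ)} (hg : MemModulation φ 1 1 |s| g) :
    ∃ C : ℝ≥0∞, C ≠ ⊤ ∧ ∀ f : 𝓢'(EuclideanSpace ℝ (Fin d), ℂ), modulationNorm φ p q s f < ⊤ →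
      distMixedNorm p q s (wigner U f g) ≤ C * modulationNorm φ p q s f := by
  obtain ⟨m, hm⟩ := K.exists_tensorDistribution_eq_integral hφ
  obtain ⟨C, hCt, hC⟩ := K.exists_mixE_superposition_le hφ hp hq s hg
  refine ⟨‖m‖ₑ * ENNReal.ofReal K.modulus * C, ENNReal.mul_ne_top (ENNReal.mul_ne_top
    enorm_ne_top ENNReal.ofReal_ne_top) hCt, fun f hf => ?_⟩
  have hgi := integrable_stft_of_memModulation hg
  set I : EuclideanSpace ℝ (Fin d ⊕ Fin d) → EuclideanSpace ℝ (Fin d ⊕ Fin d) → ℂ := fun w z =>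
    (starRingEnd ℂ) (stft φ g w) * (K.factor z *
      stft (K.window (timeFreqShift w φ)) f (K.phaseMap z)) with hI
  have hIc : Continuous fun a : EuclideanSpace ℝ (Fin d ⊕ Fin d) ×
      EuclideanSpace ℝ (Fin d ⊕ Fin d) => I a.1 a.2 :=
    (Complex.continuous_conj.comp ((continuous_stft φ g).comp continuous_fst)).mul
      ((K.continuous_factor.comp continuous_snd).mul (K.continuous_stft_window_timeFreqShift φ f))
  have hIn : ∀ w z, ‖I w z‖ₑ = ENNReal.ofReal K.modulus * (‖stft φ g w‖ₑ *
      ‖stft (K.window (timeFreqShift w φ)) f (K.phaseMap z)‖ₑ) := fun w z => by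
    rw [hI, enorm_mul, enorm_mul, RCLike.enorm_conj, ← ofReal_norm (K.factor z), K.norm_factor]
    ring
  have hIl : ∀ z, ∫⁻ w, ‖I w z‖ₑ = ENNReal.ofReal K.modulus * K.superposition φ f g z := fun z => by
    simp only [hIn]
    rw [lintegral_const_mul' _ _ ENNReal.ofReal_ne_top]
    rfl
  -- The candidate for `W(f, g)`: the superposition of the functions `W(f, π(w)φ)` dictated by the
  -- expansion of `f ⊗ ḡ`.
  set G : EuclideanSpace ℝ (Fin d ⊕ Fin d) → ℂ := fun z => m * ∫ w, I w z with hG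
  have hsup : Measurable fun z => K.superposition φ f g z := by
    refine Measurable.lintegral_prod_right' (f := fun a : EuclideanSpace ℝ (Fin d ⊕ Fin d) ×
      EuclideanSpace ℝ (Fin d ⊕ Fin d) => ‖stft φ g a.2‖ₑ *
        ‖stft (K.window (timeFreqShift a.2 φ)) f (K.phaseMap a.1)‖ₑ) ?_
    exact ((continuous_stft φ g).comp continuous_snd).measurable.enorm.mul
      ((K.continuous_stft_window_timeFreqShift φ f).comp
        (continuous_snd.prodMk continuous_fst)).measurable.enorm
  -- Absolute convergence for Fubini. Insert `1 = v_s v_{-s}` and use Hölder with conjugate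
  -- exponents: the superposition has finite `L^{p,q}_{v_s}` norm because `f` lies in the modulation
  -- space, and `Φ` lies in every dual weighted space.
  have hprod : ∀ Φ : 𝓢(EuclideanSpace ℝ (Fin d ⊕ Fin d), ℂ), Integrable (fun a :
      EuclideanSpace ℝ (Fin d ⊕ Fin d) × EuclideanSpace ℝ (Fin d ⊕ Fin d) => Φ a.2 * I a.1 a.2)
      (volume.prod volume) := by
    intro Φ
    have hc : Continuous fun a : EuclideanSpace ℝ (Fin d ⊕ Fin d) ×
        EuclideanSpace ℝ (Fin d ⊕ Fin d) => Φ a.2 * I a.1 a.2 :=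
      (Φ.continuous.comp continuous_snd).mul hIc
    refine ⟨hc.aestronglyMeasurable, ?_⟩
    rw [HasFiniteIntegral, lintegral_prod_symm _ hc.measurable.enorm.aemeasurable]
    simp only [enorm_mul]
    have h1 : ∀ z, ∫⁻ w, ‖Φ z‖ₑ * ‖I w z‖ₑ = ENNReal.ofReal K.modulus *
        ((‖weight s z‖ₑ * K.superposition φ f g z) * (‖weight (-s) z‖ₑ * ‖Φ z‖ₑ)) := by
      intro z
      rw [lintegral_const_mul' _ _ enorm_ne_top, hIl]
      calc _ = (‖weight s z‖ₑ * ‖weight (-s) z‖ₑ) *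
            (‖Φ z‖ₑ * (ENNReal.ofReal K.modulus * K.superposition φ f g z)) := by
            rw [enorm_weight_mul_neg, one_mul]
        _ = _ := by ring
    simp only [h1]
    rw [lintegral_const_mul' _ _ ENNReal.ofReal_ne_top]
    refine ENNReal.mul_lt_top ENNReal.ofReal_lt_top ?_
    have := ENNReal.HolderConjugate.conjExponent hp
    have := ENNReal.HolderConjugate.conjExponent hq
    refine (lintegral_mul_le_mixE (p := p) (q := q) (p' := p.conjExponent) (q' := q.conjExponent)
      ((measurable_enorm_weight s).mul hsup)
      ((measurable_enorm_weight (-s)).mul Φ.continuous.measurable.enorm)).trans_lt ?_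
    refine ENNReal.mul_lt_top ((hC f).trans_lt (ENNReal.mul_lt_top hCt.lt_top hf)) ?_
    exact mixE_schwartz_lt_top (by simp [ENNReal.conjExponent]) (by simp [ENNReal.conjExponent])
      (-s) Φ
  -- Exchange the integrals over `w` and `z`; for fixed `w` the inner one is `W(f, π(w)φ)` tested on
  -- `Φ`, a Schwartz-window case already known.
  have hGiven : IsGivenBy (wigner U f g) G := by
    refine ⟨?_, fun Φ => ?_⟩
    · exact (hIc.aestronglyMeasurable.prod_swap.integral_prod_right'
        (μ := volume) (ν := volume)).const_mul m
    · have e1 : ∀ z, Φ z * G z = m * ∫ w, Φ z * I w z := fun z => by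
        rw [hG, integral_const_mul]; ring
      have h1 := hprod Φ
      simp only [e1]
      refine ⟨h1.integral_prod_right.const_mul m, ?_⟩
      rw [integral_const_mul, ← integral_integral_swap h1]
      refine (hm f g hgi (conjSchwartz (U.symm (conjSchwartz Φ)))).trans ?_
      congr 2
      funext w
      have h2 := ((K.isGivenBy_wigner f (timeFreqShift w φ)).2 Φ).2
      change tensorDistribution f (conjDistribution
          (timeFreqShift w φ : 𝓢'(EuclideanSpace ℝ (Fin d), ℂ)))
          (conjSchwartz (U.symm (conjSchwartz Φ))) = _ at h2
      rw [h2, ← integral_const_mul]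
      congr 1
      funext z
      rw [hI]
      ring
  refine (iInf₂_le G hGiven).trans ?_
  rw [mixedNorm_eq_mixE, mul_assoc]
  refine le_trans ?_ (mul_le_mul_right (hC f) (‖m‖ₑ * ENNReal.ofReal K.modulus))
  rw [← mixE_const_mul _ _ (ENNReal.mul_ne_top enorm_ne_top ENNReal.ofReal_ne_top)]
  refine mixE_mono _ _ fun z => ?_
  rw [mul_left_comm]
  gcongr
  rw [hG, enorm_mul, mul_assoc, ← hIl]
  gcongr
  exact enorm_integral_le_lintegral_enorm _

end GeneralWindow

end TFA
end

/-! ### The main theorem. -/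

theorem theorem2p20 (d : ℕ)
    (A : Matrix ((Fin d ⊕ Fin d) ⊕ (Fin d ⊕ Fin d)) ((Fin d ⊕ Fin d) ⊕ (Fin d ⊕ Fin d)) ℝ)
    (hA : A ∈ Matrix.symplecticGroup (Fin d ⊕ Fin d) ℝ)
    (hcov : IsCovariant A)
    (U : 𝓢(EuclideanSpace ℝ (Fin d ⊕ Fin d), ℂ) ≃L[ℂ] 𝓢(EuclideanSpace ℝ (Fin d ⊕ Fin d), ℂ))
    (hU : IsMetaplectic A U)
    (hL : IsPartialFourierRescale U)
    (hinv : IsShiftInvertible U)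
    (p q : ℝ≥0∞) (hp : p ≠ 0) (hq : q ≠ 0) (s : ℝ)
    (φ : 𝓢(EuclideanSpace ℝ (Fin d), ℂ)) (hφ : φ ≠ 0) :
    (IsUnit A.toBlocks₁₁.toBlocks₁₁.det ∧ IsUnit (1 - A.toBlocks₁₁.toBlocks₁₁).det) ∧
    (∀ g : 𝓢(EuclideanSpace ℝ (Fin d), ℂ), g ≠ 0 →
      (∀ f : 𝓢'(EuclideanSpace ℝ (Fin d), ℂ),
        MemModulation φ p q s f ↔
          MemMixed p q s (wigner U f (g : 𝓢'(EuclideanSpace ℝ (Fin d), ℂ)))) ∧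
      ∃ C : NNReal, 0 < C ∧ ∀ f : 𝓢'(EuclideanSpace ℝ (Fin d), ℂ),
        modulationNorm φ p q s f ≤
            C * distMixedNorm p q s (wigner U f (g : 𝓢'(EuclideanSpace ℝ (Fin d), ℂ))) ∧
          distMixedNorm p q s (wigner U f (g : 𝓢'(EuclideanSpace ℝ (Fin d), ℂ))) ≤
            C * modulationNorm φ p q s f) ∧
    (1 ≤ p → 1 ≤ q →
      ∀ g : 𝓢'(EuclideanSpace ℝ (Fin d), ℂ), g ≠ 0 → MemModulation φ 1 1 |s| g →
        (∀ f : 𝓢'(EuclideanSpace ℝ (Fin d), ℂ),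
          MemModulation φ p q s f ↔ MemMixed p q s (wigner U f g)) ∧
        ∃ C : NNReal, 0 < C ∧ ∀ f : 𝓢'(EuclideanSpace ℝ (Fin d), ℂ),
          modulationNorm φ p q s f ≤ C * distMixedNorm p q s (wigner U f g) ∧
            distMixedNorm p q s (wigner U f g) ≤ C * modulationNorm φ p q s f) := by
  obtain ⟨M, A₁₃, A₂₁, -, -, rfl⟩ := hcov
  obtain ⟨c₀, hc₀, hform⟩ := exists_eq_partialFourier hU hL
  obtain ⟨hM, hN⟩ := isUnit_det_of_isShiftInvertible hform hinv
  obtain ⟨K⟩ := nonempty_wignerKernel hU.1 hc₀ hform hM hN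
  refine ⟨?_, fun g hg => K.schwartz_window hp hq s hφ hg, fun hp1 hq1 g hg hgM => ?_⟩
  · simpa only [Matrix.toBlocks_fromBlocks₁₁] using And.intro hM hN
  -- For windows in `M¹` the two bounds have different sources: the reproducing formula needs only
  -- `g ≠ 0`, the superposition needs the integrability of `V_φ g`.
  · obtain ⟨C₁, hC₁, h₁⟩ := K.exists_modulationNorm_le_mixedNorm hg φ hp1 hq1 s
    obtain ⟨C₂, hC₂, h₂⟩ := K.exists_distMixedNorm_le hφ hp1 hq1 s hgM
    exact memModulation_iff_and_equivalence hC₁ hC₂ h₁ h₂
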